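/- Let $I\subseteq\mathbb R$ be a nonempty open interval. A \emph{coefficient} is a smooth function $b:I\to(0,\infty)$, and we consider, for $t\in I$ and $(x,y)\in\mathbb R^2$, the equation $$u_t=u_{xx}+b(t)\,u_{yy}.\qquad(E_b)$$ \textbf{(1) Reduction to constant coefficients.} Let $b$ be a coefficient and $K:I\to\mathbb R\setminus\{0\}$ smooth. The transformation $$u(t,x,y)=K(t)\exp\Big[-\frac{b'(t)}{b(t)^2}\,\frac{y^2}{8}\Big]\,v(t,x,\eta),\qquad \eta=\frac{y}{\sqrt{b(t)}},$$ maps $(E_b)$ to $v_t=v_{xx}+v_{\eta\eta}$ (i.e. for every smooth $v$, $u$ solves $(E_b)$ if and only if $v$ solves the latter equation) if and only if $$4bK'+Kb'=0\quad\text{and}\quad 2bb''=3b'^2\quad\text{on } I .$$ These two equations hold if and only if there are constants $b_1,b_0,k_0\in\mathbb R$, $k_0\neq0$, with $b_1t+b_0>0$, $b(t)=(b_1t+b_0)^{-2}$ and $K(t)=k_0\,b(t)^{-1/4}=k_0(b_1t+b_0)^{1/2}$ on $I$. \textbf{(2) Symmetry classification.} Let $\mathfrak g_b$ be the Lie algebra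 of infinitesimal Lie point symmetries of $(E_b)$ modulo the trivial superposition symmetries $f(t,x,y)\partial_u$, $f$ a solution of $(E_b)$. Here an infinitesimal Lie point symmetry is a smooth vector field in $(t,x,y,u)\in I\times\mathbb R^3$ whose second prolongation annihilates the equation on its solution set in the second jet space. (a) $\dim\mathfrak g_b=9$ if and only if $b$ is constant or, up to a translation of $t$, proportional to $t^{-2}$, i.e. $b(t)=c\,(t-t_0)^{-2}$ on $I$ for some $c>0$ and $t_0\in\mathbb R\setminus I$. Otherwise $\dim\mathfrak g_b\le 6$. (b) For every coefficient $b$ and every antiderivative $B$ of $b$, the fields $$X_1=t\partial_x-\tfrac{xu}{2}\partial_u,\quad X_2=\partial_x,\quad X_3=B(t)\partial_y-\tfrac{yu}{2}\partial_u,\quad X_4=\partial_y,\quad X_5=u\partial_u$$ are symmetries, are linearly independent modulo the superposition symmetries, and span a five-dimensional Heisenberg algebra $\mathfrak h_2$: with $a_1=X_1$, $a_2=X_3$, $a_1^+=2X_2$, $a_2^+=2X_4$ and the central element $X_5$ one has $[a_i,a_j]=[a_i^+,a_j^+]=0$ and $[a_i,a_j^+]=\delta_{ij}X_5$. (c) For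 generic $b$ there is nothing else: the set of coefficients $b$ for which $X_1,\dots,X_5$ is a basis of $\mathfrak g_b$ is open and dense in the set of all coefficients on $I$, in the topology of uniform convergence of all derivatives on compact subsets of $I$. (d) Let $I\subseteq(0,\infty)$ and $b(t)=\beta t^{\alpha}$ with $\beta>0$, $\alpha\in\mathbb R$. Then $X_6=2t\partial_t+x\partial_x+(\alpha+1)y\partial_y$ is a symmetry. If $\alpha\notin\{0,-2\}$, then $X_1,\dots,X_6$ is a basis of $\mathfrak g_b$. If $\alpha\in\{0,-2\}$, then $X_1,\dots,X_6$ can be completed by three further symmetries to a basis of $\mathfrak g_b$. -/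

import Mathlib

open scoped ContDiff

noncomputable section

/-- The `i`-th partial derivative of `g` on `ℝⁿ`. -/
def pd {n : ℕ} (i : Fin n) (g : (Fin n → ℝ) → ℝ) (z : Fin n → ℝ) : ℝ :=
  fderiv ℝ g z (Pi.single i 1)

/-- The points of `ℝ^(n+1)` whose zeroth coordinate, the time `t`, lies in `I`. -/
def slab (n : ℕ) (I : Set ℝ) : Set (Fin (n + 1) → ℝ) := {z | z 0 ∈ I}

/-- `b` is a smooth positive function on `I`. -/
def IsCoefficient (I : Set ℝ) (b : ℝ → ℝ) : Prop :=
  ContDiffOn ℝ ∞ b I ∧ ∀ t ∈ I, 0 < b t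

/-! ### The equation and the transformation

Functions of `(t, x, y)` are functions of `z : Fin 3 → ℝ`, with `t = z 0`, `x = z 1`, `y = z 2`. -/

/-- `u` is a smooth solution of `u_t = u_xx + b(t) u_yy` for `t ∈ I`, `(x, y) ∈ ℝ²`. -/
def IsSolution (I : Set ℝ) (b : ℝ → ℝ) (u : (Fin 3 → ℝ) → ℝ) : Prop :=
  ContDiffOn ℝ ∞ u (slab 2 I) ∧
    ∀ z ∈ slab 2 I, pd 0 u z = pd 1 (pd 1 u) z + b (z 0) * pd 2 (pd 2 u) z

/-- `u(t,x,y) = K(t) exp(-(b'/b²) y²/8) v(t, x, y/√b(t))`. -/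
def pointTransform (b K : ℝ → ℝ) (v : (Fin 3 → ℝ) → ℝ) (z : Fin 3 → ℝ) : ℝ :=
  K (z 0) * Real.exp (-(deriv b (z 0) / b (z 0) ^ 2) * (z 2 ^ 2 / 8))
    * v ![z 0, z 1, z 2 / Real.sqrt (b (z 0))]

/-- The transformation turns `u_t = u_xx + b(t) u_yy` into `v_t = v_xx + v_ηη`. -/
def MapsToStandard (I : Set ℝ) (b K : ℝ → ℝ) : Prop :=
  ∀ v : (Fin 3 → ℝ) → ℝ, ContDiffOn ℝ ∞ v (slab 2 I) →
    (IsSolution I b (pointTransform b K v) ↔ IsSolution I (fun _ => 1) v)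

/-! ### Lie point symmetries

A vector field on the space of `(t, x, y, u)` is a map `X` on `Fin 4 → ℝ`, with `t = z 0`,
`x = z 1`, `y = z 2`, `u = z 3`; it stands for `X⁰ ∂_t + X¹ ∂_x + X² ∂_y + X³ ∂_u`. A vector field
on the slab `t ∈ I` is extended by `0` outside the slab. -/

/-- Vector fields in the variables `(t, x, y, u)`. -/
abbrev VField : Type := (Fin 4 → ℝ) → (Fin 4 → ℝ)

/-- The total derivative `D_i g = g_i + u_i g_u` of a function `g(t,x,y,u)`, on the jet whose first
derivatives `u_i` are `p i`. -/
def totalD (i : Fin 3) (g : (Fin 4 → ℝ) → ℝ) (z : Fin 4 → ℝ) (p : Fin 3 → ℝ) : ℝ :=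
  pd i.castSucc g z + p i * pd 3 g z

/-- The iterated total derivative `D_i D_j g`, on the jet with first derivatives `p` and second
derivatives `q`. -/
def totalDD (i j : Fin 3) (g : (Fin 4 → ℝ) → ℝ) (z : Fin 4 → ℝ) (p : Fin 3 → ℝ)
    (q : Fin 3 → Fin 3 → ℝ) : ℝ :=
  pd i.castSucc (pd j.castSucc g) z + p i * pd j.castSucc (pd 3 g) z
    + p j * pd i.castSucc (pd 3 g) z + p i * p j * pd 3 (pd 3 g) z + q i j * pd 3 g z

/-- The coefficient `η^i = D_i η - ∑_k u_k D_i ξ^k` of `∂/∂u_i` in the prolongation of `X`. -/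
def prolong1 (X : VField) (i : Fin 3) (z : Fin 4 → ℝ) (p : Fin 3 → ℝ) : ℝ :=
  totalD i (fun w => X w 3) z p - ∑ k : Fin 3, p k * totalD i (fun w => X w k.castSucc) z p

/-- The coefficient `η^{ij} = D_j η^i - ∑_k u_{ik} D_j ξ^k` of `∂/∂u_{ij}` in the second
prolongation of `X`, expanded. -/
def prolong2 (X : VField) (i j : Fin 3) (z : Fin 4 → ℝ) (p : Fin 3 → ℝ)
    (q : Fin 3 → Fin 3 → ℝ) : ℝ :=
  totalDD i j (fun w => X w 3) z p q
    - ∑ k : Fin 3, (p k * totalDD i j (fun w => X w k.castSucc) z p q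
        + q j k * totalD i (fun w => X w k.castSucc) z p
        + q i k * totalD j (fun w => X w k.castSucc) z p)

/-- The second prolongation of `X` applied to the function `u_t - u_xx - b(t) u_yy` on the jet
space. -/
def prolongEq (b : ℝ → ℝ) (X : VField) (z : Fin 4 → ℝ) (p : Fin 3 → ℝ)
    (q : Fin 3 → Fin 3 → ℝ) : ℝ :=
  prolong1 X 0 z p - prolong2 X 1 1 z p q - b (z 0) * prolong2 X 2 2 z p q
    - X z 0 * deriv b (z 0) * q 2 2

/-- `X` is an infinitesimal Lie point symmetry of `u_t = u_xx + b(t) u_yy`, `t ∈ I`: a smooth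
vector field on the slab (zero outside it) whose second prolongation annihilates the equation at
every point of the second jet space where the equation holds. -/
structure IsPointSymmetry (I : Set ℝ) (b : ℝ → ℝ) (X : VField) : Prop where
  zero_off : ∀ z, z ∉ slab 3 I → X z = 0
  smooth : ∀ z ∈ slab 3 I, ContDiffAt ℝ ∞ X z
  annihilates : ∀ z ∈ slab 3 I, ∀ (p : Fin 3 → ℝ) (q : Fin 3 → Fin 3 → ℝ),
    (∀ i j, q i j = q j i) → p 0 = q 1 1 + b (z 0) * q 2 2 → prolongEq b X z p q = 0

theorem contDiffAt_comp {X : VField} {z : Fin 4 → ℝ} (h : ContDiffAt ℝ ∞ X z) (k : Fin 4) :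
    ContDiffAt ℝ ∞ (fun w => X w k) z :=
  contDiffAt_pi.1 h k

theorem pd_add {f g : (Fin 4 → ℝ) → ℝ} {z : Fin 4 → ℝ} (hf : ContDiffAt ℝ ∞ f z)
    (hg : ContDiffAt ℝ ∞ g z) (i : Fin 4) :
    pd i (fun w => f w + g w) z = pd i f z + pd i g z := by
  unfold pd
  rw [fderiv_fun_add (hf.differentiableAt (by simp)) (hg.differentiableAt (by simp))]
  rfl

theorem pd_smul (c : ℝ) {f : (Fin 4 → ℝ) → ℝ} {z : Fin 4 → ℝ} (hf : ContDiffAt ℝ ∞ f z)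
    (i : Fin 4) : pd i (fun w => c * f w) z = c * pd i f z := by
  unfold pd
  rw [fderiv_const_mul (hf.differentiableAt (by simp))]
  rfl

theorem contDiffAt_pd {f : (Fin 4 → ℝ) → ℝ} {z : Fin 4 → ℝ} (hf : ContDiffAt ℝ ∞ f z)
    (i : Fin 4) : ContDiffAt ℝ ∞ (pd i f) z := by
  have h : ContDiffAt ℝ ∞ (fderiv ℝ f) z := hf.fderiv_right (by simp)
  exact h.clm_apply contDiffAt_const

theorem eventually_diff {f : (Fin 4 → ℝ) → ℝ} {z : Fin 4 → ℝ} (hf : ContDiffAt ℝ ∞ f z) :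
    ∀ᶠ w in nhds z, DifferentiableAt ℝ f w := by
  have h1 : ContDiffAt ℝ 1 f z := hf.of_le (by exact_mod_cast le_top)
  filter_upwards [h1.eventually (by simp)] with w hw
  exact hw.differentiableAt (by simp)

theorem pd_pd_add {f g : (Fin 4 → ℝ) → ℝ} {z : Fin 4 → ℝ} (hf : ContDiffAt ℝ ∞ f z)
    (hg : ContDiffAt ℝ ∞ g z) (i j : Fin 4) :
    pd i (pd j (fun w => f w + g w)) z = pd i (pd j f) z + pd i (pd j g) z := by
  rw [← pd_add (contDiffAt_pd hf j) (contDiffAt_pd hg j) i]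
  have h : pd j (fun w => f w + g w) =ᶠ[nhds z] fun w => pd j f w + pd j g w := by
    filter_upwards [eventually_diff hf, eventually_diff hg] with w h1 h2
    unfold pd
    rw [fderiv_fun_add h1 h2]
    rfl
  show fderiv ℝ _ z _ = fderiv ℝ _ z _
  rw [h.fderiv_eq]

theorem pd_pd_smul (c : ℝ) {f : (Fin 4 → ℝ) → ℝ} {z : Fin 4 → ℝ} (hf : ContDiffAt ℝ ∞ f z)
    (i j : Fin 4) : pd i (pd j (fun w => c * f w)) z = c * pd i (pd j f) z := by
  rw [← pd_smul c (contDiffAt_pd hf j) i]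
  have h : pd j (fun w => c * f w) =ᶠ[nhds z] fun w => c * pd j f w := by
    filter_upwards [eventually_diff hf] with w h1
    unfold pd
    rw [fderiv_const_mul h1]
    rfl
  show fderiv ℝ _ z _ = fderiv ℝ _ z _
  rw [h.fderiv_eq]

theorem prolongEq_add (b : ℝ → ℝ) {X Y : VField} {z : Fin 4 → ℝ} (hX : ContDiffAt ℝ ∞ X z)
    (hY : ContDiffAt ℝ ∞ Y z) (p : Fin 3 → ℝ) (q : Fin 3 → Fin 3 → ℝ) :
    prolongEq b (X + Y) z p q = prolongEq b X z p q + prolongEq b Y z p q := by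
  have h1 := fun (k i : Fin 4) => pd_add (contDiffAt_comp hX k) (contDiffAt_comp hY k) i
  have h2 := fun (k i j : Fin 4) => pd_pd_add (contDiffAt_comp hX k) (contDiffAt_comp hY k) i j
  simp only [prolongEq, prolong1, prolong2, totalD, totalDD, Pi.add_apply, h1, h2,
    Fin.sum_univ_three]
  ring

theorem prolongEq_smul (b : ℝ → ℝ) (c : ℝ) {X : VField} {z : Fin 4 → ℝ}
    (hX : ContDiffAt ℝ ∞ X z) (p : Fin 3 → ℝ) (q : Fin 3 → Fin 3 → ℝ) :
    prolongEq b (c • X) z p q = c * prolongEq b X z p q := by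
  have h1 := fun (k i : Fin 4) => pd_smul c (contDiffAt_comp hX k) i
  have h2 := fun (k i j : Fin 4) => pd_pd_smul c (contDiffAt_comp hX k) i j
  simp only [prolongEq, prolong1, prolong2, totalD, totalDD, Pi.smul_apply, smul_eq_mul, h1, h2,
    Fin.sum_univ_three]
  ring

theorem prolongEq_zero (b : ℝ → ℝ) (z : Fin 4 → ℝ) (p : Fin 3 → ℝ) (q : Fin 3 → Fin 3 → ℝ) :
    prolongEq b 0 z p q = 0 := by
  have h := prolongEq_smul b 0 (X := 0) (z := z) contDiffAt_const p q
  simpa using h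

/-- The real vector space of all Lie point symmetries. -/
def pointSymmetries (I : Set ℝ) (b : ℝ → ℝ) : Submodule ℝ VField where
  carrier := {X | IsPointSymmetry I b X}
  zero_mem' := ⟨fun _ _ => rfl, fun _ _ => contDiffAt_const,
    fun z _ p q _ _ => prolongEq_zero b z p q⟩
  add_mem' := by
    intro X Y hX hY
    refine ⟨fun z hz => ?_, fun z hz => (hX.smooth z hz).add (hY.smooth z hz),
      fun z hz p q hq he => ?_⟩
    · simp [hX.zero_off z hz, hY.zero_off z hz]
    · rw [prolongEq_add b (hX.smooth z hz) (hY.smooth z hz), hX.annihilates z hz p q hq he,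
        hY.annihilates z hz p q hq he, add_zero]
  smul_mem' := by
    intro c X hX
    refine ⟨fun z hz => ?_, fun z hz => contDiffAt_const.smul (hX.smooth z hz),
      fun z hz p q hq he => ?_⟩
    · simp [hX.zero_off z hz]
    · rw [prolongEq_smul b c (hX.smooth z hz), hX.annihilates z hz p q hq he, mul_zero]

/-- The trivial symmetries `f(t,x,y) ∂_u` that express the superposition rule of the linear
equation (the symmetry condition then says that `f` is a solution). -/
def superpositionSymmetries (I : Set ℝ) (b : ℝ → ℝ) : Submodule ℝ VField where
  carrier := {X | X ∈ pointSymmetries I b ∧ (∀ z, ∀ k : Fin 3, X z k.castSucc = 0) ∧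
    ∀ z s, X (Function.update z 3 s) 3 = X z 3}
  zero_mem' := ⟨Submodule.zero_mem _, fun _ _ => rfl, fun _ _ => rfl⟩
  add_mem' := by
    rintro X Y ⟨hX, hX1, hX2⟩ ⟨hY, hY1, hY2⟩
    exact ⟨Submodule.add_mem _ hX hY, fun z k => by simp [hX1, hY1],
      fun z s => by simp [hX2, hY2]⟩
  smul_mem' := by
    rintro c X ⟨hX, hX1, hX2⟩
    exact ⟨Submodule.smul_mem _ c hX, fun z k => by simp [hX1], fun z s => by simp [hX2]⟩

/-- The dimension of the symmetry algebra: all Lie point symmetries modulo the superposition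
symmetries. -/
def symmetryDim (I : Set ℝ) (b : ℝ → ℝ) : Cardinal :=
  Module.rank ℝ
    (pointSymmetries I b ⧸ (superpositionSymmetries I b).submoduleOf (pointSymmetries I b))

/-- The vector fields `X i` are linearly independent modulo the superposition symmetries. -/
def IndepModSuperposition (I : Set ℝ) (b : ℝ → ℝ) {ι : Type} (X : ι → VField) : Prop :=
  LinearIndependent ℝ fun i => (superpositionSymmetries I b).mkQ (X i)

/-- The vector fields `X i` form a basis of the symmetry algebra (modulo the superposition
symmetries). -/
def IsSymmetryBasis (I : Set ℝ) (b : ℝ → ℝ) {ι : Type} (X : ι → VField) : Prop :=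
  IndepModSuperposition I b X ∧
    Submodule.span ℝ (Set.range X) ⊔ superpositionSymmetries I b = pointSymmetries I b

/-- The vector field on the slab `t ∈ I` with the given coefficients, extended by zero. -/
def slabField (I : Set ℝ) (F : VField) : VField := (slab 3 I).indicator F

/-- The five fields `t ∂_x - (x u / 2) ∂_u`, `∂_x`, `B(t) ∂_y - (y u / 2) ∂_u`, `∂_y`, `u ∂_u`. -/
def h2Fields (I : Set ℝ) (B : ℝ → ℝ) : Fin 5 → VField :=
  ![slabField I fun z => ![0, z 0, 0, -(z 1 * z 3) / 2],
    slabField I fun _ => ![0, 1, 0, 0],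
    slabField I fun z => ![0, 0, B (z 0), -(z 3 * z 2) / 2],
    slabField I fun _ => ![0, 0, 1, 0],
    slabField I fun z => ![0, 0, 0, z 3]]

/-- The field `2t ∂_t + x ∂_x + (α + 1) y ∂_y`. -/
def scalingField (I : Set ℝ) (α : ℝ) : VField :=
  slabField I fun z => ![2 * z 0, z 1, (α + 1) * z 2, 0]

/-- The commutation relations of the Heisenberg algebra `h_n` for generators `a_i`, `a⁺_i` and a
central element `c`: `[a_i, a_j] = [a⁺_i, a⁺_j] = 0`, `[a_i, a⁺_j] = δ_ij c`. -/
structure HeisenbergRelations {n : ℕ} (a a' : Fin n → VField) (c : VField) : Prop where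
  lower : ∀ i j, VectorField.lieBracket ℝ (a i) (a j) = 0
  raise : ∀ i j, VectorField.lieBracket ℝ (a' i) (a' j) = 0
  mixed : ∀ i j, VectorField.lieBracket ℝ (a i) (a' j) = if i = j then c else 0
  central : ∀ i, VectorField.lieBracket ℝ (a i) c = 0 ∧ VectorField.lieBracket ℝ (a' i) c = 0

/-- The symmetry algebra for the coefficient `b` is spanned by the five fields `h2Fields` for an
antiderivative `B` of `b`. -/
def HasOnlyH2 (I : Set ℝ) (b : ℝ → ℝ) : Prop :=
  ∃ B : ℝ → ℝ, (∀ t ∈ I, HasDerivAt B (b t) t) ∧ IsSymmetryBasis I b (h2Fields I B)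

/-- `b₁` and `b₂` and their derivatives up to order `N` differ by less than `ε` on `J`; for compact
`J ⊆ I` these are the basic neighbourhoods of the `C^∞` topology on smooth functions on `I`. -/
def CkClose (J : Set ℝ) (N : ℕ) (ε : ℝ) (b₁ b₂ : ℝ → ℝ) : Prop :=
  ∀ k ≤ N, ∀ t ∈ J, |iteratedDeriv k b₁ t - iteratedDeriv k b₂ t| < ε

end

/-!
The determining equations of the symmetries of `u_t = u_xx + b(t) u_yy` can be integrated
completely. The coefficients of the free second derivatives show that a symmetry has the form
`τ(t) ∂_t + ξ(t,x,y) ∂_x + η(t,x,y) ∂_y + (A(t,x,y) u + f(t,x,y)) ∂_u`, with `ξ` and `η` affine in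
`(x, y)`, `A_x = -ξ_t / 2` and `A_y = -η_t / (2b)`. The equation `A_t = A_xx + b A_yy` then makes
`A_t` depend on `t` only, so `ξ_tt = 0` and `(η_t / b)_t = 0`: `ξ` is affine in `t` and `η` is affine
in an antiderivative `B` of `b` (`DeterminingEqs.exists_normalForm`). Consequently `τ` is a quadratic
polynomial, the rotational part of `ξ` is a multiple of `b^(-1/2)`, and modulo superposition
symmetries every symmetry is a combination of nine explicit fields (`candidate`): five that span the
Heisenberg algebra, one rotation of the `(x, y)`-plane, and three with time components `1, t, t²`.

Which combinations are symmetries is decided by the Schwarzian derivative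
`S = (2 b b'' - 3 b'²) / (2 b²)` of `B`. The rotation is a symmetry only if `S = 0`, that is, if
`b^(-1/2)` is affine. A quadratic `τ` occurs if and only if `2 τ' S + τ S' = 0`, that is, if
the projective field `τ ∂_t` preserves the quadratic differential `S dt²`; equivalently, `τ ∂_t` is
projective both in the coordinate `t` and in the coordinate `B(t)`. If `S = 0` all nine fields are
symmetries. Otherwise two admissible `τ` have vanishing Wronskian near a point with `S ≠ 0`, hence
are proportional, and the dimension is at most six (`finrank_admissible_le`). For `b = β t^α` the
condition says that `τ` is a multiple of `t` unless `α (α + 2) = 0`.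

The algebra reduces to the Heisenberg algebra exactly if no nonzero quadratic `τ` is admissible
(`hasOnlyH2_iff`). The condition at `t` is a linear form in `τ` whose coefficients are cubic forms in
the third jet of `b`; it excludes all `τ ≠ 0` if and only if three such forms at suitable points are
independent. That is an open condition on three jets. It is dense because it holds for
`gauss = exp(t²/2)`: the determinant for `s b + gauss` is a polynomial in `s` that does not vanish at
`0`, so it is nonzero for arbitrarily large `s`, and by homogeneity also for `b + s⁻¹ gauss`.

The statements on the transformation follow from a direct computation
(`residual_pointTransform`): the transformed equation differs from the standard one by a multiple of
`v` that is a polynomial in `y²`, and the solution `v = 1` detects this term.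
-/

/-! ### Partial derivatives along lines and curves -/

theorem isOpen_slab (n : ℕ) {I : Set ℝ} (hI : IsOpen I) : IsOpen (slab n I) :=
  hI.preimage (continuous_apply 0)

theorem update_mem_slab {n : ℕ} {I : Set ℝ} {z : Fin (n + 1) → ℝ} (hz : z ∈ slab n I)
    {i : Fin (n + 1)} (hi : i ≠ 0) (s : ℝ) : Function.update z i s ∈ slab n I := by
  simpa [slab, Function.update_of_ne hi.symm] using hz

theorem update_zero_mem_slab {n : ℕ} {I : Set ℝ} (z : Fin (n + 1) → ℝ) {s : ℝ} (hs : s ∈ I) :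
    Function.update z 0 s ∈ slab n I := by
  simpa [slab] using hs

theorem hasDerivAt_line {n : ℕ} {g : (Fin n → ℝ) → ℝ} {z : Fin n → ℝ} {i : Fin n} {s : ℝ}
    (hg : DifferentiableAt ℝ g (Function.update z i s)) :
    HasDerivAt (fun r => g (Function.update z i r)) (pd i g (Function.update z i s)) s :=
  hg.hasFDerivAt.comp_hasDerivAt s (hasDerivAt_update z i s)

theorem pd_eq_of_line {n : ℕ} {g : (Fin n → ℝ) → ℝ} {z : Fin n → ℝ} {i : Fin n} {c : ℝ}
    (hg : DifferentiableAt ℝ g z)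
    (h : HasDerivAt (fun s => g (Function.update z i s)) c (z i)) : pd i g z = c := by
  have hg' : DifferentiableAt ℝ g (Function.update z i (z i)) := by simpa using hg
  have h2 := (hasDerivAt_line hg').unique h
  simpa using h2

theorem hasDerivAt_comp_curve {n : ℕ} {v : (Fin n → ℝ) → ℝ} {c : ℝ → Fin n → ℝ}
    {c' : Fin n → ℝ} {s : ℝ} (hv : DifferentiableAt ℝ v (c s))
    (hc : ∀ j, HasDerivAt (fun r => c r j) (c' j) s) :
    HasDerivAt (fun r => v (c r)) (∑ j, c' j * pd j v (c s)) s := by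
  have h := hv.hasFDerivAt.comp_hasDerivAt s (hasDerivAt_pi.2 hc)
  refine h.congr_deriv ?_
  have : c' = ∑ j, c' j • (Pi.single j 1 : Fin n → ℝ) := by
    ext k
    simp [Finset.sum_apply, Pi.single_apply]
  rw [this, map_sum]
  simp [pd, Finset.sum_apply, Pi.single_apply]

theorem pd_congr_of_eqOn {n : ℕ} {U : Set (Fin n → ℝ)} (hU : IsOpen U) {f g : (Fin n → ℝ) → ℝ}
    (h : ∀ z ∈ U, f z = g z) (i : Fin n) {z : Fin n → ℝ} (hz : z ∈ U) : pd i f z = pd i g z := by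
  have : f =ᶠ[nhds z] g := by
    filter_upwards [hU.mem_nhds hz] with w hw using h w hw
  unfold pd
  rw [this.fderiv_eq]

theorem pd_eq_zero_of_eqOn {n : ℕ} {U : Set (Fin n → ℝ)} (hU : IsOpen U) {f : (Fin n → ℝ) → ℝ}
    (h : ∀ z ∈ U, f z = 0) (i : Fin n) {z : Fin n → ℝ} (hz : z ∈ U) : pd i f z = 0 := by
  rw [pd_congr_of_eqOn hU (g := fun _ => 0) h i hz]
  simp [pd]

theorem pd_comm {n : ℕ} {g : (Fin n → ℝ) → ℝ} {z : Fin n → ℝ} (hg : ContDiffAt ℝ ∞ g z)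
    (i j : Fin n) : pd i (pd j g) z = pd j (pd i g) z := by
  have hd : DifferentiableAt ℝ (fderiv ℝ g) z :=
    (hg.fderiv_right (m := 1) (by norm_cast)).differentiableAt (by simp)
  have key : ∀ k l : Fin n, pd k (pd l g) z
      = fderiv ℝ (fderiv ℝ g) z (Pi.single k 1) (Pi.single l 1) := by
    intro k l
    have := (hd.hasFDerivAt.clm_apply (hasFDerivAt_const (Pi.single l (1 : ℝ)) z)).fderiv
    unfold pd
    rw [this]
    simp
  rw [key, key]
  exact (hg.isSymmSndFDerivAt (by simp; norm_cast)).eq _ _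

theorem contDiffAt_pd' {n : ℕ} {g : (Fin n → ℝ) → ℝ} {z : Fin n → ℝ} (hg : ContDiffAt ℝ ∞ g z)
    (i : Fin n) : ContDiffAt ℝ ∞ (pd i g) z :=
  (hg.fderiv_right (by simp)).clm_apply contDiffAt_const

theorem ContDiffAt.diff {n : ℕ} {g : (Fin n → ℝ) → ℝ} {z : Fin n → ℝ}
    (hg : ContDiffAt ℝ ∞ g z) : DifferentiableAt ℝ g z :=
  hg.differentiableAt (by simp)

theorem update_eq_of_pd_eq_zero {n : ℕ} {I : Set ℝ} {g : (Fin (n + 1) → ℝ) → ℝ} {i : Fin (n + 1)}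
    (hi : i ≠ 0) (hd : ∀ z ∈ slab n I, DifferentiableAt ℝ g z)
    (h : ∀ z ∈ slab n I, pd i g z = 0) {z : Fin (n + 1) → ℝ} (hz : z ∈ slab n I) (s : ℝ) :
    g (Function.update z i s) = g z := by
  have h1 : ∀ r, HasDerivAt (fun r => g (Function.update z i r)) 0 r := fun r => by
    have := hasDerivAt_line (hd _ (update_mem_slab hz hi r))
    rwa [h _ (update_mem_slab hz hi r)] at this
  have h2 := is_const_of_deriv_eq_zero (fun r => (h1 r).differentiableAt) (fun r => (h1 r).deriv)
    s (z i)
  simpa using h2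

/-- A function on the slab whose derivatives in the space variables vanish depends on time only. -/
theorem eq_of_space_pd_eq_zero {I : Set ℝ} {g : (Fin 4 → ℝ) → ℝ}
    (hd : ∀ z ∈ slab 3 I, DifferentiableAt ℝ g z)
    (h : ∀ z ∈ slab 3 I, pd 1 g z = 0 ∧ pd 2 g z = 0 ∧ pd 3 g z = 0) {z : Fin 4 → ℝ}
    (hz : z ∈ slab 3 I) : g z = g ![z 0, 0, 0, 0] := by
  have e : ![z 0, 0, 0, 0] =
      Function.update (Function.update (Function.update z 1 0) 2 0) 3 0 := by
    ext k
    fin_cases k <;> simp [Function.update]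
  have h1 := update_mem_slab hz (show (1 : Fin 4) ≠ 0 by decide) 0
  have h2 := update_mem_slab h1 (show (2 : Fin 4) ≠ 0 by decide) 0
  rw [e, update_eq_of_pd_eq_zero (by decide) hd (fun w hw => (h w hw).2.2) h2,
    update_eq_of_pd_eq_zero (by decide) hd (fun w hw => (h w hw).2.1) h1,
    update_eq_of_pd_eq_zero (by decide) hd (fun w hw => (h w hw).1) hz]

/-! ### Functions of one variable on the interval -/

theorem eqOn_const_of_hasDerivAt_zero {I : Set ℝ} (hI : IsOpen I) (hc : IsPreconnected I)
    {f : ℝ → ℝ} (h : ∀ t ∈ I, HasDerivAt f 0 t) : ∃ a, ∀ t ∈ I, f t = a :=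
  hI.exists_is_const_of_deriv_eq_zero hc
    (fun t ht => (h t ht).differentiableAt.differentiableWithinAt) (fun t ht => (h t ht).deriv)

theorem hasDerivAt_congr_on {I : Set ℝ} (hI : IsOpen I) {f g : ℝ → ℝ} (h : ∀ t ∈ I, f t = g t)
    {t c : ℝ} (ht : t ∈ I) (hg : HasDerivAt g c t) : HasDerivAt f c t :=
  hg.congr_of_eventuallyEq (by filter_upwards [hI.mem_nhds ht] with s hs using h s hs)

/-- If `(f' / b)' = 0` and `B' = b`, then `f` is an affine function of `B`. -/
theorem eqOn_affine_of_hasDerivAt {I : Set ℝ} (hI : IsOpen I) (hc : IsPreconnected I)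
    {f h b B : ℝ → ℝ} (hB : ∀ t ∈ I, HasDerivAt B (b t) t)
    (hf : ∀ t ∈ I, HasDerivAt f (b t * h t) t) (hh : ∀ t ∈ I, HasDerivAt h 0 t) :
    ∃ a c, ∀ t ∈ I, f t = a + c * B t ∧ h t = c := by
  obtain ⟨c, h1⟩ := eqOn_const_of_hasDerivAt_zero hI hc hh
  obtain ⟨a, h2⟩ := eqOn_const_of_hasDerivAt_zero hI hc (f := fun t => f t - c * B t)
    (fun t ht => by
      have := (hf t ht).sub ((hB t ht).const_mul c)
      rw [h1 t ht] at this
      exact this.congr_deriv (by ring))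
  exact ⟨a, c, fun t ht => ⟨by linarith [h2 t ht], h1 t ht⟩⟩

/-! ### The determining equations -/

/-- The determining equations of the symmetries of `u_t = u_xx + b(t) u_yy`: the coefficients of
the monomials in the jet variables in the prolonged equation. -/
structure DeterminingEqs (I : Set ℝ) (b : ℝ → ℝ) (X : VField) : Prop where
  time : ∀ z ∈ slab 3 I, pd 1 (fun w => X w 0) z = 0 ∧ pd 2 (fun w => X w 0) z = 0 ∧
    pd 3 (fun w => X w 0) z = 0
  space : ∀ z ∈ slab 3 I, pd 3 (fun w => X w 1) z = 0 ∧ pd 3 (fun w => X w 2) z = 0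
  mixed : ∀ z ∈ slab 3 I, pd 1 (fun w => X w 2) z + b (z 0) * pd 2 (fun w => X w 1) z = 0
  scale_x : ∀ z ∈ slab 3 I, 2 * pd 1 (fun w => X w 1) z = pd 0 (fun w => X w 0) z
  scale_y : ∀ z ∈ slab 3 I, 2 * b (z 0) * pd 2 (fun w => X w 2) z =
    b (z 0) * pd 0 (fun w => X w 0) z + X z 0 * deriv b (z 0)
  linear : ∀ z ∈ slab 3 I, pd 3 (pd 3 (fun w => X w 3)) z = 0
  drift_x : ∀ z ∈ slab 3 I, pd 0 (fun w => X w 1) z + 2 * pd 1 (pd 3 (fun w => X w 3)) z =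
    pd 1 (pd 1 (fun w => X w 1)) z + b (z 0) * pd 2 (pd 2 (fun w => X w 1)) z
  drift_y : ∀ z ∈ slab 3 I,
    pd 0 (fun w => X w 2) z + 2 * b (z 0) * pd 2 (pd 3 (fun w => X w 3)) z =
      pd 1 (pd 1 (fun w => X w 2)) z + b (z 0) * pd 2 (pd 2 (fun w => X w 2)) z
  potential : ∀ z ∈ slab 3 I, pd 0 (fun w => X w 3) z =
    pd 1 (pd 1 (fun w => X w 3)) z + b (z 0) * pd 2 (pd 2 (fun w => X w 3)) z

/-- The mixed second derivative `q₁₂`, and the derivatives `q₀₁`, `q₀₂`, are free on the solution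
set; their coefficients force `X⁰` to depend on time only and `X¹`, `X²` not to involve `u`. -/
theorem IsPointSymmetry.leading_eqs {I : Set ℝ} {b : ℝ → ℝ} (hb : ∀ t ∈ I, 0 < b t) {X : VField}
    (hX : IsPointSymmetry I b X) {z : Fin 4 → ℝ} (hz : z ∈ slab 3 I) :
    (pd 1 (fun w => X w 0) z = 0 ∧ pd 2 (fun w => X w 0) z = 0 ∧ pd 3 (fun w => X w 0) z = 0) ∧
    (pd 3 (fun w => X w 1) z = 0 ∧ pd 3 (fun w => X w 2) z = 0) ∧
    pd 1 (fun w => X w 2) z + b (z 0) * pd 2 (fun w => X w 1) z = 0 := by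
  have hb0 : b (z 0) ≠ 0 := (hb _ hz).ne'
  have key : ∀ p1 p2 d e f : ℝ,
      prolongEq b X z ![0, p1, p2] ![![0, d, e], ![d, 0, f], ![e, f, 0]] = 0 := by
    intro p1 p2 d e f
    refine hX.annihilates z hz _ _ ?_ (by simp)
    intro i j
    fin_cases i <;> fin_cases j <;> simp
  have c0 : ∀ p1 : ℝ, pd 1 (fun w => X w 0) z + p1 * pd 3 (fun w => X w 0) z = 0 := by
    intro p1
    have h1 := key p1 0 1 0 0
    have h2 := key p1 0 0 0 0
    simp [prolongEq, prolong1, prolong2, totalD, totalDD, Fin.sum_univ_three] at h1 h2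
    linarith
  have c1 : pd 2 (fun w => X w 0) z = 0 := by
    have h1 := key 0 0 0 1 0
    have h2 := key 0 0 0 0 0
    simp [prolongEq, prolong1, prolong2, totalD, totalDD, Fin.sum_univ_three] at h1 h2
    have : b (z 0) * pd 2 (fun w => X w 0) z = 0 := by linarith
    simpa [hb0] using this
  have c2 : ∀ p1 p2 : ℝ, pd 1 (fun w => X w 2) z + p1 * pd 3 (fun w => X w 2) z
      + b (z 0) * (pd 2 (fun w => X w 1) z + p2 * pd 3 (fun w => X w 1) z) = 0 := by
    intro p1 p2
    have h1 := key p1 p2 0 0 1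
    have h2 := key p1 p2 0 0 0
    simp [prolongEq, prolong1, prolong2, totalD, totalDD, Fin.sum_univ_three] at h1 h2
    linarith
  have e00 := c2 0 0
  have e10 := c2 1 0
  have e01 := c2 0 1
  have f0 := c0 0
  have f1 := c0 1
  refine ⟨⟨by linarith, c1, by linarith⟩, ⟨?_, by linarith⟩, by linarith⟩
  have : b (z 0) * pd 3 (fun w => X w 1) z = 0 := by linarith
  simpa [hb0] using this

theorem prolongEq_of_leading_eqs {I : Set ℝ} (hI : IsOpen I) {b : ℝ → ℝ} {X : VField}
    (ht : ∀ z ∈ slab 3 I, pd 1 (fun w => X w 0) z = 0 ∧ pd 2 (fun w => X w 0) z = 0 ∧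
      pd 3 (fun w => X w 0) z = 0)
    (hs : ∀ z ∈ slab 3 I, pd 3 (fun w => X w 1) z = 0 ∧ pd 3 (fun w => X w 2) z = 0)
    (hm : ∀ z ∈ slab 3 I, pd 1 (fun w => X w 2) z + b (z 0) * pd 2 (fun w => X w 1) z = 0)
    {z : Fin 4 → ℝ} (hz : z ∈ slab 3 I) {p : Fin 3 → ℝ} {q : Fin 3 → Fin 3 → ℝ}
    (hq : ∀ i j, q i j = q j i) (he : p 0 = q 1 1 + b (z 0) * q 2 2) :
    prolongEq b X z p q =
      q 1 1 * (2 * pd 1 (fun w => X w 1) z - pd 0 (fun w => X w 0) z)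
      + q 2 2 * (2 * b (z 0) * pd 2 (fun w => X w 2) z
          - (b (z 0) * pd 0 (fun w => X w 0) z + X z 0 * deriv b (z 0)))
      - (p 1 ^ 2 + b (z 0) * p 2 ^ 2) * pd 3 (pd 3 (fun w => X w 3)) z
      - p 1 * (pd 0 (fun w => X w 1) z + 2 * pd 1 (pd 3 (fun w => X w 3)) z
        - (pd 1 (pd 1 (fun w => X w 1)) z + b (z 0) * pd 2 (pd 2 (fun w => X w 1)) z))
      - p 2 * (pd 0 (fun w => X w 2) z + 2 * b (z 0) * pd 2 (pd 3 (fun w => X w 3)) z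
        - (pd 1 (pd 1 (fun w => X w 2)) z + b (z 0) * pd 2 (pd 2 (fun w => X w 2)) z))
      + (pd 0 (fun w => X w 3) z - (pd 1 (pd 1 (fun w => X w 3)) z
        + b (z 0) * pd 2 (pd 2 (fun w => X w 3)) z)) := by
  have hU := isOpen_slab 3 hI
  have t1 : ∀ i, pd i (pd 1 (fun w => X w 0)) z = 0 := fun i =>
    pd_eq_zero_of_eqOn hU (fun w hw => (ht w hw).1) i hz
  have t2 : ∀ i, pd i (pd 2 (fun w => X w 0)) z = 0 := fun i =>
    pd_eq_zero_of_eqOn hU (fun w hw => (ht w hw).2.1) i hz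
  have t3 : ∀ i, pd i (pd 3 (fun w => X w 0)) z = 0 := fun i =>
    pd_eq_zero_of_eqOn hU (fun w hw => (ht w hw).2.2) i hz
  have s1 : ∀ i, pd i (pd 3 (fun w => X w 1)) z = 0 := fun i =>
    pd_eq_zero_of_eqOn hU (fun w hw => (hs w hw).1) i hz
  have s2 : ∀ i, pd i (pd 3 (fun w => X w 2)) z = 0 := fun i =>
    pd_eq_zero_of_eqOn hU (fun w hw => (hs w hw).2) i hz
  obtain ⟨h1, h2, h3⟩ := ht z hz
  obtain ⟨h4, h5⟩ := hs z hz
  have h6 := hm z hz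
  have h6' : pd 1 (fun w => X w 2) z = - (b (z 0) * pd 2 (fun w => X w 1) z) := by linarith
  simp only [prolongEq, prolong1, prolong2, totalD, totalDD, Fin.sum_univ_three, Fin.castSucc_zero,
    Fin.castSucc_one, show (Fin.castSucc 2 : Fin 4) = 2 from rfl, t1, t2, t3, s1, s2, h1, h2, h3,
    h4, h5, h6', he, hq 2 1]
  ring

theorem isPointSymmetry_iff {I : Set ℝ} (hI : IsOpen I) {b : ℝ → ℝ} (hb : ∀ t ∈ I, 0 < b t)
    {X : VField} : IsPointSymmetry I b X ↔ (∀ z, z ∉ slab 3 I → X z = 0) ∧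
      (∀ z ∈ slab 3 I, ContDiffAt ℝ ∞ X z) ∧ DeterminingEqs I b X := by
  constructor
  · intro hX
    have hl := fun z (hz : z ∈ slab 3 I) => hX.leading_eqs hb hz
    have key : ∀ z (hz : z ∈ slab 3 I), ∀ p1 p2 a c : ℝ, _ := fun z hz p1 p2 a c =>
      (prolongEq_of_leading_eqs hI (fun z hz => (hl z hz).1) (fun z hz => (hl z hz).2.1)
        (fun z hz => (hl z hz).2.2) hz (p := ![a + b (z 0) * c, p1, p2])
        (q := ![![0, 0, 0], ![0, a, 0], ![0, 0, c]])
        (by intro i j; fin_cases i <;> fin_cases j <;> simp) (by simp)).symm.trans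
        (hX.annihilates z hz _ _ (by intro i j; fin_cases i <;> fin_cases j <;> simp) (by simp))
    simp only [Matrix.cons_val] at key
    refine ⟨hX.zero_off, hX.smooth, fun z hz => (hl z hz).1, fun z hz => (hl z hz).2.1,
      fun z hz => (hl z hz).2.2, fun z hz => ?_, fun z hz => ?_, fun z hz => ?_, fun z hz => ?_,
      fun z hz => ?_, fun z hz => ?_⟩
    · linarith [key z hz 0 0 0 0, key z hz 0 0 1 0]
    · linarith [key z hz 0 0 0 0, key z hz 0 0 0 1]
    · linarith [key z hz 0 0 0 0, key z hz 1 0 0 0, key z hz (-1) 0 0 0]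
    · linarith [key z hz 1 0 0 0, key z hz (-1) 0 0 0]
    · linarith [key z hz 0 1 0 0, key z hz 0 (-1) 0 0]
    · linarith [key z hz 0 0 0 0]
  · rintro ⟨h0, hs, h⟩
    refine ⟨h0, hs, fun z hz p q hq he => ?_⟩
    rw [prolongEq_of_leading_eqs hI h.time h.space h.mixed hz hq he, h.scale_x z hz, h.scale_y z hz,
      h.linear z hz, h.drift_x z hz, h.drift_y z hz, h.potential z hz]
    ring

/-! ### Symmetries in normal form -/

theorem pd_eq_of_quadratic {n : ℕ} {g : (Fin n → ℝ) → ℝ} {z : Fin n → ℝ} {i : Fin n}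
    (p1 p2 : ℝ) (hg : DifferentiableAt ℝ g z)
    (h : ∀ s, g (Function.update z i s) = g (Function.update z i 0) + p1 * s + p2 * s ^ 2) :
    pd i g z = p1 + 2 * p2 * z i := by
  refine pd_eq_of_line hg ?_
  rw [funext h]
  have h1 := ((hasDerivAt_id (z i)).const_mul p1).const_add (g (Function.update z i 0))
  have h2 := ((hasDerivAt_id (z i)).pow 2).const_mul p2
  refine (h1.add h2).congr_deriv ?_
  simp
  ring

theorem DeterminingEqs.congr {I : Set ℝ} (hI : IsOpen I) {b : ℝ → ℝ} {X Y : VField}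
    (h : ∀ z ∈ slab 3 I, X z = Y z) (hY : DeterminingEqs I b Y) : DeterminingEqs I b X := by
  have hU := isOpen_slab 3 hI
  have h1 : ∀ (k i : Fin 4), ∀ z ∈ slab 3 I,
      pd i (fun w => X w k) z = pd i (fun w => Y w k) z := fun k i z hz =>
    pd_congr_of_eqOn hU (fun w hw => by rw [h w hw]) i hz
  have h2 : ∀ (k i j : Fin 4), ∀ z ∈ slab 3 I,
      pd i (pd j (fun w => X w k)) z = pd i (pd j (fun w => Y w k)) z := fun k i j z hz =>
    pd_congr_of_eqOn hU (h1 k j) i hz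
  refine ⟨fun z hz => ?_, fun z hz => ?_, fun z hz => ?_, fun z hz => ?_, fun z hz => ?_,
    fun z hz => ?_, fun z hz => ?_, fun z hz => ?_, fun z hz => ?_⟩
  · rw [h1 _ _ z hz, h1 _ _ z hz, h1 _ _ z hz]; exact hY.time z hz
  · rw [h1 _ _ z hz, h1 _ _ z hz]; exact hY.space z hz
  · rw [h1 _ _ z hz, h1 _ _ z hz]; exact hY.mixed z hz
  · rw [h1 _ _ z hz, h1 _ _ z hz]; exact hY.scale_x z hz
  · rw [h1 _ _ z hz, h1 _ _ z hz, h z hz]; exact hY.scale_y z hz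
  · rw [h2 _ _ _ z hz]; exact hY.linear z hz
  · rw [h1 _ _ z hz, h2 _ _ _ z hz, h2 _ _ _ z hz, h2 _ _ _ z hz]; exact hY.drift_x z hz
  · rw [h1 _ _ z hz, h2 _ _ _ z hz, h2 _ _ _ z hz, h2 _ _ _ z hz]; exact hY.drift_y z hz
  · rw [h1 _ _ z hz, h2 _ _ _ z hz, h2 _ _ _ z hz]; exact hY.potential z hz

/-- The coefficient functions of a field
`τ ∂_t + (α x + κ y + σ) ∂_x + (l x + m y + ρ) ∂_y + A u ∂_u` with
`A = c₂₀ x² + c₁₁ x y + c₀₂ y² + c₁₀ x + c₀₁ y + γ`. The coefficients of `A` other than `γ` are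
constants. -/
structure NormalForm where
  (c20 c11 c02 c10 c01 : ℝ)
  (τ α κ σ l m ρ γ : ℝ → ℝ)

/-- The vector field with the given coefficient functions. -/
def NormalForm.field (N : NormalForm) : VField := fun z =>
  ![N.τ (z 0), N.α (z 0) * z 1 + N.κ (z 0) * z 2 + N.σ (z 0),
    N.l (z 0) * z 1 + N.m (z 0) * z 2 + N.ρ (z 0),
    (N.c20 * z 1 ^ 2 + N.c11 * (z 1 * z 2) + N.c02 * z 2 ^ 2 + N.c10 * z 1 + N.c01 * z 2
      + N.γ (z 0)) * z 3]

/-- The ordinary differential equations to which the determining equations reduce. -/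
structure NormalForm.Solves (I : Set ℝ) (b : ℝ → ℝ) (N : NormalForm) : Prop where
  τ : ∀ t ∈ I, HasDerivAt N.τ (2 * N.α t) t
  α : ∀ t ∈ I, HasDerivAt N.α (-4 * N.c20) t
  κ : ∀ t ∈ I, HasDerivAt N.κ (-2 * N.c11) t
  σ : ∀ t ∈ I, HasDerivAt N.σ (-2 * N.c10) t
  l : ∀ t ∈ I, HasDerivAt N.l (b t * (-2 * N.c11)) t
  m : ∀ t ∈ I, HasDerivAt N.m (b t * (-4 * N.c02)) t
  ρ : ∀ t ∈ I, HasDerivAt N.ρ (b t * (-2 * N.c01)) t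
  γ : ∀ t ∈ I, HasDerivAt N.γ (2 * N.c20 + 2 * b t * N.c02) t
  mixed : ∀ t ∈ I, N.l t + b t * N.κ t = 0
  scale : ∀ t ∈ I, 2 * b t * N.m t = 2 * b t * N.α t + N.τ t * deriv b t

theorem NormalForm.Solves.determiningEqs {I : Set ℝ} (hI : IsOpen I) {b : ℝ → ℝ} {N : NormalForm}
    (hN : N.Solves I b) (hs : ∀ z ∈ slab 3 I, ContDiffAt ℝ ∞ N.field z) :
    DeterminingEqs I b N.field := by
  have hU := isOpen_slab 3 hI
  have hd : ∀ k, ∀ z ∈ slab 3 I, ContDiffAt ℝ ∞ (fun w => N.field w k) z := fun k z hz =>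
    contDiffAt_comp (hs z hz) k
  have hdd : ∀ k i, ∀ z ∈ slab 3 I, DifferentiableAt ℝ (pd i (fun w => N.field w k)) z :=
    fun k i z hz => (contDiffAt_pd' (hd k z hz) i).diff
  have d00 : ∀ z ∈ slab 3 I, pd 0 (fun w => N.field w 0) z = 2 * N.α (z 0) := fun z hz =>
    pd_eq_of_line (hd 0 z hz).diff (by simpa [NormalForm.field] using hN.τ _ hz)
  have d0 : ∀ z ∈ slab 3 I, pd 1 (fun w => N.field w 0) z = 0 ∧
      pd 2 (fun w => N.field w 0) z = 0 ∧ pd 3 (fun w => N.field w 0) z = 0 := by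
    refine fun z hz => ⟨?_, ?_, ?_⟩ <;>
    · rw [pd_eq_of_quadratic 0 0 (hd 0 z hz).diff (fun s => by simp [NormalForm.field])]
      simp
  have d10 : ∀ z ∈ slab 3 I, pd 0 (fun w => N.field w 1) z =
      -4 * N.c20 * z 1 - 2 * N.c11 * z 2 - 2 * N.c10 := fun z hz =>
    pd_eq_of_line (hd 1 z hz).diff (by
      have := (((hN.α _ hz).mul_const (z 1)).add ((hN.κ _ hz).mul_const (z 2))).add (hN.σ _ hz)
      simp only [NormalForm.field, Function.update]
      simp
      exact this.congr_deriv (by ring))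
  have d11 : ∀ z ∈ slab 3 I, pd 1 (fun w => N.field w 1) z = N.α (z 0) := fun z hz => by
    rw [pd_eq_of_quadratic (N.α (z 0)) 0 (hd 1 z hz).diff
      (fun s => by simp [NormalForm.field]; ring)]
    simp
  have d12 : ∀ z ∈ slab 3 I, pd 2 (fun w => N.field w 1) z = N.κ (z 0) := fun z hz => by
    rw [pd_eq_of_quadratic (N.κ (z 0)) 0 (hd 1 z hz).diff
      (fun s => by simp [NormalForm.field]; ring)]
    simp
  have d13 : ∀ z ∈ slab 3 I, pd 3 (fun w => N.field w 1) z = 0 := fun z hz => by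
    rw [pd_eq_of_quadratic 0 0 (hd 1 z hz).diff (fun s => by simp [NormalForm.field])]
    simp
  have d20 : ∀ z ∈ slab 3 I, pd 0 (fun w => N.field w 2) z =
      b (z 0) * (-2 * N.c11 * z 1 - 4 * N.c02 * z 2 - 2 * N.c01) := fun z hz =>
    pd_eq_of_line (hd 2 z hz).diff (by
      have := (((hN.l _ hz).mul_const (z 1)).add ((hN.m _ hz).mul_const (z 2))).add (hN.ρ _ hz)
      simp only [NormalForm.field, Function.update]
      simp
      exact this.congr_deriv (by ring))
  have d21 : ∀ z ∈ slab 3 I, pd 1 (fun w => N.field w 2) z = N.l (z 0) := fun z hz => by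
    rw [pd_eq_of_quadratic (N.l (z 0)) 0 (hd 2 z hz).diff
      (fun s => by simp [NormalForm.field]; ring)]
    simp
  have d22 : ∀ z ∈ slab 3 I, pd 2 (fun w => N.field w 2) z = N.m (z 0) := fun z hz => by
    rw [pd_eq_of_quadratic (N.m (z 0)) 0 (hd 2 z hz).diff
      (fun s => by simp [NormalForm.field]; ring)]
    simp
  have d23 : ∀ z ∈ slab 3 I, pd 3 (fun w => N.field w 2) z = 0 := fun z hz => by
    rw [pd_eq_of_quadratic 0 0 (hd 2 z hz).diff (fun s => by simp [NormalForm.field])]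
    simp
  have d30 : ∀ z ∈ slab 3 I, pd 0 (fun w => N.field w 3) z =
      (2 * N.c20 + 2 * b (z 0) * N.c02) * z 3 := fun z hz =>
    pd_eq_of_line (hd 3 z hz).diff (by
      have := ((hN.γ _ hz).const_add (N.c20 * z 1 ^ 2 + N.c11 * (z 1 * z 2) + N.c02 * z 2 ^ 2
        + N.c10 * z 1 + N.c01 * z 2)).mul_const (z 3)
      simp only [NormalForm.field, Function.update]
      simp
      exact this)
  have d31 : ∀ z ∈ slab 3 I, pd 1 (fun w => N.field w 3) z =
      (2 * N.c20 * z 1 + N.c11 * z 2 + N.c10) * z 3 := fun z hz => by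
    rw [pd_eq_of_quadratic ((N.c11 * z 2 + N.c10) * z 3) (N.c20 * z 3) (hd 3 z hz).diff
      (fun s => by simp [NormalForm.field]; ring)]
    ring
  have d32 : ∀ z ∈ slab 3 I, pd 2 (fun w => N.field w 3) z =
      (N.c11 * z 1 + 2 * N.c02 * z 2 + N.c01) * z 3 := fun z hz => by
    rw [pd_eq_of_quadratic ((N.c11 * z 1 + N.c01) * z 3) (N.c02 * z 3) (hd 3 z hz).diff
      (fun s => by simp [NormalForm.field]; ring)]
    ring
  have d33 : ∀ z ∈ slab 3 I, pd 3 (fun w => N.field w 3) z =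
      N.c20 * z 1 ^ 2 + N.c11 * (z 1 * z 2) + N.c02 * z 2 ^ 2 + N.c10 * z 1 + N.c01 * z 2
        + N.γ (z 0) := fun z hz => by
    rw [pd_eq_of_quadratic (N.c20 * z 1 ^ 2 + N.c11 * (z 1 * z 2) + N.c02 * z 2 ^ 2
      + N.c10 * z 1 + N.c01 * z 2 + N.γ (z 0)) 0 (hd 3 z hz).diff
      (fun s => by simp [NormalForm.field])]
    ring
  -- second derivatives are computed from the first ones, which are known on the open slab
  have second : ∀ (k i j : Fin 4) (f : (Fin 4 → ℝ) → ℝ) (z : Fin 4 → ℝ) (p1 p2 : ℝ), z ∈ slab 3 I →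
      i ≠ 0 → (∀ w ∈ slab 3 I, pd j (fun w => N.field w k) w = f w) →
      (∀ s, f (Function.update z i s) = f (Function.update z i 0) + p1 * s + p2 * s ^ 2) →
      pd i (pd j (fun w => N.field w k)) z = p1 + 2 * p2 * z i := by
    intro k i j f z p1 p2 hz hi hf h
    refine pd_eq_of_quadratic p1 p2 (hdd k j z hz) fun s => ?_
    rw [hf _ (update_mem_slab hz hi _), hf _ (update_mem_slab hz hi _), h]
  refine ⟨d0, fun z hz => ⟨d13 z hz, d23 z hz⟩, fun z hz => ?_, fun z hz => ?_, fun z hz => ?_,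
    fun z hz => ?_, fun z hz => ?_, fun z hz => ?_, fun z hz => ?_⟩
  · rw [d21 z hz, d12 z hz]
    exact hN.mixed _ hz
  · rw [d11 z hz, d00 z hz]
  · rw [d22 z hz, d00 z hz]
    have := hN.scale _ hz
    simp only [NormalForm.field, Matrix.cons_val_zero]
    linarith
  · rw [second 3 3 3 _ z 0 0 hz (by decide) d33 (fun s => by simp)]
    ring
  · rw [d10 z hz, second 1 1 1 _ z 0 0 hz (by decide) d11 (fun s => by simp),
      second 1 2 2 _ z 0 0 hz (by decide) d12 (fun s => by simp),
      second 3 1 3 _ z (N.c11 * z 2 + N.c10) N.c20 hz (by decide) d33 (fun s => by simp; ring)]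
    ring
  · rw [d20 z hz, second 2 1 1 _ z 0 0 hz (by decide) d21 (fun s => by simp),
      second 2 2 2 _ z 0 0 hz (by decide) d22 (fun s => by simp),
      second 3 2 3 _ z (N.c11 * z 1 + N.c01) N.c02 hz (by decide) d33 (fun s => by simp; ring)]
    ring
  · rw [d30 z hz, second 3 1 1 _ z (2 * N.c20 * z 3) 0 hz (by decide) d31 (fun s => by simp; ring),
      second 3 2 2 _ z (2 * N.c02 * z 3) 0 hz (by decide) d32 (fun s => by simp; ring)]
    ring

theorem slabField_of_mem {I : Set ℝ} {F : VField} {z : Fin 4 → ℝ} (hz : z ∈ slab 3 I) :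
    slabField I F z = F z :=
  Set.indicator_of_mem hz F

theorem slabField_of_notMem {I : Set ℝ} {F : VField} {z : Fin 4 → ℝ} (hz : z ∉ slab 3 I) :
    slabField I F z = 0 :=
  Set.indicator_of_notMem hz F

theorem NormalForm.Solves.slabField_mem {I : Set ℝ} (hI : IsOpen I) {b : ℝ → ℝ}
    (hb : ∀ t ∈ I, 0 < b t) {N : NormalForm} (hN : N.Solves I b)
    (hs : ∀ z ∈ slab 3 I, ContDiffAt ℝ ∞ N.field z) :
    slabField I N.field ∈ pointSymmetries I b := by
  refine (isPointSymmetry_iff hI hb).2 ⟨fun z hz => slabField_of_notMem hz, fun z hz => ?_, ?_⟩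
  · refine (hs z hz).congr_of_eventuallyEq ?_
    filter_upwards [(isOpen_slab 3 hI).mem_nhds hz] with w hw using slabField_of_mem hw
  · exact (hN.determiningEqs hI hs).congr hI fun z hz => slabField_of_mem hz

/-! ### Every symmetry has a normal form -/

theorem pd_time_mul {I : Set ℝ} {c : ℝ → ℝ} {g f : (Fin 4 → ℝ) → ℝ}
    (h : ∀ z ∈ slab 3 I, g z = c (z 0) * f z) {i : Fin 4} (hi : i ≠ 0) {z : Fin 4 → ℝ}
    (hz : z ∈ slab 3 I) (hg : DifferentiableAt ℝ g z) (hf : DifferentiableAt ℝ f z) :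
    pd i g z = c (z 0) * pd i f z := by
  refine pd_eq_of_line hg ?_
  have e : (fun s => g (Function.update z i s)) =
      fun s => c (z 0) * f (Function.update z i s) := by
    funext s
    rw [h _ (update_mem_slab hz hi s), Function.update_of_ne hi.symm]
  rw [e]
  have := hasDerivAt_line (g := f) (z := z) (i := i) (s := z i) (by simpa using hf)
  simpa using this.const_mul (c (z 0))

theorem pd_time_only {I : Set ℝ} {c : ℝ → ℝ} {g : (Fin 4 → ℝ) → ℝ}
    (h : ∀ z ∈ slab 3 I, g z = c (z 0)) {i : Fin 4} (hi : i ≠ 0) {z : Fin 4 → ℝ}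
    (hz : z ∈ slab 3 I) (hg : DifferentiableAt ℝ g z) : pd i g z = 0 := by
  rw [pd_eq_of_quadratic 0 0 hg fun s => ?_]
  · ring
  · rw [h _ (update_mem_slab hz hi s), h _ (update_mem_slab hz hi 0)]
    simp [Function.update_of_ne hi.symm]

theorem line_quadratic {I : Set ℝ} {g : (Fin 4 → ℝ) → ℝ} {i : Fin 4} (hi : i ≠ 0)
    (hd : ∀ z ∈ slab 3 I, DifferentiableAt ℝ g z) {z : Fin 4 → ℝ} (hz : z ∈ slab 3 I) {p1 p2 : ℝ}
    (h : ∀ s, pd i g (Function.update z i s) = p1 + 2 * p2 * s) :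
    g z = g (Function.update z i 0) + p1 * z i + p2 * z i ^ 2 := by
  have h1 : ∀ s, HasDerivAt (fun s => g (Function.update z i s) - (p1 * s + p2 * s ^ 2)) 0 s := by
    intro s
    have e1 := hasDerivAt_line (hd _ (update_mem_slab hz hi s))
    have e2 := ((hasDerivAt_id s).const_mul p1).add (((hasDerivAt_id s).pow 2).const_mul p2)
    refine (e1.sub e2).congr_deriv ?_
    rw [h s]
    simp
    ring
  have h2 := is_const_of_deriv_eq_zero (fun s => (h1 s).differentiableAt) (fun s => (h1 s).deriv)
    (z i) 0
  simp only [Function.update_eq_self] at h2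
  linarith

theorem hasDerivAt_time_line {g : (Fin 4 → ℝ) → ℝ} {t x y u : ℝ}
    (hg : DifferentiableAt ℝ g ![t, x, y, u]) :
    HasDerivAt (fun s => g ![s, x, y, u]) (pd 0 g ![t, x, y, u]) t := by
  have e : ∀ s, Function.update ![t, x, y, u] 0 s = ![s, x, y, u] := fun s => by
    ext k
    fin_cases k <;> simp [Function.update]
  have := hasDerivAt_line (g := g) (z := ![t, x, y, u]) (i := 0) (s := t) (by rwa [e])
  simpa only [e] using this

theorem quadratic_of_pd {I : Set ℝ} {g : (Fin 4 → ℝ) → ℝ}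
    (hd : ∀ z ∈ slab 3 I, DifferentiableAt ℝ g z) {z : Fin 4 → ℝ} (hz : z ∈ slab 3 I)
    {c20 c11 c02 c10 c01 : ℝ}
    (h : ∀ w, w 0 = z 0 → pd 1 g w = 2 * c20 * w 1 + c11 * w 2 + c10 ∧
      pd 2 g w = c11 * w 1 + 2 * c02 * w 2 + c01 ∧ pd 3 g w = 0) :
    g z = c20 * z 1 ^ 2 + c11 * (z 1 * z 2) + c02 * z 2 ^ 2 + c10 * z 1 + c01 * z 2
      + g ![z 0, 0, 0, 0] := by
  have h1 := update_mem_slab hz (show (3 : Fin 4) ≠ 0 by decide) 0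
  have h2 := update_mem_slab h1 (show (1 : Fin 4) ≠ 0 by decide) 0
  have e3 := line_quadratic (i := 3) (by decide) hd hz (p1 := 0) (p2 := 0)
    (fun s => by rw [(h _ (by simp)).2.2]; ring)
  have e1 := line_quadratic (i := 1) (by decide) hd h1 (p1 := c11 * z 2 + c10) (p2 := c20)
    (fun s => by rw [(h _ (by simp)).1]; simp; ring)
  have e2 := line_quadratic (i := 2) (by decide) hd h2 (p1 := c01) (p2 := c02)
    (fun s => by rw [(h _ (by simp)).2.1]; simp; ring)
  have e : ![z 0, 0, 0, 0] =
      Function.update (Function.update (Function.update z 3 0) 1 0) 2 0 := by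
    ext k
    fin_cases k <;> simp [Function.update]
  rw [e, e3, e1, e2]
  simp
  ring

/-- The determining equations integrate to a normal form plus a superposition symmetry. Writing `A`
for the derivative of `X³` by `u`, the potential equation shows that `A_t` depends on time only,
so that the time derivatives of `A_x` and `A_y` vanish; these are `-X¹_t / 2` and
`-X²_t / (2b)`, so `X¹` is affine in `t` and `X²` is affine in the antiderivative of `b`. -/
theorem DeterminingEqs.exists_normalForm {I : Set ℝ} (hI : IsOpen I) (hc : IsPreconnected I)
    (hne : I.Nonempty) {b B : ℝ → ℝ} (hb : ∀ t ∈ I, 0 < b t)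
    (hB : ∀ t ∈ I, HasDerivAt B (b t) t) {X : VField} (hs : ∀ z ∈ slab 3 I, ContDiffAt ℝ ∞ X z)
    (h : DeterminingEqs I b X) :
    ∃ N : NormalForm, N.Solves I b ∧ ∀ z ∈ slab 3 I, (∀ k : Fin 3, X z k.castSucc =
      N.field z k.castSucc) ∧ X z 3 = N.field z 3 + X ![z 0, z 1, z 2, 0] 3 := by
  obtain ⟨htime, hspace, hmixed, hscx, hscy, hlin, hdx, hdy, hpot⟩ := h
  have hU := isOpen_slab 3 hI
  have hT : ∀ z ∈ slab 3 I, ContDiffAt ℝ ∞ (fun w => X w 0) z := fun z hz =>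
    contDiffAt_comp (hs z hz) 0
  have hXi : ∀ z ∈ slab 3 I, ContDiffAt ℝ ∞ (fun w => X w 1) z := fun z hz =>
    contDiffAt_comp (hs z hz) 1
  have hEt : ∀ z ∈ slab 3 I, ContDiffAt ℝ ∞ (fun w => X w 2) z := fun z hz =>
    contDiffAt_comp (hs z hz) 2
  have hPh : ∀ z ∈ slab 3 I, ContDiffAt ℝ ∞ (fun w => X w 3) z := fun z hz =>
    contDiffAt_comp (hs z hz) 3
  have hTX : ∀ z, X z 0 = (fun w => X w 0) z := fun z => rfl
  have hXX : ∀ z, X z 1 = (fun w => X w 1) z := fun z => rfl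
  have hEX : ∀ z, X z 2 = (fun w => X w 2) z := fun z => rfl
  have hPX : ∀ z, X z 3 = (fun w => X w 3) z := fun z => rfl
  replace hscy : ∀ z ∈ slab 3 I, 2 * b (z 0) * pd 2 (fun w => X w 2) z =
    b (z 0) * pd 0 (fun w => X w 0) z + (fun w => X w 0) z * deriv b (z 0) := hscy
  generalize (fun w => X w 0) = T at *
  generalize (fun w => X w 1) = Xi at *
  generalize (fun w => X w 2) = Et at *
  generalize (fun w => X w 3) = Ph at *
  have ne1 : (1 : Fin 4) ≠ 0 := by decide
  have ne2 : (2 : Fin 4) ≠ 0 := by decide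
  have ne3 : (3 : Fin 4) ≠ 0 := by decide
  have ho : ∀ t ∈ I, ∀ x y u : ℝ, ![t, x, y, u] ∈ slab 3 I := fun t ht x y u => ht
  have hoz : ∀ z : Fin 4 → ℝ, z ∈ slab 3 I → ∀ x y u : ℝ, ![z 0, x, y, u] ∈ slab 3 I :=
    fun z hz x y u => hz
  have b0 : ∀ z ∈ slab 3 I, b (z 0) ≠ 0 := fun z hz => (hb _ hz).ne'
  -- `T` and its time derivative depend on time only
  have T_eq : ∀ z ∈ slab 3 I, T z = T ![z 0, 0, 0, 0] := fun z hz =>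
    eq_of_space_pd_eq_zero (fun z hz => (hT z hz).diff) htime hz
  have T0_eq : ∀ z ∈ slab 3 I, pd 0 T z = pd 0 T ![z 0, 0, 0, 0] := fun z hz =>
    eq_of_space_pd_eq_zero (fun z hz => (contDiffAt_pd' (hT z hz) 0).diff) (fun w hw => by
      rw [pd_comm (hT w hw) 1 0, pd_comm (hT w hw) 2 0, pd_comm (hT w hw) 3 0]
      exact ⟨pd_eq_zero_of_eqOn hU (fun w hw => (htime w hw).1) 0 hw,
        pd_eq_zero_of_eqOn hU (fun w hw => (htime w hw).2.1) 0 hw,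
        pd_eq_zero_of_eqOn hU (fun w hw => (htime w hw).2.2) 0 hw⟩) hz
  -- so do the space derivatives of `Xi` and `Et`
  obtain ⟨fα, X1_eq⟩ : ∃ f : ℝ → ℝ, ∀ z ∈ slab 3 I, pd 1 Xi z = f (z 0) :=
    ⟨fun t => pd 0 T ![t, 0, 0, 0] / 2, fun z hz => by
      have := hscx z hz
      rw [T0_eq z hz] at this
      linarith⟩
  obtain ⟨fm, E2_eq⟩ : ∃ f : ℝ → ℝ, ∀ z ∈ slab 3 I, pd 2 Et z = f (z 0) :=
    ⟨fun t => (b t * pd 0 T ![t, 0, 0, 0] + T ![t, 0, 0, 0] * deriv b t) / (2 * b t),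
      fun z hz => by
        have := hscy z hz
        rw [T0_eq z hz, T_eq z hz] at this
        have hb' := b0 z hz
        simp only
        rw [← this]
        field_simp⟩
  have X1_pd : ∀ i, i ≠ 0 → ∀ z ∈ slab 3 I, pd i (pd 1 Xi) z = 0 := fun i hi z hz =>
    pd_time_only X1_eq hi hz (contDiffAt_pd' (hXi z hz) 1).diff
  have E2_pd : ∀ i, i ≠ 0 → ∀ z ∈ slab 3 I, pd i (pd 2 Et) z = 0 := fun i hi z hz =>
    pd_time_only E2_eq hi hz (contDiffAt_pd' (hEt z hz) 2).diff
  have E1_pd : ∀ z ∈ slab 3 I,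
      pd 1 (pd 1 Et) z = 0 ∧ pd 2 (pd 1 Et) z = 0 ∧ pd 3 (pd 1 Et) z = 0 := by
    intro z hz
    refine ⟨?_, ?_, ?_⟩
    · rw [pd_time_mul (c := fun t => - b t) (f := pd 2 Xi)
        (fun w hw => by have := hmixed w hw; linarith) ne1 hz
        (contDiffAt_pd' (hEt z hz) 1).diff (contDiffAt_pd' (hXi z hz) 2).diff,
        pd_comm (hXi z hz) 1 2, X1_pd 2 ne2 z hz, mul_zero]
    · rw [pd_comm (hEt z hz), E2_pd 1 ne1 z hz]
    · rw [pd_comm (hEt z hz)]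
      exact pd_eq_zero_of_eqOn hU (fun w hw => (hspace w hw).2) 1 hz
  have E1_eq : ∀ z ∈ slab 3 I, pd 1 Et z = pd 1 Et ![z 0, 0, 0, 0] := fun z hz =>
    eq_of_space_pd_eq_zero (fun z hz => (contDiffAt_pd' (hEt z hz) 1).diff) E1_pd hz
  obtain ⟨fκ, X2_eq⟩ : ∃ f : ℝ → ℝ, ∀ z ∈ slab 3 I, pd 2 Xi z = f (z 0) :=
    ⟨fun t => - pd 1 Et ![t, 0, 0, 0] / b t, fun z hz => by
      have := hmixed z hz
      rw [E1_eq z hz] at this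
      have hb' := b0 z hz
      simp only
      field_simp
      linarith⟩
  have X2_pd : ∀ z ∈ slab 3 I, pd 2 (pd 2 Xi) z = 0 := fun z hz =>
    pd_time_only X2_eq ne2 hz (contDiffAt_pd' (hXi z hz) 2).diff
  -- the derivative of `Ph` by `u`
  obtain ⟨A, hA⟩ : ∃ A, A = pd 3 Ph := ⟨_, rfl⟩
  rw [← hA] at hlin hdx hdy
  have hAs : ∀ z ∈ slab 3 I, ContDiffAt ℝ ∞ A z := fun z hz => hA ▸ contDiffAt_pd' (hPh z hz) 3
  have X0 : ∀ z ∈ slab 3 I, pd 0 Xi z = 1 * (-2 * pd 1 A z) := fun z hz => by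
    have := hdx z hz
    rw [X1_pd 1 ne1 z hz, X2_pd z hz] at this
    linarith
  have E0 : ∀ z ∈ slab 3 I, pd 0 Et z = b (z 0) * (-2 * pd 2 A z) := fun z hz => by
    have := hdy z hz
    rw [(E1_pd z hz).1, E2_pd 2 ne2 z hz] at this
    linarith
  have A0 : ∀ z ∈ slab 3 I, pd 0 A z = pd 1 (pd 1 A) z + b (z 0) * pd 2 (pd 2 A) z := by
    intro z hz
    have swap : ∀ i, pd 3 (pd i (pd i Ph)) z = pd i (pd i A) z := fun i => by
      rw [pd_comm (contDiffAt_pd' (hPh z hz) i) 3 i]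
      refine pd_congr_of_eqOn hU (fun w hw => ?_) i hz
      rw [pd_comm (hPh w hw) 3 i, hA]
    have line : ∀ i, HasDerivAt (fun s => pd i (pd i Ph) (Function.update z 3 s))
        (pd i (pd i A) z) (z 3) := fun i => by
      have := hasDerivAt_line (g := pd i (pd i Ph)) (z := z) (i := 3) (s := z 3)
        (by simpa using (contDiffAt_pd' (contDiffAt_pd' (hPh z hz) i) i).diff)
      simpa [swap i] using this
    rw [hA, pd_comm (hPh z hz) 0 3, ← hA]
    refine pd_eq_of_line (contDiffAt_pd' (hPh z hz) 0).diff ?_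
    have e : (fun s => pd 0 Ph (Function.update z 3 s)) = fun s =>
        pd 1 (pd 1 Ph) (Function.update z 3 s) +
          b (z 0) * pd 2 (pd 2 Ph) (Function.update z 3 s) := by
      funext s
      rw [hpot _ (update_mem_slab hz ne3 s)]
      simp
    rw [e]
    exact (line 1).add ((line 2).const_mul _)
  have A11_eq : ∀ z ∈ slab 3 I, pd 1 (pd 1 A) z = -(1 / 2) * pd 0 (pd 1 Xi) z := fun z hz => by
    rw [pd_time_mul (c := fun _ => -(1 / 2)) (f := pd 0 Xi)
      (fun w hw => by have := X0 w hw; linarith) ne1 hz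
      (contDiffAt_pd' (hAs z hz) 1).diff (contDiffAt_pd' (hXi z hz) 0).diff, pd_comm (hXi z hz) 1 0]
  have A22_eq : ∀ z ∈ slab 3 I, b (z 0) * pd 2 (pd 2 A) z = -(1 / 2) * pd 0 (pd 2 Et) z :=
    fun z hz => by
      have hb' := b0 z hz
      rw [pd_time_mul (c := fun t => -(1 / (2 * b t))) (f := pd 0 Et)
        (fun w hw => by
          have := E0 w hw
          have hb' := b0 w hw
          simp only [this]
          field_simp) ne2 hz
        (contDiffAt_pd' (hAs z hz) 2).diff (contDiffAt_pd' (hEt z hz) 0).diff,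
        pd_comm (hEt z hz) 2 0]
      field_simp
  have A0_pd : ∀ i, i ≠ 0 → ∀ z ∈ slab 3 I, pd i (pd 0 A) z = 0 := by
    intro i hi z hz
    have line : ∀ (g : (Fin 4 → ℝ) → ℝ), ContDiffAt ℝ ∞ g z →
        (∀ w ∈ slab 3 I, pd i g w = 0) →
        HasDerivAt (fun s => pd 0 g (Function.update z i s)) 0 (z i) := by
      intro g hg h0
      have := hasDerivAt_line (g := pd 0 g) (z := z) (i := i) (s := z i)
        (by simpa using (contDiffAt_pd' hg 0).diff)
      simp only [Function.update_eq_self] at this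
      rwa [pd_comm hg, pd_eq_zero_of_eqOn hU h0 0 hz] at this
    refine pd_eq_of_line (contDiffAt_pd' (hAs z hz) 0).diff ?_
    have e : (fun s => pd 0 A (Function.update z i s)) = fun s =>
        -(1 / 2) * pd 0 (pd 1 Xi) (Function.update z i s) +
          -(1 / 2) * pd 0 (pd 2 Et) (Function.update z i s) := by
      funext s
      have hw := update_mem_slab hz hi s
      rw [A0 _ hw, A11_eq _ hw, A22_eq _ hw]
    rw [e]
    have h1 := line (pd 1 Xi) (contDiffAt_pd' (hXi z hz) 1) (X1_pd i hi)
    have h2 := line (pd 2 Et) (contDiffAt_pd' (hEt z hz) 2) (E2_pd i hi)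
    exact ((h1.const_mul _).add (h2.const_mul _)).congr_deriv (by ring)
  have A1_line : ∀ i, i ≠ 0 → ∀ x y : ℝ, ∀ t ∈ I,
      HasDerivAt (fun t => -2 * pd i A ![t, x, y, 0]) 0 t := by
    intro i hi x y t ht
    have hz := ho t ht x y 0
    have := hasDerivAt_time_line (g := pd i A) (contDiffAt_pd' (hAs _ hz) i).diff
    have h0 : pd 0 (pd i A) ![t, x, y, 0] = 0 := by rw [pd_comm (hAs _ hz), A0_pd i hi _ hz]
    simpa [h0] using this.const_mul (-2)
  -- hence `Xi` is affine in time, and `Et` in the antiderivative of `b`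
  have X_line : ∀ x y : ℝ, ∃ a c, ∀ t ∈ I, Xi ![t, x, y, 0] = a + c * t ∧
      -2 * pd 1 A ![t, x, y, 0] = c := fun x y =>
    eqOn_affine_of_hasDerivAt hI hc (b := fun _ => 1) (B := fun t => t)
      (fun t _ => hasDerivAt_id t) (fun t ht => by
        have := hasDerivAt_time_line (g := Xi) (hXi _ (ho t ht x y 0)).diff
        simpa [X0 _ (ho t ht x y 0)] using this) (A1_line 1 ne1 x y)
  have E_line : ∀ x y : ℝ, ∃ a c, ∀ t ∈ I, Et ![t, x, y, 0] = a + c * B t ∧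
      -2 * pd 2 A ![t, x, y, 0] = c := fun x y =>
    eqOn_affine_of_hasDerivAt hI hc hB (fun t ht => by
        have := hasDerivAt_time_line (g := Et) (hEt _ (ho t ht x y 0)).diff
        simpa [E0 _ (ho t ht x y 0)] using this) (A1_line 2 ne2 x y)
  have X_form : ∀ z ∈ slab 3 I, Xi z = pd 1 Xi ![z 0, 0, 0, 0] * z 1
      + pd 2 Xi ![z 0, 0, 0, 0] * z 2 + Xi ![z 0, 0, 0, 0] := fun z hz => by
    have := quadratic_of_pd (fun z hz => (hXi z hz).diff) hz (c20 := 0) (c11 := 0) (c02 := 0)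
      (c10 := pd 1 Xi ![z 0, 0, 0, 0]) (c01 := pd 2 Xi ![z 0, 0, 0, 0]) (fun w hw => by
        have hw' : w ∈ slab 3 I := by simpa [slab, hw] using hz
        rw [X1_eq w hw', X2_eq w hw', X1_eq _ (hoz z hz _ _ _), X2_eq _ (hoz z hz _ _ _),
          (hspace w hw').1]
        simp [hw])
    linarith
  have E_form : ∀ z ∈ slab 3 I, Et z = pd 1 Et ![z 0, 0, 0, 0] * z 1
      + pd 2 Et ![z 0, 0, 0, 0] * z 2 + Et ![z 0, 0, 0, 0] := fun z hz => by
    have := quadratic_of_pd (fun z hz => (hEt z hz).diff) hz (c20 := 0) (c11 := 0) (c02 := 0)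
      (c10 := pd 1 Et ![z 0, 0, 0, 0]) (c01 := pd 2 Et ![z 0, 0, 0, 0]) (fun w hw => by
        have hw' : w ∈ slab 3 I := by simpa [slab, hw] using hz
        rw [E1_eq w hw', E2_eq w hw', E2_eq _ (hoz z hz _ _ _), (hspace w hw').2]
        simp [hw])
    linarith
  obtain ⟨s0, s1, hS⟩ := X_line 0 0
  obtain ⟨a0, a1, ha⟩ := X_line 1 0
  obtain ⟨k0, k1, hk⟩ := X_line 0 1
  obtain ⟨r0, r1, hr⟩ := E_line 0 0
  obtain ⟨l0, l1, hl⟩ := E_line 1 0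
  obtain ⟨m0, m1, hm⟩ := E_line 0 1
  have affine_deriv : ∀ (f : ℝ → ℝ) (a c : ℝ), (∀ t ∈ I, f t = a + c * t) →
      ∀ t ∈ I, HasDerivAt f c t := fun f a c hf t ht =>
    hasDerivAt_congr_on hI hf ht
      ((((hasDerivAt_id t).const_mul c).const_add a).congr_deriv (by simp))
  have affine_deriv' : ∀ (f : ℝ → ℝ) (a c : ℝ), (∀ t ∈ I, f t = a + c * B t) →
      ∀ t ∈ I, HasDerivAt f (b t * c) t := fun f a c hf t ht =>
    hasDerivAt_congr_on hI hf ht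
      ((((hB t ht).const_mul c).const_add a).congr_deriv (by ring))
  have dσ := affine_deriv (fun t => Xi ![t, 0, 0, 0]) s0 s1 fun t ht => (hS t ht).1
  have dα := affine_deriv (fun t => pd 1 Xi ![t, 0, 0, 0]) (a0 - s0) (a1 - s1) fun t ht => by
    have := X_form _ (ho t ht 1 0 0)
    simp [(hS t ht).1, (ha t ht).1] at this
    linarith
  have dκ := affine_deriv (fun t => pd 2 Xi ![t, 0, 0, 0]) (k0 - s0) (k1 - s1) fun t ht => by
    have := X_form _ (ho t ht 0 1 0)
    simp [(hS t ht).1, (hk t ht).1] at this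
    linarith
  have dρ := affine_deriv' (fun t => Et ![t, 0, 0, 0]) r0 r1 fun t ht => (hr t ht).1
  have dl := affine_deriv' (fun t => pd 1 Et ![t, 0, 0, 0]) (l0 - r0) (l1 - r1) fun t ht => by
    have := E_form _ (ho t ht 1 0 0)
    simp [(hr t ht).1, (hl t ht).1] at this
    linarith
  have dm := affine_deriv' (fun t => pd 2 Et ![t, 0, 0, 0]) (m0 - r0) (m1 - r1) fun t ht => by
    have := E_form _ (ho t ht 0 1 0)
    simp [(hr t ht).1, (hm t ht).1] at this
    linarith
  have A1_eq : ∀ z ∈ slab 3 I, pd 1 A z =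
      2 * (-(a1 - s1) / 4) * z 1 + (-(k1 - s1) / 2) * z 2 + (-s1 / 2) := fun z hz => by
    have h1 : pd 0 Xi z = (a1 - s1) * z 1 + (k1 - s1) * z 2 + s1 := by
      refine pd_eq_of_line (hXi z hz).diff (hasDerivAt_congr_on hI (g := fun t =>
        pd 1 Xi ![t, 0, 0, 0] * z 1 + pd 2 Xi ![t, 0, 0, 0] * z 2 + Xi ![t, 0, 0, 0])
        (fun t ht => ?_) hz ((((dα _ hz).mul_const _).add ((dκ _ hz).mul_const _)).add (dσ _ hz)))
      rw [X_form _ (update_zero_mem_slab z ht)]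
      simp
    have := X0 z hz
    linarith
  have A2_eq : ∀ z ∈ slab 3 I, pd 2 A z =
      (-(l1 - r1) / 2) * z 1 + 2 * (-(m1 - r1) / 4) * z 2 + (-r1 / 2) := fun z hz => by
    have h1 : pd 0 Et z = b (z 0) * (l1 - r1) * z 1 + b (z 0) * (m1 - r1) * z 2 + b (z 0) * r1 := by
      refine pd_eq_of_line (hEt z hz).diff (hasDerivAt_congr_on hI (g := fun t =>
        pd 1 Et ![t, 0, 0, 0] * z 1 + pd 2 Et ![t, 0, 0, 0] * z 2 + Et ![t, 0, 0, 0])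
        (fun t ht => ?_) hz ((((dl _ hz).mul_const _).add ((dm _ hz).mul_const _)).add (dρ _ hz)))
      rw [E_form _ (update_zero_mem_slab z ht)]
      simp
    have h2 := E0 z hz
    refine mul_left_cancel₀ (b0 z hz) ?_
    linarith
  have A_second : ∀ (i j : Fin 4) (z : Fin 4 → ℝ) (p1 : ℝ), z ∈ slab 3 I →
      (∀ s, pd j A (Function.update z i s) = pd j A (Function.update z i 0) + p1 * s) →
      pd i (pd j A) z = p1 := fun i j z p1 hz h => by
    rw [pd_eq_of_quadratic p1 0 (contDiffAt_pd' (hAs z hz) j).diff (fun s => by rw [h]; ring)]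
    ring
  have compat : l1 - r1 = k1 - s1 := by
    obtain ⟨t, ht⟩ := hne
    have hz := ho t ht 0 0 0
    have e1 := A_second 1 2 _ (-(l1 - r1) / 2) hz (fun s => by
      rw [A2_eq _ (update_mem_slab hz ne1 s), A2_eq _ (update_mem_slab hz ne1 0)]
      simp
      ring)
    have e2 := A_second 2 1 _ (-(k1 - s1) / 2) hz (fun s => by
      rw [A1_eq _ (update_mem_slab hz ne2 s), A1_eq _ (update_mem_slab hz ne2 0)]
      simp
      ring)
    rw [pd_comm (hAs _ hz)] at e1
    linarith
  rw [compat] at A2_eq dl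
  have dγ : ∀ t ∈ I, HasDerivAt (fun t => A ![t, 0, 0, 0])
      (2 * (-(a1 - s1) / 4) + 2 * b t * (-(m1 - r1) / 4)) t := by
    intro t ht
    have hz := ho t ht 0 0 0
    have e1 := A_second 1 1 _ (2 * (-(a1 - s1) / 4)) hz (fun s => by
      rw [A1_eq _ (update_mem_slab hz ne1 s), A1_eq _ (update_mem_slab hz ne1 0)]
      simp
      ring)
    have e2 := A_second 2 2 _ (2 * (-(m1 - r1) / 4)) hz (fun s => by
      rw [A2_eq _ (update_mem_slab hz ne2 s), A2_eq _ (update_mem_slab hz ne2 0)]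
      simp
      ring)
    have := hasDerivAt_time_line (g := A) (hAs _ hz).diff
    have e3 := A0 _ hz
    rw [e1, e2] at e3
    simp only [Matrix.cons_val_zero] at e3
    rw [e3] at this
    exact this.congr_deriv (by ring)
  refine ⟨⟨-(a1 - s1) / 4, -(k1 - s1) / 2, -(m1 - r1) / 4, -s1 / 2, -r1 / 2,
    fun t => T ![t, 0, 0, 0], fun t => pd 1 Xi ![t, 0, 0, 0], fun t => pd 2 Xi ![t, 0, 0, 0],
    fun t => Xi ![t, 0, 0, 0], fun t => pd 1 Et ![t, 0, 0, 0], fun t => pd 2 Et ![t, 0, 0, 0],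
    fun t => Et ![t, 0, 0, 0], fun t => A ![t, 0, 0, 0]⟩, ?_, ?_⟩
  · refine ⟨fun t ht => ?_, fun t ht => ?_, fun t ht => ?_, fun t ht => ?_, fun t ht => ?_,
      fun t ht => ?_, fun t ht => ?_, fun t ht => dγ t ht, fun t ht => ?_, fun t ht => ?_⟩
    · have hz := ho t ht 0 0 0
      have := hasDerivAt_time_line (g := T) (hT _ hz).diff
      simpa [hscx _ hz] using this
    · exact (dα t ht).congr_deriv (by simp only; ring)
    · exact (dκ t ht).congr_deriv (by simp only; ring)
    · exact (dσ t ht).congr_deriv (by simp only; ring)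
    · exact (dl t ht).congr_deriv (by simp only; ring)
    · exact (dm t ht).congr_deriv (by simp only; ring)
    · exact (dρ t ht).congr_deriv (by simp only; ring)
    · exact hmixed _ (ho t ht 0 0 0)
    · have h1 := hscy _ (ho t ht 0 0 0)
      have h2 := hscx _ (ho t ht 0 0 0)
      simp only [Matrix.cons_val_zero] at h1
      simp only
      rw [h1, ← h2]
      ring
  · intro z hz
    have hA_form := quadratic_of_pd (fun z hz => (hAs z hz).diff) hz (fun w hw => by
        have hw' : w ∈ slab 3 I := by simpa [slab, hw] using hz
        exact ⟨A1_eq w hw', A2_eq w hw', hlin w hw'⟩)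
    have hP := line_quadratic (i := 3) ne3 (fun z hz => (hPh z hz).diff) hz (p1 := A z) (p2 := 0)
      (fun s => by
        rw [← hA, update_eq_of_pd_eq_zero ne3 (fun z hz => (hAs z hz).diff) hlin hz]
        ring)
    refine ⟨fun k => ?_, ?_⟩
    · fin_cases k
      · simpa [NormalForm.field, hTX] using T_eq z hz
      · simpa [NormalForm.field, hXX] using X_form z hz
      · simpa [NormalForm.field, hEX] using E_form z hz
    · have e : Function.update z 3 0 = ![z 0, z 1, z 2, 0] := by
        ext k
        fin_cases k <;> simp [Function.update]
      rw [hPX, hPX, hP, e, hA_form]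
      simp [NormalForm.field]
      ring

/-! ### The nine candidate fields -/

/-- The polynomial `w₀ + w₁ t + w₂ t²`. -/
noncomputable def quad (w : Fin 3 → ℝ) (t : ℝ) : ℝ := w 0 + w 1 * t + w 2 * t ^ 2

/-- The derivative of `quad w`. -/
noncomputable def quadDeriv (w : Fin 3 → ℝ) (t : ℝ) : ℝ := w 1 + 2 * w 2 * t

/-- The numerator of the Schwarzian derivative of an antiderivative of `b`, which is
`(2 b b'' - 3 b'²) / (2 b²)`. -/
noncomputable def schwarz (b : ℝ → ℝ) (t : ℝ) : ℝ := 2 * b t * deriv (deriv b) t - 3 * deriv b t ^ 2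

/-- The numerator over `b³` of the derivative of the Schwarzian derivative. -/
noncomputable def schwarzDeriv (b : ℝ → ℝ) (t : ℝ) : ℝ :=
  b t ^ 2 * deriv (deriv (deriv b)) t - 4 * b t * deriv b t * deriv (deriv b) t + 3 * deriv b t ^ 3

/-- The condition for `τ = quad w` to be the time component of a symmetry: with `S` the Schwarzian
derivative of an antiderivative of `b`, this is `b³ (2 τ' S + τ S')`, the Lie derivative of the
quadratic differential `S dt²`. -/
noncomputable def projCond (b : ℝ → ℝ) (w : Fin 3 → ℝ) (t : ℝ) : ℝ :=
  quadDeriv w t * (b t * schwarz b t) + quad w t * schwarzDeriv b t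

/-- The coefficient of `y ∂_y` in the symmetry with time component `quad w`. -/
noncomputable def yScale (b : ℝ → ℝ) (w : Fin 3 → ℝ) (t : ℝ) : ℝ :=
  (quadDeriv w t + quad w t * (deriv b t / b t)) / 2

/-- The derivative of `yScale b w`. -/
noncomputable def yScaleDeriv (b : ℝ → ℝ) (w : Fin 3 → ℝ) (t : ℝ) : ℝ :=
  (2 * w 2 + quadDeriv w t * (deriv b t / b t)
    + quad w t * (deriv (deriv b) t / b t - (deriv b t / b t) ^ 2)) / 2

/-- The fields with time component `τ = quad w` that are the candidates for symmetries. -/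
noncomputable def projField (I : Set ℝ) (b : ℝ → ℝ) : (Fin 3 → ℝ) →ₗ[ℝ] VField where
  toFun w := slabField I fun z => ![quad w (z 0), quadDeriv w (z 0) / 2 * z 1,
    yScale b w (z 0) * z 2,
    (-(w 2) / 4 * z 1 ^ 2 - yScaleDeriv b w (z 0) / (4 * b (z 0)) * z 2 ^ 2
      - quadDeriv w (z 0) / 4 - yScale b w (z 0) / 2) * z 3]
  map_add' v w := by
    ext z k
    by_cases hz : z ∈ slab 3 I
    · simp only [Pi.add_apply, slabField_of_mem hz]
      fin_cases k <;> simp [quad, quadDeriv, yScale, yScaleDeriv] <;> ring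
    · simp [slabField_of_notMem hz]
  map_smul' c w := by
    ext z k
    by_cases hz : z ∈ slab 3 I
    · simp only [Pi.smul_apply, slabField_of_mem hz, RingHom.id_apply]
      fin_cases k <;> simp [quad, quadDeriv, yScale, yScaleDeriv] <;> ring
    · simp [slabField_of_notMem hz]

/-- The candidate for a symmetry that rotates the `(x, y)`-plane. -/
noncomputable def rotField (I : Set ℝ) (b : ℝ → ℝ) : VField :=
  slabField I fun z => ![0, z 2 / √(b (z 0)), -√(b (z 0)) * z 1,
    deriv b (z 0) / (4 * b (z 0) * √(b (z 0))) * (z 1 * z 2) * z 3]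

/-- The coordinates in the span of the nine candidate fields. -/
abbrev Params : Type := (Fin 5 → ℝ) × ℝ × (Fin 3 → ℝ)

/-- The linear combination of the candidate fields with given coordinates. -/
noncomputable def candidate (I : Set ℝ) (b B : ℝ → ℝ) : Params →ₗ[ℝ] VField :=
  (Fintype.linearCombination ℝ (h2Fields I B)).coprod
    ((LinearMap.toSpanSingleton ℝ VField (rotField I b)).coprod (projField I b))

theorem candidate_of_mem {I : Set ℝ} (b B : ℝ → ℝ) (p : Params) {z : Fin 4 → ℝ}
    (hz : z ∈ slab 3 I) : candidate I b B p z = ![quad p.2.2 (z 0),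
      quadDeriv p.2.2 (z 0) / 2 * z 1 + p.2.1 / √(b (z 0)) * z 2 + (p.1 1 + p.1 0 * z 0),
      -p.2.1 * √(b (z 0)) * z 1 + yScale b p.2.2 (z 0) * z 2 + (p.1 3 + p.1 2 * B (z 0)),
      (-(p.2.2 2) / 4 * z 1 ^ 2
        + p.2.1 * (deriv b (z 0) / (4 * b (z 0) * √(b (z 0)))) * (z 1 * z 2)
        + -(yScaleDeriv b p.2.2 (z 0) / (4 * b (z 0))) * z 2 ^ 2
        + -(p.1 0) / 2 * z 1 + -(p.1 2) / 2 * z 2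
        + (p.1 4 - quadDeriv p.2.2 (z 0) / 4 - yScale b p.2.2 (z 0) / 2)) * z 3] := by
  ext k
  simp only [candidate, LinearMap.coprod_apply, Pi.add_apply, Fintype.linearCombination_apply,
    Fin.sum_univ_five, LinearMap.toSpanSingleton_apply, Pi.smul_apply, projField, rotField,
    h2Fields, LinearMap.coe_mk, AddHom.coe_mk, Matrix.cons_val, slabField_of_mem hz]
  fin_cases k <;> simp <;> ring

theorem candidate_of_notMem {I : Set ℝ} (b B : ℝ → ℝ) (p : Params) {z : Fin 4 → ℝ}
    (hz : z ∉ slab 3 I) : candidate I b B p z = 0 := by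
  ext k
  simp only [candidate, LinearMap.coprod_apply, Pi.add_apply, Fintype.linearCombination_apply,
    Fin.sum_univ_five, LinearMap.toSpanSingleton_apply, Pi.smul_apply, projField, rotField,
    h2Fields, LinearMap.coe_mk, AddHom.coe_mk, Matrix.cons_val, slabField_of_notMem hz]
  simp

/-- The coordinates for which the candidate field is a symmetry. -/
def admissible (I : Set ℝ) (b : ℝ → ℝ) : Submodule ℝ Params where
  carrier := {p | ∀ t ∈ I, p.2.1 * schwarz b t = 0 ∧ projCond b p.2.2 t = 0}
  zero_mem' t _ := by simp [projCond, quad, quadDeriv]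
  add_mem' := by
    intro p q hp hq t ht
    obtain ⟨h1, h2⟩ := hp t ht
    obtain ⟨h3, h4⟩ := hq t ht
    simp only [projCond, quad, quadDeriv, Prod.snd_add, Prod.fst_add, Pi.add_apply] at *
    exact ⟨by linarith, by linarith⟩
  smul_mem' := by
    intro c p hp t ht
    obtain ⟨h1, h2⟩ := hp t ht
    simp only [projCond, quad, quadDeriv, Prod.smul_snd, Prod.smul_fst, Pi.smul_apply,
      smul_eq_mul] at *
    exact ⟨by rw [mul_assoc, h1, mul_zero], by linear_combination c * h2⟩

theorem mem_admissible {I : Set ℝ} {b : ℝ → ℝ} {p : Params} : p ∈ admissible I b ↔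
    ∀ t ∈ I, p.2.1 * schwarz b t = 0 ∧ projCond b p.2.2 t = 0 :=
  Iff.rfl

/-! ### Derivatives of the coefficient -/

theorem ContDiffOn.deriv_contDiffOn {I : Set ℝ} (hI : IsOpen I) {f : ℝ → ℝ}
    (hf : ContDiffOn ℝ ∞ f I) : ContDiffOn ℝ ∞ (deriv f) I :=
  hf.deriv_of_isOpen hI (by simp)

theorem ContDiffOn.hasDerivAt_of_mem {I : Set ℝ} (hI : IsOpen I) {f : ℝ → ℝ}
    (hf : ContDiffOn ℝ ∞ f I) {t : ℝ} (ht : t ∈ I) : HasDerivAt f (deriv f t) t :=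
  ((hf.differentiableOn (by simp)).differentiableAt (hI.mem_nhds ht)).hasDerivAt

theorem hasDerivAt_quad (w : Fin 3 → ℝ) (t : ℝ) : HasDerivAt (quad w) (quadDeriv w t) t := by
  have h := (((hasDerivAt_id t).const_mul (w 1)).const_add (w 0)).add
    (((hasDerivAt_id t).pow 2).const_mul (w 2))
  refine h.congr_deriv ?_
  simp [quadDeriv]
  ring

theorem hasDerivAt_quadDeriv (w : Fin 3 → ℝ) (t : ℝ) : HasDerivAt (quadDeriv w) (2 * w 2) t := by
  have h := ((hasDerivAt_id t).const_mul (2 * w 2)).const_add (w 1)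
  exact h.congr_deriv (by simp)

section Coefficient

variable {I : Set ℝ} {b : ℝ → ℝ}

theorem hasDerivAt_yScale (hI : IsOpen I) (hb : IsCoefficient I b) (w : Fin 3 → ℝ) {t : ℝ}
    (ht : t ∈ I) : HasDerivAt (yScale b w) (yScaleDeriv b w t) t := by
  have h0 := hb.1.hasDerivAt_of_mem hI ht
  have h1 := (hb.1.deriv_contDiffOn hI).hasDerivAt_of_mem hI ht
  have hne := (hb.2 t ht).ne'
  have h := ((hasDerivAt_quadDeriv w t).add ((hasDerivAt_quad w t).mul (h1.div h0 hne))).div_const 2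
  refine h.congr_deriv ?_
  simp only [yScaleDeriv, Pi.div_apply]
  field_simp
  ring

theorem hasDerivAt_yScaleDeriv_div (hI : IsOpen I) (hb : IsCoefficient I b) (w : Fin 3 → ℝ)
    {t : ℝ} (ht : t ∈ I) :
    HasDerivAt (fun t => yScaleDeriv b w t / b t) (projCond b w t / (2 * b t ^ 4)) t := by
  have h0 := hb.1.hasDerivAt_of_mem hI ht
  have h1 := (hb.1.deriv_contDiffOn hI).hasDerivAt_of_mem hI ht
  have h2 := ((hb.1.deriv_contDiffOn hI).deriv_contDiffOn hI).hasDerivAt_of_mem hI ht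
  have hne := (hb.2 t ht).ne'
  have hg := h1.div h0 hne
  have h := ((((hasDerivAt_quadDeriv w t).mul hg).const_add (2 * w 2)).add
    ((hasDerivAt_quad w t).mul ((h2.div h0 hne).sub (hg.pow 2)))).div_const 2 |>.div h0 hne
  refine h.congr_deriv ?_
  simp only [projCond, schwarz, schwarzDeriv, Pi.div_apply, Pi.add_apply, Pi.mul_apply,
    Pi.sub_apply, Pi.pow_apply, Nat.cast_ofNat, Nat.add_one_sub_one, pow_one]
  field_simp
  ring

theorem hasDerivAt_sqrt_coefficient (hI : IsOpen I) (hb : IsCoefficient I b) {t : ℝ}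
    (ht : t ∈ I) : HasDerivAt (fun t => √(b t)) (deriv b t / (2 * √(b t))) t :=
  (hb.1.hasDerivAt_of_mem hI ht).sqrt (hb.2 t ht).ne'

theorem hasDerivAt_inv_sqrt_coefficient (hI : IsOpen I) (hb : IsCoefficient I b) {t : ℝ}
    (ht : t ∈ I) : HasDerivAt (fun t => 1 / √(b t)) (-(deriv b t / (2 * b t * √(b t)))) t := by
  have hpos := hb.2 t ht
  have hr : 0 < √(b t) := Real.sqrt_pos.2 hpos
  have h := (hasDerivAt_const t (1 : ℝ)).div (hasDerivAt_sqrt_coefficient hI hb ht) hr.ne'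
  refine h.congr_deriv ?_
  rw [Real.sq_sqrt hpos.le]
  field_simp
  ring

theorem hasDerivAt_deriv_inv_sqrt (hI : IsOpen I) (hb : IsCoefficient I b) {t : ℝ}
    (ht : t ∈ I) : HasDerivAt (fun t => deriv b t / (4 * b t * √(b t)))
      (schwarz b t / (8 * b t ^ 2 * √(b t))) t := by
  have hpos := hb.2 t ht
  have hr : 0 < √(b t) := Real.sqrt_pos.2 hpos
  have hs := Real.sq_sqrt hpos.le
  have h0 := hb.1.hasDerivAt_of_mem hI ht
  have h1 := (hb.1.deriv_contDiffOn hI).hasDerivAt_of_mem hI ht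
  have h := h1.div ((h0.const_mul 4).mul (hasDerivAt_sqrt_coefficient hI hb ht))
    (by positivity : 4 * b t * √(b t) ≠ 0)
  refine h.congr_deriv ?_
  simp only [schwarz, Pi.mul_apply]
  set r := √(b t)
  rw [← hs]
  field_simp
  ring

theorem hasDerivAt_schwarz (hI : IsOpen I) (hb : IsCoefficient I b) {t : ℝ} (ht : t ∈ I) :
    HasDerivAt (schwarz b)
      (2 * b t * deriv (deriv (deriv b)) t - 4 * deriv b t * deriv (deriv b) t) t := by
  have h0 := hb.1.hasDerivAt_of_mem hI ht
  have h1 := (hb.1.deriv_contDiffOn hI).hasDerivAt_of_mem hI ht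
  have h2 := ((hb.1.deriv_contDiffOn hI).deriv_contDiffOn hI).hasDerivAt_of_mem hI ht
  have h := ((h0.const_mul 2).mul h2).sub ((h1.pow 2).const_mul 3)
  refine h.congr_deriv ?_
  simp
  ring

/-! ### The symmetries are the admissible candidates -/

theorem exists_normalForm_of_admissible (hI : IsOpen I) (hc : IsPreconnected I)
    (hb : IsCoefficient I b) {B : ℝ → ℝ} (hB : ∀ t ∈ I, HasDerivAt B (b t) t) {p : Params}
    (hp : p ∈ admissible I b) :
    ∃ N : NormalForm, N.Solves I b ∧ ∀ z ∈ slab 3 I, N.field z = candidate I b B p z := by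
  obtain ⟨c, k, w⟩ := p
  have hp' := fun t ht => (mem_admissible.1 hp) t ht
  simp only at hp'
  obtain ⟨c11, h11⟩ := eqOn_const_of_hasDerivAt_zero hI hc
    (f := fun t => k * (deriv b t / (4 * b t * √(b t)))) (fun t ht => by
      refine ((hasDerivAt_deriv_inv_sqrt hI hb ht).const_mul k).congr_deriv ?_
      rw [← mul_div_assoc, (hp' t ht).1, zero_div])
  obtain ⟨c02, h02⟩ := eqOn_const_of_hasDerivAt_zero hI hc
    (f := fun t => yScaleDeriv b w t / b t) (fun t ht => by
      refine (hasDerivAt_yScaleDeriv_div hI hb w ht).congr_deriv ?_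
      rw [(hp' t ht).2, zero_div])
  refine ⟨⟨-(w 2) / 4, c11, -c02 / 4, -(c 0) / 2, -(c 2) / 2, quad w, fun t => quadDeriv w t / 2,
    fun t => k * (1 / √(b t)), fun t => c 1 + c 0 * t, fun t => -k * √(b t), yScale b w,
    fun t => c 3 + c 2 * B t, fun t => c 4 - quadDeriv w t / 4 - yScale b w t / 2⟩, ?_, ?_⟩
  · refine ⟨fun t ht => ?_, fun t ht => ?_, fun t ht => ?_, fun t ht => ?_, fun t ht => ?_,
      fun t ht => ?_, fun t ht => ?_, fun t ht => ?_, fun t ht => ?_, fun t ht => ?_⟩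
    · exact (hasDerivAt_quad w t).congr_deriv (by simp only; ring)
    · exact ((hasDerivAt_quadDeriv w t).div_const 2).congr_deriv (by simp only; ring)
    · refine ((hasDerivAt_inv_sqrt_coefficient hI hb ht).const_mul k).congr_deriv ?_
      have hpos := hb.2 t ht
      have hr : 0 < √(b t) := Real.sqrt_pos.2 hpos
      simp only [← h11 t ht]
      field_simp
      ring
    · exact (((hasDerivAt_id t).const_mul (c 0)).const_add (c 1)).congr_deriv (by
        simp only; ring)
    · refine ((hasDerivAt_sqrt_coefficient hI hb ht).const_mul (-k)).congr_deriv ?_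
      have hpos := hb.2 t ht
      have hr : 0 < √(b t) := Real.sqrt_pos.2 hpos
      simp only [← h11 t ht]
      field_simp
      ring
    · refine (hasDerivAt_yScale hI hb w ht).congr_deriv ?_
      have hne := (hb.2 t ht).ne'
      simp only [← h02 t ht]
      field_simp
    · exact (((hB t ht).const_mul (c 2)).const_add (c 3)).congr_deriv (by simp only; ring)
    · refine (((hasDerivAt_quadDeriv w t).div_const 4).const_sub (c 4)
        |>.sub ((hasDerivAt_yScale hI hb w ht).div_const 2)).congr_deriv ?_
      have hne := (hb.2 t ht).ne'
      simp only [← h02 t ht]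
      field_simp
      ring
    · have hpos := hb.2 t ht
      have hr : 0 < √(b t) := Real.sqrt_pos.2 hpos
      have hs := Real.sq_sqrt hpos.le
      simp only
      field_simp
      linear_combination (-k) * hs
    · have hne := (hb.2 t ht).ne'
      simp only [yScale]
      field_simp
  · intro z hz
    rw [candidate_of_mem b B _ hz]
    have e1 := h11 _ hz
    have e2 := h02 _ hz
    have hne := (hb.2 _ hz).ne'
    ext j
    fin_cases j
    · simp [NormalForm.field]
    · simp [NormalForm.field]
      left
      ring
    · simp [NormalForm.field]
    · simp only [NormalForm.field, ← e1, ← e2]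
      simp
      left
      ring

theorem candidate_contDiffAt (hI : IsOpen I) (hb : IsCoefficient I b) {B : ℝ → ℝ}
    (hB : ∀ t ∈ I, HasDerivAt B (b t) t) (p : Params) {z : Fin 4 → ℝ} (hz : z ∈ slab 3 I) :
    ContDiffAt ℝ ∞ (candidate I b B p) z := by
  have hB' : ContDiffOn ℝ ∞ B I := by
    refine (contDiffOn_infty_iff_deriv_of_isOpen hI).2
      ⟨fun t ht => (hB t ht).differentiableAt.differentiableWithinAt, ?_⟩
    exact hb.1.congr fun t ht => (hB t ht).deriv
  have hproj : ∀ k : Fin 4, ContDiffAt ℝ ∞ (fun w : Fin 4 → ℝ => w k) z := fun k =>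
    contDiffAt_pi.1 contDiffAt_id k
  have lift : ∀ f : ℝ → ℝ, ContDiffOn ℝ ∞ f I →
      ContDiffAt ℝ ∞ (fun w : Fin 4 → ℝ => f (w 0)) z := fun f hf =>
    (hf.contDiffAt (hI.mem_nhds hz)).comp z (hproj 0)
  have f0 := lift b hb.1
  have f1 := lift _ (hb.1.deriv_contDiffOn hI)
  have f2 := lift _ ((hb.1.deriv_contDiffOn hI).deriv_contDiffOn hI)
  have fB := lift B hB'
  have hpos := hb.2 _ hz
  have fr : ContDiffAt ℝ ∞ (fun w : Fin 4 → ℝ => √(b (w 0))) z := f0.sqrt hpos.ne'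
  have hr : √(b (z 0)) ≠ 0 := (Real.sqrt_pos.2 hpos).ne'
  have fg := f1.div f0 hpos.ne'
  have fg2 := f2.div f0 hpos.ne'
  have fq : ContDiffAt ℝ ∞ (fun w : Fin 4 → ℝ => quad p.2.2 (w 0)) z := by
    unfold quad
    fun_prop
  have fq' : ContDiffAt ℝ ∞ (fun w : Fin 4 → ℝ => quadDeriv p.2.2 (w 0)) z := by
    unfold quadDeriv
    fun_prop
  have fy : ContDiffAt ℝ ∞ (fun w : Fin 4 → ℝ => yScale b p.2.2 (w 0)) z :=
    (fq'.add (fq.mul fg)).div_const 2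
  have fy' : ContDiffAt ℝ ∞ (fun w : Fin 4 → ℝ => yScaleDeriv b p.2.2 (w 0)) z :=
    ((contDiffAt_const.add (fq'.mul fg)).add (fq.mul (fg2.sub (fg.pow 2)))).div_const 2
  have fk : ContDiffAt ℝ ∞ (fun w : Fin 4 → ℝ => p.2.1 / √(b (w 0))) z :=
    contDiffAt_const.div fr hr
  have fu : ContDiffAt ℝ ∞ (fun w : Fin 4 → ℝ => deriv b (w 0) / (4 * b (w 0) * √(b (w 0)))) z :=
    f1.div ((contDiffAt_const.mul f0).mul fr) (by positivity)
  have fv : ContDiffAt ℝ ∞ (fun w : Fin 4 → ℝ => yScaleDeriv b p.2.2 (w 0) / (4 * b (w 0))) z :=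
    fy'.div (contDiffAt_const.mul f0) (by positivity)
  refine ContDiffAt.congr_of_eventuallyEq ?_ (Filter.eventually_of_mem
    ((isOpen_slab 3 hI).mem_nhds hz) fun w hw => candidate_of_mem b B p hw)
  refine contDiffAt_pi.2 fun k => ?_
  fin_cases k
  · simpa using fq
  · simp only [Fin.mk_one, Matrix.cons_val_one, Matrix.cons_val_zero]
    fun_prop
  · simp only [Fin.reduceFinMk, Matrix.cons_val]
    exact ((contDiffAt_const.mul fr).mul (hproj 1)).add (fy.mul (hproj 2))
      |>.add (contDiffAt_const.add (contDiffAt_const.mul fB))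
  · simp only [Fin.reduceFinMk, Matrix.cons_val]
    fun_prop

theorem candidate_mem_pointSymmetries (hI : IsOpen I) (hc : IsPreconnected I)
    (hb : IsCoefficient I b) {B : ℝ → ℝ} (hB : ∀ t ∈ I, HasDerivAt B (b t) t) {p : Params}
    (hp : p ∈ admissible I b) : candidate I b B p ∈ pointSymmetries I b := by
  obtain ⟨N, hN, h⟩ := exists_normalForm_of_admissible hI hc hb hB hp
  have hs : ∀ z ∈ slab 3 I, ContDiffAt ℝ ∞ N.field z := fun z hz => by
    refine (candidate_contDiffAt hI hb hB p hz).congr_of_eventuallyEq ?_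
    filter_upwards [(isOpen_slab 3 hI).mem_nhds hz] with w hw using h w hw
  have e : candidate I b B p = slabField I N.field := by
    funext z
    by_cases hz : z ∈ slab 3 I
    · rw [slabField_of_mem hz, h z hz]
    · rw [slabField_of_notMem hz, candidate_of_notMem b B p hz]
  rw [e]
  exact hN.slabField_mem hI hb.2 hs

theorem NormalForm.Solves.exists_admissible (hI : IsOpen I) (hc : IsPreconnected I)
    (hb : IsCoefficient I b) {B : ℝ → ℝ} (hB : ∀ t ∈ I, HasDerivAt B (b t) t)
    {N : NormalForm} (hN : N.Solves I b) :
    ∃ p ∈ admissible I b, ∀ z ∈ slab 3 I, N.field z = candidate I b B p z := by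
  have id' : ∀ t : ℝ, HasDerivAt (fun t : ℝ => t) 1 t := fun t => hasDerivAt_id t
  obtain ⟨s0, hs0⟩ := eqOn_const_of_hasDerivAt_zero hI hc (f := fun t => N.σ t + 2 * N.c10 * t)
    (fun t ht => ((hN.σ t ht).add ((id' t).const_mul (2 * N.c10))).congr_deriv (by ring))
  obtain ⟨α0, hα0⟩ := eqOn_const_of_hasDerivAt_zero hI hc (f := fun t => N.α t + 4 * N.c20 * t)
    (fun t ht => ((hN.α t ht).add ((id' t).const_mul (4 * N.c20))).congr_deriv (by ring))
  obtain ⟨r0, hr0⟩ := eqOn_const_of_hasDerivAt_zero hI hc (f := fun t => N.ρ t + 2 * N.c01 * B t)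
    (fun t ht => ((hN.ρ t ht).add ((hB t ht).const_mul (2 * N.c01))).congr_deriv (by ring))
  obtain ⟨g0, hg0⟩ := eqOn_const_of_hasDerivAt_zero hI hc
    (f := fun t => N.γ t + N.α t / 2 + N.m t / 2) (fun t ht =>
      (((hN.γ t ht).add ((hN.α t ht).div_const 2)).add ((hN.m t ht).div_const 2)).congr_deriv
        (by ring))
  obtain ⟨τ0, hτ0⟩ := eqOn_const_of_hasDerivAt_zero hI hc
    (f := fun t => N.τ t - quad ![0, 2 * α0, -4 * N.c20] t) (fun t ht => by
      refine ((hN.τ t ht).sub (hasDerivAt_quad _ t)).congr_deriv ?_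
      simp [quadDeriv]
      linarith [hα0 t ht])
  have κ_eq : ∀ t ∈ I, deriv b t * N.κ t = 4 * b t * N.c11 := fun t ht => by
    have h1 := (hb.1.hasDerivAt_of_mem hI ht).mul (hN.κ t ht)
    have h2 := hasDerivAt_congr_on hI (f := fun t => - N.l t) (g := fun t => b t * N.κ t)
      (fun t ht => by linarith [hN.mixed t ht]) ht h1
    have h3 := h2.unique (hN.l t ht).neg
    linarith
  obtain ⟨k, hk⟩ := eqOn_const_of_hasDerivAt_zero hI hc (f := fun t => N.κ t * √(b t))
    (fun t ht => by
      have hpos := hb.2 t ht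
      have hr : 0 < √(b t) := Real.sqrt_pos.2 hpos
      have hs := Real.sq_sqrt hpos.le
      refine ((hN.κ t ht).mul (hasDerivAt_sqrt_coefficient hI hb ht)).congr_deriv ?_
      field_simp
      rw [hs]
      linarith [κ_eq t ht])
  set w : Fin 3 → ℝ := ![τ0, 2 * α0, -4 * N.c20] with hw
  have τ_eq : ∀ t ∈ I, N.τ t = quad w t := fun t ht => by
    have := hτ0 t ht
    simp [quad, hw] at this ⊢
    linarith
  have α_eq : ∀ t ∈ I, N.α t = quadDeriv w t / 2 := fun t ht => by
    have := hα0 t ht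
    simp [quadDeriv, hw] at this ⊢
    linarith
  have m_eq : ∀ t ∈ I, N.m t = yScale b w t := fun t ht => by
    have := hN.scale t ht
    have hne := (hb.2 t ht).ne'
    rw [τ_eq t ht, α_eq t ht] at this
    simp only [yScale]
    field_simp
    linarith
  have m1_eq : ∀ t ∈ I, yScaleDeriv b w t = b t * (-4 * N.c02) := fun t ht =>
    (hasDerivAt_congr_on hI m_eq ht (hasDerivAt_yScale hI hb w ht)).unique (hN.m t ht)
  refine ⟨(![-2 * N.c10, s0, -2 * N.c01, r0, g0], k, w), ?_, ?_⟩
  · refine mem_admissible.2 fun t ht => ⟨?_, ?_⟩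
    · have h1 := ((hb.1.deriv_contDiffOn hI).hasDerivAt_of_mem hI ht).mul (hN.κ t ht)
      have h2 := ((hb.1.hasDerivAt_of_mem hI ht).const_mul 4).mul_const N.c11
      have h3 := (hasDerivAt_congr_on hI κ_eq ht h2).unique h1
      have h4 := κ_eq t ht
      have h5 := hk t ht
      simp only [schwarz] at h5 ⊢
      rw [← h5]
      linear_combination (-2 * b t * √(b t)) * h3 - 3 * √(b t) * deriv b t * h4
    · have h1 := hasDerivAt_yScaleDeriv_div hI hb w ht
      have h2 := hasDerivAt_congr_on hI (f := fun t => yScaleDeriv b w t / b t)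
        (g := fun _ => -4 * N.c02) (fun t ht => by
          have hne := (hb.2 t ht).ne'
          rw [m1_eq t ht]
          field_simp) ht (hasDerivAt_const t _)
      have h3 := h1.unique h2
      have hpos := hb.2 t ht
      field_simp at h3
      simpa using h3
  · intro z hz
    rw [candidate_of_mem b B _ hz]
    have hpos := hb.2 _ hz
    have hr : 0 < √(b (z 0)) := Real.sqrt_pos.2 hpos
    have e1 := m1_eq _ hz
    have e2 := hs0 _ hz
    have e3 := hr0 _ hz
    have e4 := hg0 _ hz
    have e5 := hk _ hz
    have e6 := κ_eq _ hz
    have e7 := hN.mixed _ hz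
    have e8 := Real.sq_sqrt hpos.le
    have e9 := m_eq _ hz
    have e10 := α_eq _ hz
    have e11 : k / √(b (z 0)) = N.κ (z 0) := by
      rw [← e5]
      field_simp
    have e12 : -k * √(b (z 0)) = N.l (z 0) := by
      rw [← e5]
      linear_combination (-N.κ (z 0)) * e8 - e7
    have e13 : k * (deriv b (z 0) / (4 * b (z 0) * √(b (z 0)))) = N.c11 := by
      have : k * (deriv b (z 0) / (4 * b (z 0) * √(b (z 0)))) =
          k / √(b (z 0)) * deriv b (z 0) / (4 * b (z 0)) := by
        field_simp
      rw [this, e11]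
      field_simp
      linarith
    have e14 : -(yScaleDeriv b w (z 0) / (4 * b (z 0))) = N.c02 := by
      rw [e1]
      field_simp
    have e15 : -(w 2) / 4 = N.c20 := by
      simp [hw]
    simp only [e11, e12, e13, e14, e15, ← e9, ← τ_eq _ hz, ← e10]
    ext j
    fin_cases j
    · simp [NormalForm.field]
    · simp [NormalForm.field, ← e2]
    · simp [NormalForm.field, ← e3]
    · simp [NormalForm.field, ← e4]
      left
      rw [show quadDeriv w (z 0) = 2 * N.α (z 0) by rw [e10]; ring]
      ring

theorem exists_admissible_of_mem_pointSymmetries (hI : IsOpen I) (hc : IsPreconnected I)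
    (hne : I.Nonempty) (hb : IsCoefficient I b) {B : ℝ → ℝ} (hB : ∀ t ∈ I, HasDerivAt B (b t) t)
    {X : VField} (hX : X ∈ pointSymmetries I b) :
    ∃ p ∈ admissible I b, X - candidate I b B p ∈ superpositionSymmetries I b := by
  obtain ⟨h0, hs, hdet⟩ := (isPointSymmetry_iff hI hb.2).1 hX
  obtain ⟨N, hN, hform⟩ := hdet.exists_normalForm hI hc hne hb.2 hB hs
  obtain ⟨p, hp, hcand⟩ := hN.exists_admissible hI hc hb hB
  refine ⟨p, hp, Submodule.sub_mem _ hX (candidate_mem_pointSymmetries hI hc hb hB hp),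
    fun z k => ?_, fun z s => ?_⟩
  · by_cases hz : z ∈ slab 3 I
    · simp [(hform z hz).1 k, hcand z hz]
    · simp [h0 z hz, candidate_of_notMem b B p hz]
  · by_cases hz : z ∈ slab 3 I
    · have hz' := update_mem_slab hz (show (3 : Fin 4) ≠ 0 by decide) s
      simp only [Pi.sub_apply, (hform _ hz).2, (hform _ hz').2, hcand _ hz, hcand _ hz',
        add_sub_cancel_left]
      simp
    · have hz' : Function.update z 3 s ∉ slab 3 I := by simpa [slab] using hz
      simp [h0 z hz, candidate_of_notMem b B p hz, h0 _ hz', candidate_of_notMem b B p hz']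

theorem quad_eq_zero (hI : IsOpen I) (hne : I.Nonempty) {w : Fin 3 → ℝ}
    (h : ∀ t ∈ I, quad w t = 0) : w = 0 := by
  have h1 : ∀ t ∈ I, quadDeriv w t = 0 := fun t ht =>
    (hasDerivAt_quad w t).unique (hasDerivAt_congr_on hI h ht (hasDerivAt_const t 0))
  have h2 : ∀ t ∈ I, 2 * w 2 = 0 := fun t ht =>
    (hasDerivAt_quadDeriv w t).unique (hasDerivAt_congr_on hI h1 ht (hasDerivAt_const t 0))
  obtain ⟨t, ht⟩ := hne
  have e2 : w 2 = 0 := by linarith [h2 t ht]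
  have e1 : w 1 = 0 := by simpa [quadDeriv, e2] using h1 t ht
  have e0 : w 0 = 0 := by simpa [quad, e1, e2] using h t ht
  ext k
  fin_cases k <;> assumption

theorem eq_zero_of_candidate_mem (hI : IsOpen I) (hne : I.Nonempty) (hb : IsCoefficient I b)
    {B : ℝ → ℝ} (hB : ∀ t ∈ I, HasDerivAt B (b t) t) {p : Params}
    (h : candidate I b B p ∈ superpositionSymmetries I b) : p = 0 := by
  obtain ⟨c, k, w⟩ := p
  obtain ⟨-, h1, h2⟩ := h
  have ho : ∀ t ∈ I, ∀ x y u : ℝ, ![t, x, y, u] ∈ slab 3 I := fun t ht x y u => ht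
  have e0 : ∀ t ∈ I, quad w t = 0 := fun t ht => by
    have := h1 ![t, 0, 0, 0] 0
    rw [candidate_of_mem b B _ (ho t ht _ _ _)] at this
    simpa using this
  have hw := quad_eq_zero hI hne e0
  subst hw
  have e1 : ∀ t ∈ I, ∀ y, k / √(b t) * y + (c 1 + c 0 * t) = 0 := fun t ht y => by
    have := h1 ![t, 0, y, 0] 1
    rw [candidate_of_mem b B _ (ho t ht _ _ _)] at this
    simpa using this
  have e2 : ∀ t ∈ I, c 3 + c 2 * B t = 0 := fun t ht => by
    have := h1 ![t, 0, 0, 0] 2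
    rw [candidate_of_mem b B _ (ho t ht _ _ _)] at this
    simpa using this
  have hc0 := quad_eq_zero hI hne (w := ![c 1, c 0, 0]) (fun t ht => by
    simpa [quad] using e1 t ht 0)
  have c1 : c 1 = 0 := congrFun hc0 0
  have c0 : c 0 = 0 := congrFun hc0 1
  obtain ⟨t, ht⟩ := hne
  have hpos := hb.2 t ht
  have hr : 0 < √(b t) := Real.sqrt_pos.2 hpos
  have hk : k = 0 := by
    have := e1 t ht 1
    simp [c0, c1, hr.ne'] at this
    exact this
  have c2 : c 2 = 0 := by
    have h3 := ((hB t ht).const_mul (c 2)).const_add (c 3)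
    have h4 := h3.unique (hasDerivAt_congr_on hI e2 ht (hasDerivAt_const t 0))
    simpa [hpos.ne'] using h4
  have c3 : c 3 = 0 := by simpa [c2] using e2 t ht
  have c4 : c 4 = 0 := by
    have h3 := h2 ![t, 0, 0, 0] 1
    have e : Function.update ![t, 0, 0, 0] (3 : Fin 4) (1 : ℝ) = ![t, 0, 0, 1] := by
      ext j
      fin_cases j <;> simp [Function.update]
    rw [e, candidate_of_mem b B _ (ho t ht _ _ _), candidate_of_mem b B _ (ho t ht _ _ _)] at h3
    simpa [quadDeriv, yScale, quad] using h3
  refine Prod.ext ?_ (Prod.ext hk rfl)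
  ext j
  fin_cases j <;> assumption

end Coefficient

/-! ### The symmetry algebra in coordinates -/

theorem exists_antiderivative {I : Set ℝ} (hI : IsOpen I) (hc : IsPreconnected I)
    (hne : I.Nonempty) {b : ℝ → ℝ} (hb : ContinuousOn b I) :
    ∃ B : ℝ → ℝ, ∀ t ∈ I, HasDerivAt B (b t) t := by
  obtain ⟨a, ha⟩ := hne
  refine ⟨fun t => ∫ s in a..t, b s, fun t ht => ?_⟩
  have hsub : Set.uIcc a t ⊆ I := hc.ordConnected.uIcc_subset ha ht
  exact intervalIntegral.integral_hasDerivAt_right (hb.mono hsub).intervalIntegrable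
    (hb.stronglyMeasurableAtFilter hI t ht) (hb.continuousAt (hI.mem_nhds ht))

section Algebra

variable {I : Set ℝ} {b : ℝ → ℝ}

theorem superposition_le : superpositionSymmetries I b ≤ pointSymmetries I b := fun _ h => h.1

theorem pointSymmetries_eq (hI : IsOpen I) (hc : IsPreconnected I)
    (hne : I.Nonempty) (hb : IsCoefficient I b) {B : ℝ → ℝ} (hB : ∀ t ∈ I, HasDerivAt B (b t) t) :
    (admissible I b).map (candidate I b B) ⊔ superpositionSymmetries I b =
      pointSymmetries I b := by
  refine le_antisymm (sup_le ?_ superposition_le) fun X hX => ?_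
  · rintro _ ⟨p, hp, rfl⟩
    exact candidate_mem_pointSymmetries hI hc hb hB hp
  · obtain ⟨p, hp, h⟩ := exists_admissible_of_mem_pointSymmetries hI hc hne hb hB hX
    exact Submodule.mem_sup.2 ⟨_, ⟨p, hp, rfl⟩, _, h, by simp⟩

theorem ker_mkQ_candidate (hI : IsOpen I) (hne : I.Nonempty) (hb : IsCoefficient I b)
    {B : ℝ → ℝ} (hB : ∀ t ∈ I, HasDerivAt B (b t) t) :
    LinearMap.ker ((superpositionSymmetries I b).mkQ ∘ₗ candidate I b B) = ⊥ := by
  refine (Submodule.eq_bot_iff _).2 fun p hp => eq_zero_of_candidate_mem hI hne hb hB ?_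
  simpa using hp

theorem indepModSuperposition_candidate (hI : IsOpen I) (hne : I.Nonempty)
    (hb : IsCoefficient I b) {B : ℝ → ℝ} (hB : ∀ t ∈ I, HasDerivAt B (b t) t) {ι : Type}
    {v : ι → Params} (hv : LinearIndependent ℝ v) :
    IndepModSuperposition I b fun i => candidate I b B (v i) :=
  hv.map' _ (ker_mkQ_candidate hI hne hb hB)

theorem isSymmetryBasis_candidate (hI : IsOpen I) (hc : IsPreconnected I) (hne : I.Nonempty)
    (hb : IsCoefficient I b) {B : ℝ → ℝ} (hB : ∀ t ∈ I, HasDerivAt B (b t) t) {ι : Type}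
    {v : ι → Params} (hv : LinearIndependent ℝ v)
    (hs : Submodule.span ℝ (Set.range v) = admissible I b) :
    IsSymmetryBasis I b fun i => candidate I b B (v i) := by
  refine ⟨indepModSuperposition_candidate hI hne hb hB hv, ?_⟩
  rw [← pointSymmetries_eq hI hc hne hb hB, ← hs, Submodule.map_span, ← Set.range_comp]
  rfl

theorem symmetryDim_eq (hI : IsOpen I) (hc : IsPreconnected I) (hne : I.Nonempty)
    (hb : IsCoefficient I b) : symmetryDim I b = (Module.finrank ℝ (admissible I b) : Cardinal) := by
  obtain ⟨B, hB⟩ := exists_antiderivative hI hc hne hb.1.continuousOn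
  let f : admissible I b →ₗ[ℝ] pointSymmetries I b :=
    ((candidate I b B).comp (admissible I b).subtype).codRestrict _ fun p =>
      candidate_mem_pointSymmetries hI hc hb hB p.2
  let g := ((superpositionSymmetries I b).submoduleOf (pointSymmetries I b)).mkQ ∘ₗ f
  have hinj : Function.Injective g := by
    rw [← LinearMap.ker_eq_bot]
    refine (Submodule.eq_bot_iff _).2 fun p hp => Subtype.ext ?_
    exact eq_zero_of_candidate_mem hI hne hb hB ((Submodule.Quotient.mk_eq_zero
      ((superpositionSymmetries I b).submoduleOf (pointSymmetries I b))).1 hp)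
  have hsurj : Function.Surjective g := by
    intro Y
    obtain ⟨X, rfl⟩ := Submodule.mkQ_surjective _ Y
    obtain ⟨p, hp, h⟩ := exists_admissible_of_mem_pointSymmetries hI hc hne hb hB X.2
    exact ⟨⟨p, hp⟩, ((Submodule.Quotient.eq
      ((superpositionSymmetries I b).submoduleOf (pointSymmetries I b))).2 h).symm⟩
  have := (LinearEquiv.ofBijective g ⟨hinj, hsurj⟩).rank_eq
  rw [symmetryDim, ← this, Module.finrank_eq_rank]

theorem h2Fields_eq_candidate (I : Set ℝ) (b B : ℝ → ℝ) (i : Fin 5) :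
    h2Fields I B i = candidate I b B (Pi.single i 1, 0, 0) := by
  simp [candidate, Fintype.linearCombination_apply, Pi.single_apply]

/-- If the Schwarzian derivative does not vanish identically, two quadratic time components of
symmetries are proportional, since their Wronskian vanishes where the Schwarzian does not. -/
theorem exists_generator_of_schwarz_ne_zero (hI : IsOpen I) (hb : IsCoefficient I b) {t₁ : ℝ}
    (ht₁ : t₁ ∈ I) (hS : schwarz b t₁ ≠ 0) :
    ∃ w : Fin 3 → ℝ, ∀ v : Fin 3 → ℝ, (∀ t ∈ I, projCond b v t = 0) → ∃ s : ℝ, v = s • w := by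
  by_cases h : ∃ w : Fin 3 → ℝ, (∀ t ∈ I, projCond b w t = 0) ∧ w ≠ 0
  · obtain ⟨w, hw, hne⟩ := h
    refine ⟨w, fun v hv => ?_⟩
    have hU : IsOpen (I ∩ schwarz b ⁻¹' {0}ᶜ) := by
      have hcont : ContinuousOn (schwarz b) I := fun t ht =>
        (hasDerivAt_schwarz hI hb ht).continuousAt.continuousWithinAt
      exact hcont.isOpen_inter_preimage hI isOpen_compl_singleton
    have hwr := quad_eq_zero hU ⟨t₁, ht₁, hS⟩
      (w := ![w 0 * v 1 - w 1 * v 0, 2 * (w 0 * v 2 - w 2 * v 0), w 1 * v 2 - w 2 * v 1])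
      (fun t ht => by
        have hbS : b t * schwarz b t ≠ 0 := mul_ne_zero (hb.2 t ht.1).ne' ht.2
        have e1 := hw t ht.1
        have e2 := hv t ht.1
        have e3 : b t * schwarz b t * (quad w t * quadDeriv v t - quadDeriv w t * quad v t) = 0 := by
          simp only [projCond] at e1 e2
          linear_combination quad w t * e2 - quad v t * e1
        have e4 := (mul_eq_zero.1 e3).resolve_left hbS
        simp only [quad, quadDeriv, Matrix.cons_val] at e4 ⊢
        linear_combination e4)
    have c0 : w 0 * v 1 - w 1 * v 0 = 0 := congrFun hwr 0
    have c1 : 2 * (w 0 * v 2 - w 2 * v 0) = 0 := congrFun hwr 1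
    have c2 : w 1 * v 2 - w 2 * v 1 = 0 := congrFun hwr 2
    have key : ∀ i j, w i * v j = w j * v i := by
      intro i j
      fin_cases i <;> fin_cases j <;> simp <;> linarith
    obtain ⟨i, hi⟩ := Function.ne_iff.1 hne
    have hi' : w i ≠ 0 := hi
    refine ⟨v i / w i, ?_⟩
    ext j
    simp only [Pi.smul_apply, smul_eq_mul]
    field_simp
    linarith [key i j]
  · push Not at h
    exact ⟨0, fun v hv => ⟨0, by simp [h v hv]⟩⟩

theorem finrank_admissible_le (hI : IsOpen I) (hb : IsCoefficient I b) {t₁ : ℝ}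
    (ht₁ : t₁ ∈ I) (hS : schwarz b t₁ ≠ 0) : Module.finrank ℝ (admissible I b) ≤ 6 := by
  obtain ⟨w, hw⟩ := exists_generator_of_schwarz_ne_zero hI hb ht₁ hS
  let g : (Fin 5 → ℝ) × ℝ →ₗ[ℝ] Params :=
    LinearMap.prodMap LinearMap.id ((0 : ℝ →ₗ[ℝ] ℝ).prod (LinearMap.toSpanSingleton ℝ _ w))
  have hle : admissible I b ≤ LinearMap.range g := by
    rintro ⟨c, k, v⟩ hp
    obtain ⟨s, hs⟩ := hw v fun t ht => ((mem_admissible.1 hp) t ht).2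
    have hk : k = 0 := (mul_eq_zero.1 ((mem_admissible.1 hp) t₁ ht₁).1).resolve_right hS
    exact ⟨(c, s), by simp [g, hk, hs]⟩
  calc Module.finrank ℝ (admissible I b) ≤ Module.finrank ℝ (LinearMap.range g) :=
        Submodule.finrank_mono hle
    _ ≤ Module.finrank ℝ ((Fin 5 → ℝ) × ℝ) := LinearMap.finrank_range_le g
    _ = 6 := by simp

theorem schwarzDeriv_eq_zero (hI : IsOpen I) (hb : IsCoefficient I b)
    (h : ∀ t ∈ I, schwarz b t = 0) {t : ℝ} (ht : t ∈ I) : schwarzDeriv b t = 0 := by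
  have h1 := (hasDerivAt_schwarz hI hb ht).unique
    (hasDerivAt_congr_on hI h ht (hasDerivAt_const t 0))
  have h2 := h t ht
  simp only [schwarz] at h2
  simp only [schwarzDeriv]
  linear_combination (b t / 2) * h1 - deriv b t * h2

theorem admissible_eq_top (hI : IsOpen I) (hb : IsCoefficient I b)
    (h : ∀ t ∈ I, schwarz b t = 0) : admissible I b = ⊤ :=
  eq_top_iff.2 fun p _ => mem_admissible.2 fun t ht => by
    simp [projCond, h t ht, schwarzDeriv_eq_zero hI hb h ht]

theorem symmetryDim_eq_nine (hI : IsOpen I) (hc : IsPreconnected I) (hne : I.Nonempty)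
    (hb : IsCoefficient I b) (h : ∀ t ∈ I, schwarz b t = 0) : symmetryDim I b = 9 := by
  rw [symmetryDim_eq hI hc hne hb, admissible_eq_top hI hb h]
  simp

theorem symmetryDim_le_six (hI : IsOpen I) (hc : IsPreconnected I) (hne : I.Nonempty)
    (hb : IsCoefficient I b) (h : ¬ ∀ t ∈ I, schwarz b t = 0) : symmetryDim I b ≤ 6 := by
  push Not at h
  obtain ⟨t, ht, hS⟩ := h
  rw [symmetryDim_eq hI hc hne hb]
  exact_mod_cast finrank_admissible_le hI hb ht hS

theorem linearIndependent_single_params :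
    LinearIndependent ℝ fun i : Fin 5 => ((Pi.single i 1, 0, 0) : Params) := by
  have h := (Pi.basisFun ℝ (Fin 5)).linearIndependent.map'
    (LinearMap.inl ℝ (Fin 5 → ℝ) (ℝ × (Fin 3 → ℝ))) (LinearMap.ker_eq_bot.2
      LinearMap.inl_injective)
  have e : (fun i : Fin 5 => ((Pi.single i 1, 0, 0) : Params)) =
      LinearMap.inl ℝ (Fin 5 → ℝ) (ℝ × (Fin 3 → ℝ)) ∘ Pi.basisFun ℝ (Fin 5) := by
    funext i
    simp
  rw [e]
  exact h

theorem span_single_params : Submodule.span ℝ (Set.range fun i : Fin 5 =>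
    ((Pi.single i 1, 0, 0) : Params)) = LinearMap.range (LinearMap.inl ℝ (Fin 5 → ℝ) _) := by
  rw [← Submodule.map_top, ← (Pi.basisFun ℝ (Fin 5)).span_eq, Submodule.map_span,
    ← Set.range_comp]
  congr 2
  ext i : 1
  simp

/-- The symmetry algebra is the Heisenberg algebra exactly if no nonzero quadratic polynomial is
the time component of a symmetry. -/
theorem isSymmetryBasis_h2Fields_iff (hI : IsOpen I) (hc : IsPreconnected I) (hne : I.Nonempty)
    (hb : IsCoefficient I b) {B : ℝ → ℝ} (hB : ∀ t ∈ I, HasDerivAt B (b t) t) :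
    IsSymmetryBasis I b (h2Fields I B) ↔
      ∀ w : Fin 3 → ℝ, (∀ t ∈ I, projCond b w t = 0) → w = 0 := by
  have e : h2Fields I B = fun i => candidate I b B (Pi.single i 1, 0, 0) :=
    funext (h2Fields_eq_candidate I b B)
  constructor
  · rintro ⟨-, h⟩ w hw
    have hmem : candidate I b B (0, 0, w) ∈ pointSymmetries I b :=
      candidate_mem_pointSymmetries hI hc hb hB (mem_admissible.2 fun t ht => ⟨by simp, hw t ht⟩)
    rw [← h, e] at hmem
    have hr : Set.range (fun i : Fin 5 => candidate I b B (Pi.single i 1, 0, 0)) =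
        candidate I b B '' Set.range (fun i : Fin 5 => ((Pi.single i 1, 0, 0) : Params)) := by
      rw [← Set.range_comp]
      rfl
    rw [hr, ← Submodule.map_span, span_single_params] at hmem
    obtain ⟨_, ⟨_, ⟨c, rfl⟩, rfl⟩, Y, hY, hsum⟩ := Submodule.mem_sup.1 hmem
    have h0 := eq_zero_of_candidate_mem hI hne hb hB
      (p := (0, 0, w) - LinearMap.inl ℝ (Fin 5 → ℝ) _ c) (by
        rw [map_sub, ← hsum, add_sub_cancel_left]
        exact hY)
    simpa using congrArg (fun p : Params => p.2.2) h0
  · intro h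
    rw [e]
    refine isSymmetryBasis_candidate hI hc hne hb hB ?_ ?_
    · exact linearIndependent_single_params
    · rw [span_single_params]
      refine le_antisymm ?_ ?_
      · rintro _ ⟨c, rfl⟩
        exact mem_admissible.2 fun t _ => by simp [projCond, quad, quadDeriv]
      · rintro ⟨c, k, w⟩ hp
        have hw := h w fun t ht => ((mem_admissible.1 hp) t ht).2
        have hk : k = 0 := by
          by_contra hk
          have hS : ∀ t ∈ I, schwarz b t = 0 := fun t ht =>
            (mul_eq_zero.1 ((mem_admissible.1 hp) t ht).1).resolve_left hk
          have := h ![1, 0, 0] fun t ht => by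
            simp [projCond, hS t ht, schwarzDeriv_eq_zero hI hb hS ht]
          simpa using congrFun this 0
        exact ⟨c, by simp [hw, hk]; rfl⟩

theorem hasOnlyH2_iff (hI : IsOpen I) (hc : IsPreconnected I) (hne : I.Nonempty)
    (hb : IsCoefficient I b) :
    HasOnlyH2 I b ↔ ∀ w : Fin 3 → ℝ, (∀ t ∈ I, projCond b w t = 0) → w = 0 := by
  constructor
  · rintro ⟨B, hB, h⟩
    exact (isSymmetryBasis_h2Fields_iff hI hc hne hb hB).1 h
  · intro h
    obtain ⟨B, hB⟩ := exists_antiderivative hI hc hne hb.1.continuousOn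
    exact ⟨B, hB, (isSymmetryBasis_h2Fields_iff hI hc hne hb hB).2 h⟩

end Algebra

/-! ### Generic coefficients -/

/-- The coefficients of `projCond b w t` as a linear form in `w`, in terms of the third jet `j` of
`b` at `t`. -/
def condRow {S : Type*} [CommRing S] (t : S) (j : Fin 4 → S) : Fin 3 → S :=
  let q := j 0 * (2 * j 0 * j 2 - 3 * j 1 ^ 2)
  let r := j 0 ^ 2 * j 3 - 4 * j 0 * j 1 * j 2 + 3 * j 1 ^ 3
  ![r, q + t * r, 2 * t * q + t ^ 2 * r]

/-- The determinant of the linear forms `condRow` at three points. -/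
def condDet {S : Type*} [CommRing S] (t : Fin 3 → S) (j : Fin 3 → Fin 4 → S) : S :=
  (Matrix.of fun i => condRow (t i) (j i)).det

/-- The values of the derivatives of `b` at `t` up to the third. -/
noncomputable def jet (b : ℝ → ℝ) (t : ℝ) : Fin 4 → ℝ := fun k => iteratedDeriv k b t

theorem condRow_dotProduct (b : ℝ → ℝ) (w : Fin 3 → ℝ) (t : ℝ) :
    condRow t (jet b t) ⬝ᵥ w = projCond b w t := by
  simp [condRow, jet, dotProduct, Fin.sum_univ_three, projCond, quad, quadDeriv, schwarz,
    schwarzDeriv, iteratedDeriv_succ, iteratedDeriv_zero]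
  ring

theorem eq_zero_of_condDet_ne_zero {I : Set ℝ} {b : ℝ → ℝ} {ts : Fin 3 → ℝ} (hts : ∀ i, ts i ∈ I)
    (h : condDet ts (fun i => jet b (ts i)) ≠ 0) (w : Fin 3 → ℝ)
    (hw : ∀ t ∈ I, projCond b w t = 0) : w = 0 := by
  refine Matrix.eq_zero_of_mulVec_eq_zero h ?_
  ext i
  exact (condRow_dotProduct b w (ts i)).trans (hw _ (hts i))

/-- If no nonzero `w` is annihilated by all the linear forms, three of them are independent. -/
theorem exists_condDet_ne_zero {I : Set ℝ} {b : ℝ → ℝ}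
    (h : ∀ w : Fin 3 → ℝ, (∀ t ∈ I, projCond b w t = 0) → w = 0) :
    ∃ ts : Fin 3 → ℝ, (∀ i, ts i ∈ I) ∧ condDet ts (fun i => jet b (ts i)) ≠ 0 := by
  have htop : Submodule.span ℝ ((fun t => condRow t (jet b t)) '' I) = ⊤ := by
    by_contra hlt
    obtain ⟨f, hf, hle⟩ := Submodule.exists_le_ker_of_lt_top _ (lt_top_iff_ne_top.2 hlt)
    refine hf ?_
    have hf' : ∀ v : Fin 3 → ℝ, f v = v ⬝ᵥ fun i => f (Pi.single i 1) := fun v => by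
      conv_lhs => rw [pi_eq_sum_univ' v]
      simp [dotProduct, map_sum]
    have h0 := h (fun i => f (Pi.single i 1)) fun t ht => by
      rw [← condRow_dotProduct, ← hf']
      exact hle (Submodule.subset_span ⟨t, ht, rfl⟩)
    ext i
    simpa using congrFun h0 i
  obtain ⟨f, hf, -, hli⟩ := Submodule.exists_fun_fin_finrank_span_eq ℝ
    ((fun t => condRow t (jet b t)) '' I)
  have h3 : Module.finrank ℝ (Submodule.span ℝ ((fun t => condRow t (jet b t)) '' I)) = 3 := by
    rw [htop]
    simp
  let g : Fin 3 → Fin 3 → ℝ := fun i => f (Fin.cast h3.symm i)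
  have hg : LinearIndependent ℝ g := hli.comp _ (Fin.cast_injective _)
  choose ts hts hts' using fun i : Fin 3 => hf (Fin.cast h3.symm i)
  refine ⟨ts, hts, ?_⟩
  have e : (Matrix.of fun i => condRow (ts i) (jet b (ts i))) = Matrix.of g :=
    congrArg Matrix.of (funext hts')
  rw [condDet, e]
  have := Matrix.linearIndependent_rows_iff_isUnit (A := Matrix.of g) |>.1 hg
  exact ((Matrix.isUnit_iff_isUnit_det _).1 this).ne_zero

theorem continuous_condDet (ts : Fin 3 → ℝ) : Continuous (condDet ts) := by
  simp only [funext fun j => (show condDet ts j = _ from Matrix.det_fin_three _)]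
  simp only [Matrix.of_apply, condRow, Matrix.cons_val]
  fun_prop

theorem map_condDet {S S' : Type*} [CommRing S] [CommRing S'] (f : S →+* S') (t : Fin 3 → S)
    (j : Fin 3 → Fin 4 → S) : f (condDet t j) = condDet (fun i => f (t i)) fun i k => f (j i k) := by
  simp [condDet, Matrix.det_fin_three, condRow, map_ofNat]

theorem condDet_smul (c : ℝ) (t : Fin 3 → ℝ) (j : Fin 3 → Fin 4 → ℝ) :
    condDet t (fun i k => c * j i k) = c ^ 9 * condDet t j := by
  simp [condDet, Matrix.det_fin_three, condRow]
  ring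

theorem hasOnlyH2_of_ckClose {I : Set ℝ} (hI : IsOpen I) (hc : IsPreconnected I)
    (hne : I.Nonempty) {b : ℝ → ℝ} (hb : IsCoefficient I b) (h : HasOnlyH2 I b) :
    ∃ J ⊆ I, IsCompact J ∧ ∃ N : ℕ, ∃ ε > 0, ∀ b' : ℝ → ℝ, IsCoefficient I b' →
      CkClose J N ε b' b → HasOnlyH2 I b' := by
  obtain ⟨ts, hts, hdet⟩ := exists_condDet_ne_zero ((hasOnlyH2_iff hI hc hne hb).1 h)
  obtain ⟨ε, hε, hball⟩ := Metric.isOpen_iff.1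
    (isOpen_ne.preimage (continuous_condDet ts)) (fun i => jet b (ts i)) hdet
  refine ⟨Set.range ts, Set.range_subset_iff.2 hts, (Set.finite_range ts).isCompact, 3, ε, hε,
    fun b' hb' hclose => (hasOnlyH2_iff hI hc hne hb').2 ?_⟩
  refine eq_zero_of_condDet_ne_zero hts (hball (a := fun i => jet b' (ts i)) ?_)
  refine (dist_pi_lt_iff hε).2 fun i => (dist_pi_lt_iff hε).2 fun k => ?_
  rw [Real.dist_eq]
  exact hclose k (Nat.lt_succ_iff.1 k.2) (ts i) ⟨i, rfl⟩

/-- A positive function on the line whose symmetry algebra is the Heisenberg algebra on every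
interval; it serves as the direction of the perturbations. -/
noncomputable def gauss (t : ℝ) : ℝ := Real.exp (t ^ 2 / 2)

theorem contDiff_gauss : ContDiff ℝ ∞ gauss := by
  unfold gauss
  fun_prop

theorem deriv_gauss : deriv gauss = (fun t => t * gauss t) ∧
    deriv (fun t => t * gauss t) = (fun t => (1 + t ^ 2) * gauss t) ∧
    deriv (fun t => (1 + t ^ 2) * gauss t) = fun t => (3 * t + t ^ 3) * gauss t := by
  have h : ∀ t, HasDerivAt gauss (t * gauss t) t := fun t => by
    have := (((hasDerivAt_id t).pow 2).div_const 2).exp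
    refine this.congr_deriv ?_
    simp [gauss]
    ring
  have h1 : deriv gauss = fun t => t * gauss t := funext fun t => (h t).deriv
  have h2 : deriv (fun t => t * gauss t) = fun t => (1 + t ^ 2) * gauss t := funext fun t => by
    refine (((hasDerivAt_id t).mul (h t)).congr_deriv ?_).deriv
    simp
    ring
  have h3 : deriv (fun t => (1 + t ^ 2) * gauss t) = fun t => (3 * t + t ^ 3) * gauss t :=
    funext fun t => by
      refine (((((hasDerivAt_id t).pow 2).const_add 1).mul (h t)).congr_deriv ?_).deriv
      simp
      ring
  exact ⟨h1, h2, h3⟩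

theorem eq_zero_of_projCond_gauss {I : Set ℝ} (hI : IsOpen I) (hne : I.Nonempty) (w : Fin 3 → ℝ)
    (h : ∀ t ∈ I, projCond gauss w t = 0) : w = 0 := by
  have h1 : ∀ t ∈ I, 2 * w 1 + (4 * w 2 - w 0) * t - 2 * w 1 * t ^ 2 - 3 * w 2 * t ^ 3 = 0 := by
    intro t ht
    have := h t ht
    have hg : gauss t ^ 3 ≠ 0 := (pow_pos (Real.exp_pos _) 3).ne'
    simp only [projCond, schwarz, schwarzDeriv, deriv_gauss.1, deriv_gauss.2.1, deriv_gauss.2.2,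
      quad, quadDeriv] at this
    refine mul_left_cancel₀ hg ?_
    linear_combination this
  have h2 : ∀ t ∈ I, quad ![4 * w 2 - w 0, -4 * w 1, -9 * w 2] t = 0 := fun t ht => by
    have e := (((((hasDerivAt_id t).const_mul (4 * w 2 - w 0)).const_add (2 * w 1)).sub
      (((hasDerivAt_id t).pow 2).const_mul (2 * w 1))).sub
      (((hasDerivAt_id t).pow 3).const_mul (3 * w 2))).unique
        (hasDerivAt_congr_on hI h1 ht (hasDerivAt_const t 0))
    simp [quad] at e ⊢
    linarith
  have h3 := quad_eq_zero hI hne h2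
  have e0 : 4 * w 2 - w 0 = 0 := congrFun h3 0
  have e1 : -4 * w 1 = 0 := congrFun h3 1
  have e2 : -9 * w 2 = 0 := congrFun h3 2
  ext i
  fin_cases i <;> simp <;> linarith

theorem exists_hasOnlyH2_ckClose {I : Set ℝ} (hI : IsOpen I) (hc : IsPreconnected I)
    (hne : I.Nonempty) {b : ℝ → ℝ} (hb : IsCoefficient I b) {J : Set ℝ} (hJI : J ⊆ I)
    (hJ : IsCompact J) (N : ℕ) {ε : ℝ} (hε : 0 < ε) :
    ∃ b' : ℝ → ℝ, IsCoefficient I b' ∧ CkClose J N ε b' b ∧ HasOnlyH2 I b' := by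
  obtain ⟨ts, hts, hdet⟩ := exists_condDet_ne_zero (eq_zero_of_projCond_gauss hI hne)
  have hbound : ∃ C > 0, ∀ k ≤ N, ∀ t ∈ J, |iteratedDeriv k gauss t| ≤ C := by
    have h1 : ∀ k : ℕ, ∃ C, ∀ t ∈ J, |iteratedDeriv k gauss t| ≤ C := fun k =>
      hJ.exists_bound_of_continuousOn
        (contDiff_gauss.continuous_iteratedDeriv k (by exact_mod_cast le_top)).continuousOn
    choose C hC using h1
    refine ⟨∑ k ∈ Finset.range (N + 1), |C k| + 1, by positivity, fun k hk t ht => ?_⟩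
    have h2 := Finset.single_le_sum (f := fun k => |C k|) (fun i _ => abs_nonneg _)
      (Finset.mem_range.2 (Nat.lt_succ_iff.2 hk))
    linarith [hC k t ht, le_abs_self (C k)]
  obtain ⟨C, hC0, hC⟩ := hbound
  -- `condDet` of `s b + gauss` is a polynomial in `s`, nonzero at `s = 0`
  let p : Polynomial ℝ := condDet (fun i => Polynomial.C (ts i)) fun i k =>
    Polynomial.C (jet b (ts i) k) * Polynomial.X + Polynomial.C (jet gauss (ts i) k)
  have hp : ∀ s : ℝ, p.eval s =
      condDet ts fun i k => jet b (ts i) k * s + jet gauss (ts i) k := fun s => by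
    have := map_condDet (Polynomial.evalRingHom s) (fun i => Polynomial.C (ts i)) fun i k =>
      Polynomial.C (jet b (ts i) k) * Polynomial.X + Polynomial.C (jet gauss (ts i) k)
    simpa [p] using this
  have hp0 : p ≠ 0 := fun h0 => hdet (by simpa [h0] using (hp 0).symm)
  obtain ⟨s, hs, hroot⟩ : ∃ s > C / ε, p.eval s ≠ 0 := by
    by_contra! hall
    exact hp0 (p.eq_zero_of_infinite_isRoot ((Set.Ioi_infinite (C / ε)).mono hall))
  have hs0 : 0 < s := lt_trans (by positivity) hs
  -- perturb with the small factor `1 / s`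
  have hjet : ∀ k : ℕ, ∀ t ∈ I, iteratedDeriv k (fun t => b t + s⁻¹ * gauss t) t =
      iteratedDeriv k b t + s⁻¹ * iteratedDeriv k gauss t := by
    intro k t ht
    have h1 : ContDiffAt ℝ k b t :=
      (hb.1.contDiffAt (hI.mem_nhds ht)).of_le (by exact_mod_cast le_top)
    have h2 : ContDiffAt ℝ k gauss t :=
      contDiff_gauss.contDiffAt.of_le (by exact_mod_cast le_top)
    rw [iteratedDeriv_fun_add h1 (contDiffAt_const.mul h2), iteratedDeriv_const_mul_field]
  have hb' : IsCoefficient I fun t => b t + s⁻¹ * gauss t := by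
    refine ⟨hb.1.add (contDiffOn_const.mul contDiff_gauss.contDiffOn), fun t ht => ?_⟩
    have h1 := hb.2 t ht
    have h2 : 0 < gauss t := Real.exp_pos _
    positivity
  refine ⟨fun t => b t + s⁻¹ * gauss t, hb', fun k hk t ht => ?_,
    (hasOnlyH2_iff hI hc hne hb').2 ?_⟩
  · rw [hjet k t (hJI ht), add_sub_cancel_left, abs_mul, abs_of_pos (inv_pos.2 hs0)]
    have h1 := hC k hk t ht
    rw [gt_iff_lt, div_lt_iff₀ hε] at hs
    calc s⁻¹ * |iteratedDeriv k gauss t| ≤ s⁻¹ * C := by gcongr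
      _ < s⁻¹ * (s * ε) := by gcongr
      _ = ε := by field_simp
  · refine eq_zero_of_condDet_ne_zero hts ?_
    have e : (fun i => jet (fun t => b t + s⁻¹ * gauss t) (ts i)) =
        fun i k => s⁻¹ * (jet b (ts i) k * s + jet gauss (ts i) k) := by
      ext i k
      simp only [jet]
      rw [hjet k _ (hts i)]
      field_simp
    rw [e, condDet_smul, ← hp]
    exact mul_ne_zero (pow_ne_zero _ (inv_ne_zero hs0.ne')) hroot

/-! ### The Heisenberg algebra -/

section Heisenberg

variable {I : Set ℝ} {b B : ℝ → ℝ}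

theorem h2Fields_mem_pointSymmetries (hI : IsOpen I) (hc : IsPreconnected I)
    (hb : IsCoefficient I b) (hB : ∀ t ∈ I, HasDerivAt B (b t) t) (i : Fin 5) :
    h2Fields I B i ∈ pointSymmetries I b := by
  rw [h2Fields_eq_candidate I b B i]
  exact candidate_mem_pointSymmetries hI hc hb hB
    (mem_admissible.2 fun t _ => by simp [projCond, quad, quadDeriv])

theorem indepModSuperposition_h2Fields (hI : IsOpen I) (hne : I.Nonempty)
    (hb : IsCoefficient I b) (hB : ∀ t ∈ I, HasDerivAt B (b t) t) :
    IndepModSuperposition I b (h2Fields I B) := by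
  rw [funext (h2Fields_eq_candidate I b B)]
  exact indepModSuperposition_candidate hI hne hb hB linearIndependent_single_params

theorem fderiv_candidate_apply (hI : IsOpen I) (hb : IsCoefficient I b)
    (hB : ∀ t ∈ I, HasDerivAt B (b t) t) (c : Fin 5 → ℝ) {z v : Fin 4 → ℝ} (hz : z ∈ slab 3 I)
    (hv : v 0 = 0) : fderiv ℝ (candidate I b B (c, 0, 0)) z v =
      ![0, 0, 0, -(c 0 / 2 * v 1 + c 2 / 2 * v 2) * z 3
        + (c 4 - c 0 / 2 * z 1 - c 2 / 2 * z 2) * v 3] := by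
  have hd : DifferentiableAt ℝ (candidate I b B (c, 0, 0)) (z + (0 : ℝ) • v) := by
    simpa using (candidate_contDiffAt hI hb hB (c, 0, 0) hz).differentiableAt (by simp)
  have hl : HasDerivAt (fun s : ℝ => z + s • v) v 0 := by
    simpa using ((hasDerivAt_id (0 : ℝ)).smul_const v).const_add z
  have h1 := hd.hasFDerivAt.comp_hasDerivAt (0 : ℝ) hl
  have e : (candidate I b B (c, 0, 0)) ∘ (fun s : ℝ => z + s • v) = fun s =>
      ![0, c 1 + c 0 * z 0, c 3 + c 2 * B (z 0),
        (c 4 - c 0 / 2 * (z 1 + s * v 1) - c 2 / 2 * (z 2 + s * v 2)) * (z 3 + s * v 3)] := by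
    funext s
    have hm : z + s • v ∈ slab 3 I := by simpa [slab, hv] using hz
    rw [Function.comp_apply, candidate_of_mem b B _ hm]
    ext k
    fin_cases k <;> simp [quad, quadDeriv, yScale, yScaleDeriv, hv]
    left
    ring
  rw [e] at h1
  simp only [zero_smul, add_zero] at h1
  refine h1.unique (hasDerivAt_pi.2 fun k => ?_)
  have hs := hasDerivAt_id (0 : ℝ)
  fin_cases k
  · exact hasDerivAt_const _ _
  · exact hasDerivAt_const _ _
  · exact hasDerivAt_const _ _
  · have h3 := ((((hs.mul_const (v 1)).const_add (z 1)).const_mul (c 0 / 2)).const_sub (c 4)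
      |>.sub (((hs.mul_const (v 2)).const_add (z 2)).const_mul (c 2 / 2))).mul
        ((hs.mul_const (v 3)).const_add (z 3))
    refine h3.congr_deriv ?_
    simp
    left
    ring

theorem lieBracket_candidate (hI : IsOpen I) (hb : IsCoefficient I b)
    (hB : ∀ t ∈ I, HasDerivAt B (b t) t) (c d : Fin 5 → ℝ) :
    VectorField.lieBracket ℝ (candidate I b B (c, 0, 0)) (candidate I b B (d, 0, 0)) =
      candidate I b B
        (Pi.single 4 ((c 0 * d 1 - c 1 * d 0 + c 2 * d 3 - c 3 * d 2) / 2), 0, 0) := by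
  rw [VectorField.lieBracket_eq]
  funext z
  by_cases hz : z ∈ slab 3 I
  · have h0 : ∀ e : Fin 5 → ℝ, candidate I b B (e, 0, 0) z 0 = 0 := fun e => by
      rw [candidate_of_mem b B _ hz]
      simp [quad]
    simp only [fderiv_candidate_apply hI hb hB _ hz (h0 _)]
    simp only [candidate_of_mem b B _ hz]
    ext k
    fin_cases k <;> simp [quad, quadDeriv, yScale, yScaleDeriv]
    ring
  · simp [candidate_of_notMem b B _ hz]

theorem heisenbergRelations_h2Fields (hI : IsOpen I) (hb : IsCoefficient I b)
    (hB : ∀ t ∈ I, HasDerivAt B (b t) t) :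
    HeisenbergRelations ![h2Fields I B 0, h2Fields I B 2]
      ![(2 : ℝ) • h2Fields I B 1, (2 : ℝ) • h2Fields I B 3] (h2Fields I B 4) := by
  have e0 : candidate I b B (0, 0, 0) = 0 := map_zero _
  have e2 : ∀ i, (2 : ℝ) • h2Fields I B i = candidate I b B (Pi.single i 2, 0, 0) := fun i => by
    rw [h2Fields_eq_candidate I b B i, ← map_smul]
    simp [← Pi.single_smul]
  simp only [e2]
  simp only [h2Fields_eq_candidate I b B]
  constructor
  · intro i j
    fin_cases i <;> fin_cases j <;> simp [lieBracket_candidate hI hb hB, e0]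
  · intro i j
    fin_cases i <;> fin_cases j <;> simp [lieBracket_candidate hI hb hB, e0]
  · intro i j
    fin_cases i <;> fin_cases j <;> simp [lieBracket_candidate hI hb hB, e0]
  · intro i
    fin_cases i <;> simp [lieBracket_candidate hI hb hB, e0]

end Heisenberg

/-! ### Coefficients with vanishing Schwarzian derivative -/

section Explicit

variable {I : Set ℝ} {b : ℝ → ℝ}

theorem hasDerivAt_inv_sq (c p q : ℝ) {t : ℝ} (h : p * t + q ≠ 0) (n : ℕ) :
    HasDerivAt (fun t => c * ((p * t + q) ^ n)⁻¹) (-(n * c * p) * ((p * t + q) ^ (n + 1))⁻¹) t := by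
  have h1 := (((hasDerivAt_id t).const_mul p).add_const q)
  have h2 := ((h1.pow n).inv (pow_ne_zero n h)).const_mul c
  refine h2.congr_deriv ?_
  simp only [id, Pi.pow_apply]
  rcases n with _ | n
  · simp
  · field_simp
    simp
    ring

theorem deriv_inv_sq (hI : IsOpen I) {c p q : ℝ}
    (h : ∀ t ∈ I, p * t + q ≠ 0 ∧ b t = c * ((p * t + q) ^ 2)⁻¹) {t : ℝ} (ht : t ∈ I) :
    deriv b t = -(2 * c * p) * ((p * t + q) ^ 3)⁻¹ ∧
      deriv (deriv b) t = 6 * c * p ^ 2 * ((p * t + q) ^ 4)⁻¹ := by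
  have h1 : ∀ t ∈ I, deriv b t = -(2 * c * p) * ((p * t + q) ^ 3)⁻¹ := fun t ht => by
    have := (hasDerivAt_congr_on hI (fun t ht => (h t ht).2) ht
      (hasDerivAt_inv_sq c p q (h t ht).1 2)).deriv
    simpa using this
  refine ⟨h1 t ht, ?_⟩
  have := (hasDerivAt_congr_on hI h1 ht (hasDerivAt_inv_sq _ p q (h t ht).1 3)).deriv
  rw [this]
  push_cast
  ring

theorem schwarz_inv_sq (hI : IsOpen I) {c p q : ℝ}
    (h : ∀ t ∈ I, p * t + q ≠ 0 ∧ b t = c * ((p * t + q) ^ 2)⁻¹) {t : ℝ} (ht : t ∈ I) :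
    schwarz b t = 0 := by
  have hne := (h t ht).1
  rw [schwarz, (deriv_inv_sq hI h ht).1, (deriv_inv_sq hI h ht).2, (h t ht).2]
  field_simp
  ring

/-- The Schwarzian derivative vanishes exactly if `b^(-1/2)` is affine. -/
theorem exists_eq_inv_sq_of_schwarz (hI : IsOpen I) (hc : IsPreconnected I)
    (hb : IsCoefficient I b) (h : ∀ t ∈ I, schwarz b t = 0) :
    ∃ p q : ℝ, ∀ t ∈ I, 0 < p * t + q ∧ b t = ((p * t + q) ^ 2)⁻¹ := by
  obtain ⟨q, p, hpq⟩ := eqOn_affine_of_hasDerivAt hI hc (b := fun _ => 1) (B := fun t => t)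
    (f := fun t => 1 / √(b t)) (h := fun t => -2 * (deriv b t / (4 * b t * √(b t))))
    (fun t _ => hasDerivAt_id t)
    (fun t ht => (hasDerivAt_inv_sqrt_coefficient hI hb ht).congr_deriv (by
      have hpos := hb.2 t ht
      have hr : 0 < √(b t) := Real.sqrt_pos.2 hpos
      field_simp
      ring))
    (fun t ht => ((hasDerivAt_deriv_inv_sqrt hI hb ht).const_mul (-2)).congr_deriv (by
      rw [h t ht]
      simp))
  refine ⟨p, q, fun t ht => ?_⟩
  have hpos := hb.2 t ht
  have hr : 0 < √(b t) := Real.sqrt_pos.2 hpos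
  have e : p * t + q = 1 / √(b t) := by linarith [(hpq t ht).1]
  rw [e]
  refine ⟨by positivity, ?_⟩
  rw [div_pow, Real.sq_sqrt hpos.le]
  simp

theorem schwarz_eq_zero_iff (hI : IsOpen I) (hc : IsPreconnected I) (hb : IsCoefficient I b) :
    (∀ t ∈ I, schwarz b t = 0) ↔ (∃ c : ℝ, 0 < c ∧ ∀ t ∈ I, b t = c) ∨
      (∃ c t₀ : ℝ, 0 < c ∧ ∀ t ∈ I, t ≠ t₀ ∧ b t = c / (t - t₀) ^ 2) := by
  constructor
  · intro h
    obtain ⟨p, q, hpq⟩ := exists_eq_inv_sq_of_schwarz hI hc hb h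
    by_cases hp : p = 0
    · left
      rcases I.eq_empty_or_nonempty with rfl | ⟨t, ht⟩
      · exact ⟨1, one_pos, by simp⟩
      · have hq : 0 < q := by simpa [hp] using (hpq t ht).1
        exact ⟨(q ^ 2)⁻¹, by positivity, fun t ht => by simpa [hp] using (hpq t ht).2⟩
    · right
      refine ⟨(p ^ 2)⁻¹, -q / p, by positivity, fun t ht => ?_⟩
      obtain ⟨h1, h2⟩ := hpq t ht
      have e : t - -q / p = (p * t + q) / p := by
        field_simp
        ring
      refine ⟨fun h0 => ?_, ?_⟩
      · rw [← sub_eq_zero, e] at h0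
        exact div_ne_zero h1.ne' hp h0
      · rw [h2, e]
        field_simp
  · rintro (⟨c, hc0, h⟩ | ⟨c, t₀, hc0, h⟩) t ht
    · exact schwarz_inv_sq hI (c := c) (p := 0) (q := 1)
        (fun t ht => ⟨by simp, by simp [h t ht]⟩) ht
    · exact schwarz_inv_sq hI (c := c) (p := 1) (q := -t₀) (fun t ht => by
        obtain ⟨h1, h2⟩ := h t ht
        refine ⟨?_, ?_⟩
        · rw [one_mul, ← sub_eq_add_neg]
          exact sub_ne_zero.2 h1
        · rw [h2, one_mul, ← sub_eq_add_neg, div_eq_mul_inv]) ht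

end Explicit

/-! ### Power functions -/

section Power

variable {I : Set ℝ} {b B : ℝ → ℝ} {β α : ℝ}

theorem isCoefficient_power (hβ : 0 < β)
    (h : ∀ t ∈ I, 0 < t ∧ b t = β * t ^ α) : IsCoefficient I b := by
  refine ⟨ContDiffOn.congr (f := fun t => β * t ^ α) (fun t ht => ?_) fun t ht => (h t ht).2,
    fun t ht => ?_⟩
  · exact (contDiffAt_const.mul
      (Real.contDiffAt_rpow_const_of_ne (h t ht).1.ne')).contDiffWithinAt
  · rw [(h t ht).2]
    exact mul_pos hβ (Real.rpow_pos_of_pos (h t ht).1 α)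

theorem deriv_power (hI : IsOpen I) (hβ : 0 < β) (h : ∀ t ∈ I, 0 < t ∧ b t = β * t ^ α) {t : ℝ}
    (ht : t ∈ I) : deriv b t = α * b t / t ∧ deriv (deriv b) t = α * (α - 1) * b t / t ^ 2 ∧
      deriv (deriv (deriv b)) t = α * (α - 1) * (α - 2) * b t / t ^ 3 := by
  have hb := isCoefficient_power hβ h
  have h1 : ∀ t ∈ I, deriv b t = α * b t / t := fun t ht => by
    have ht0 := (h t ht).1
    have := (hasDerivAt_congr_on hI (fun t ht => (h t ht).2) ht
      ((Real.hasDerivAt_rpow_const (p := α) (Or.inl ht0.ne')).const_mul β)).deriv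
    rw [this, (h t ht).2, Real.rpow_sub_one ht0.ne']
    ring
  have hbt : ∀ t ∈ I, HasDerivAt b (α * b t / t) t := fun t ht => by
    rw [← h1 t ht]
    exact hb.1.hasDerivAt_of_mem hI ht
  have h2 : ∀ t ∈ I, deriv (deriv b) t = α * (α - 1) * b t / t ^ 2 := fun t ht => by
    have ht0 := (h t ht).1.ne'
    rw [(hasDerivAt_congr_on hI h1 ht
      (((hbt t ht).const_mul α).div (hasDerivAt_id t) ht0)).deriv]
    field_simp
  refine ⟨h1 t ht, h2 t ht, ?_⟩
  have ht0 := (h t ht).1.ne'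
  rw [(hasDerivAt_congr_on hI h2 ht (((hbt t ht).const_mul (α * (α - 1))).div
    ((hasDerivAt_id t).pow 2) (pow_ne_zero 2 ht0))).deriv]
  simp
  field_simp

theorem schwarz_power (hI : IsOpen I) (hβ : 0 < β) (h : ∀ t ∈ I, 0 < t ∧ b t = β * t ^ α) {t : ℝ}
    (ht : t ∈ I) : schwarz b t = -(α * (α + 2)) * b t ^ 2 / t ^ 2 := by
  obtain ⟨h1, h2, -⟩ := deriv_power hI hβ h ht
  have ht0 := (h t ht).1.ne'
  rw [schwarz, h1, h2]
  field_simp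
  ring

theorem projCond_power (hI : IsOpen I) (hβ : 0 < β) (h : ∀ t ∈ I, 0 < t ∧ b t = β * t ^ α)
    (w : Fin 3 → ℝ) {t : ℝ} (ht : t ∈ I) :
    projCond b w t = α * (α + 2) * b t ^ 3 / t ^ 3 * (w 0 - w 2 * t ^ 2) := by
  obtain ⟨h1, h2, h3⟩ := deriv_power hI hβ h ht
  have ht0 := (h t ht).1.ne'
  rw [projCond, schwarz_power hI hβ h ht, schwarzDeriv, h1, h2, h3, quad, quadDeriv]
  field_simp
  ring

/-- The coordinates of the scaling field of a power function. -/
noncomputable def scalingParams (α : ℝ) : Params := (Pi.single 4 ((α + 2) / 2), 0, Pi.single 1 2)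

theorem scalingField_eq_candidate (hI : IsOpen I) (hβ : 0 < β)
    (h : ∀ t ∈ I, 0 < t ∧ b t = β * t ^ α) :
    scalingField I α = candidate I b B (scalingParams α) := by
  funext z
  by_cases hz : z ∈ slab 3 I
  · obtain ⟨h1, h2, -⟩ := deriv_power hI hβ h hz
    have ht0 := (h _ hz).1.ne'
    have hb0 := ((isCoefficient_power hβ h).2 _ hz).ne'
    have ey : yScale b (Pi.single 1 2) (z 0) = α + 1 := by
      simp [yScale, quad, quadDeriv, h1]
      field_simp
      ring
    have ey' : yScaleDeriv b (Pi.single 1 2) (z 0) = 0 := by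
      simp [yScaleDeriv, quad, quadDeriv, h1, h2]
      field_simp
      ring
    rw [scalingField, slabField_of_mem hz, candidate_of_mem b B _ hz]
    simp only [scalingParams, ey, ey']
    ext k
    fin_cases k <;> simp [quad, quadDeriv]
    left
    ring
  · rw [scalingField, slabField_of_notMem hz, candidate_of_notMem b B _ hz]

theorem scalingParams_mem (hI : IsOpen I) (hβ : 0 < β) (h : ∀ t ∈ I, 0 < t ∧ b t = β * t ^ α) :
    scalingParams α ∈ admissible I b :=
  mem_admissible.2 fun t ht => by simp [projCond_power hI hβ h _ ht, scalingParams]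

theorem snoc_h2Fields_eq (hI : IsOpen I) (hβ : 0 < β) (h : ∀ t ∈ I, 0 < t ∧ b t = β * t ^ α) :
    (Fin.snoc (h2Fields I B) (scalingField I α) : Fin 6 → VField) = fun i => candidate I b B
      ((Fin.snoc (fun j : Fin 5 => ((Pi.single j 1, 0, 0) : Params)) (scalingParams α) :
        Fin 6 → Params) i) := by
  rw [funext (h2Fields_eq_candidate I b B), scalingField_eq_candidate (B := B) hI hβ h]
  funext i
  refine Fin.lastCases ?_ (fun j => ?_) i
  · simp only [Fin.snoc_last]
  · simp only [Fin.snoc_castSucc]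

theorem isSymmetryBasis_power (hI : IsOpen I) (hc : IsPreconnected I) (hne : I.Nonempty)
    (hβ : 0 < β) (h : ∀ t ∈ I, 0 < t ∧ b t = β * t ^ α) (hB : ∀ t ∈ I, HasDerivAt B (b t) t)
    (h0 : α ≠ 0) (h2 : α ≠ -2) :
    IsSymmetryBasis I b (Fin.snoc (h2Fields I B) (scalingField I α) : Fin 6 → VField) := by
  have hb := isCoefficient_power hβ h
  have hα : α * (α + 2) ≠ 0 := mul_ne_zero h0 fun h => h2 (by linarith)
  rw [snoc_h2Fields_eq hI hβ h]
  refine isSymmetryBasis_candidate hI hc hne hb hB ?_ ?_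
  · refine linearIndependent_finSnoc.2 ⟨linearIndependent_single_params, ?_⟩
    rw [span_single_params]
    rintro ⟨c, hc'⟩
    have := congrFun (congrArg (fun p : Params => p.2.2) hc') 1
    simp [scalingParams] at this
  · rw [Fin.range_snoc, Submodule.span_insert, span_single_params]
    refine le_antisymm (sup_le ?_ ?_) ?_
    · rw [Submodule.span_singleton_le_iff_mem]
      exact scalingParams_mem hI hβ h
    · rintro _ ⟨c, rfl⟩
      exact mem_admissible.2 fun t _ => by simp [projCond, quad, quadDeriv]
    · rintro ⟨c, k, w⟩ hp
      have hp' := fun t ht => (mem_admissible.1 hp) t ht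
      obtain ⟨t, ht⟩ := id hne
      have ht0 := (h t ht).1
      have hbt := hb.2 t ht
      have hk : k = 0 := by
        refine (mul_eq_zero.1 (hp' t ht).1).resolve_right ?_
        rw [schwarz_power hI hβ h ht]
        have : α * (α + 2) * b t ^ 2 / t ^ 2 ≠ 0 :=
          div_ne_zero (mul_ne_zero hα (by positivity)) (by positivity)
        rw [neg_mul, neg_div]
        exact neg_ne_zero.2 this
      have hw := quad_eq_zero hI hne (w := ![w 0, 0, -w 2]) fun t ht => by
        have e := (hp' t ht).2
        have ht0 := (h t ht).1
        have hbt := hb.2 t ht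
        simp only [projCond_power hI hβ h w ht] at e
        have e2 := (mul_eq_zero.1 e).resolve_left
          (div_ne_zero (mul_ne_zero hα (by positivity)) (by positivity))
        simp [quad]
        linarith
      have w0 : w 0 = 0 := congrFun hw 0
      have w2 : w 2 = 0 := neg_eq_zero.1 (congrFun hw 2)
      refine Submodule.mem_sup.2 ⟨(w 1 / 2) • scalingParams α,
        Submodule.smul_mem _ _ (Submodule.mem_span_singleton_self _),
        _, ⟨c - (w 1 / 2) • Pi.single 4 ((α + 2) / 2), rfl⟩, ?_⟩
      refine Prod.ext ?_ (Prod.ext ?_ ?_)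
      · simp [scalingParams]
      · simp [scalingParams, hk]
      · ext j
        fin_cases j <;> simp [scalingParams, w0, w2]

theorem exists_isSymmetryBasis_power (hI : IsOpen I) (hc : IsPreconnected I) (hne : I.Nonempty)
    (hβ : 0 < β) (h : ∀ t ∈ I, 0 < t ∧ b t = β * t ^ α) (hB : ∀ t ∈ I, HasDerivAt B (b t) t)
    (hα : α = 0 ∨ α = -2) :
    ∃ Y : Fin 3 → VField, IsSymmetryBasis I b
      (Fin.append (Fin.snoc (h2Fields I B) (scalingField I α) : Fin 6 → VField) Y) := by
  have hb := isCoefficient_power hβ h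
  have hS : ∀ t ∈ I, schwarz b t = 0 := fun t ht => by
    rw [schwarz_power hI hβ h ht]
    rcases hα with rfl | rfl <;> simp
  let y : Fin 3 → Params := ![(0, 1, 0), (0, 0, Pi.single 0 1), (0, 0, Pi.single 2 1)]
  let x : Fin 6 → Params :=
    Fin.snoc (fun j : Fin 5 => ((Pi.single j 1, 0, 0) : Params)) (scalingParams α)
  refine ⟨fun i => candidate I b B (y i), ?_⟩
  have e : Fin.append (Fin.snoc (h2Fields I B) (scalingField I α) : Fin 6 → VField)
      (fun i => candidate I b B (y i)) = fun i => candidate I b B (Fin.append x y i) := by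
    rw [snoc_h2Fields_eq hI hβ h]
    funext i
    refine Fin.addCases (fun j => ?_) (fun j => ?_) i
    · simp [x]
    · simp
  rw [e]
  have htop : ⊤ ≤ Submodule.span ℝ (Set.range (Fin.append x y)) := by
    have hx : ∀ i, x i ∈ Submodule.span ℝ (Set.range (Fin.append x y)) := fun i =>
      Submodule.subset_span ⟨Fin.castAdd 3 i, by simp⟩
    have hy : ∀ i, y i ∈ Submodule.span ℝ (Set.range (Fin.append x y)) := fun i =>
      Submodule.subset_span ⟨Fin.natAdd 6 i, by simp⟩
    have hinl : ∀ c : Fin 5 → ℝ,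
        ((c, 0, 0) : Params) ∈ Submodule.span ℝ (Set.range (Fin.append x y)) := by
      intro c
      have h1 : ((c, 0, 0) : Params) ∈ Submodule.span ℝ (Set.range fun i : Fin 5 =>
          ((Pi.single i 1, 0, 0) : Params)) := by
        rw [span_single_params]
        exact ⟨c, rfl⟩
      refine (Submodule.span_le.2 ?_) h1
      rintro _ ⟨i, rfl⟩
      refine SetLike.mem_coe.2 ?_
      simpa only [x, Fin.snoc_castSucc] using hx i.castSucc
    rintro ⟨c, k, w⟩ -
    have hlast := hx (Fin.last 5)
    simp only [x, Fin.snoc_last] at hlast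
    have hsum := add_mem (add_mem (add_mem (add_mem
      (hinl (c - (w 1 / 2) • Pi.single 4 ((α + 2) / 2)))
      (Submodule.smul_mem _ (w 1 / 2) hlast)) (Submodule.smul_mem _ k (hy 0)))
      (Submodule.smul_mem _ (w 0) (hy 1))) (Submodule.smul_mem _ (w 2) (hy 2))
    convert hsum using 1
    refine Prod.ext ?_ (Prod.ext ?_ ?_)
    · simp [scalingParams, y]
    · simp [scalingParams, y]
    · ext j
      fin_cases j <;> simp [scalingParams, y]
  refine isSymmetryBasis_candidate hI hc hne hb hB
    (linearIndependent_of_top_le_span_of_card_eq_finrank htop (by simp)) ?_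
  rw [admissible_eq_top hI hb hS]
  exact top_le_iff.1 htop

end Power

/-! ### The transformation to constant coefficients -/

section Transform

variable {I : Set ℝ} {b K : ℝ → ℝ} {v : (Fin 3 → ℝ) → ℝ}

/-- The new independent variables `(t, x, y / √b(t))`. -/
noncomputable def rescale (b : ℝ → ℝ) (z : Fin 3 → ℝ) : Fin 3 → ℝ :=
  ![z 0, z 1, z 2 / √(b (z 0))]

/-- The factor `K(t) exp(-(b'/b²) y²/8)` of the transformation. -/
noncomputable def transformFactor (b K : ℝ → ℝ) (z : Fin 3 → ℝ) : ℝ :=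
  K (z 0) * Real.exp (-(deriv b (z 0) / b (z 0) ^ 2) * (z 2 ^ 2 / 8))

theorem pointTransform_eq (b K : ℝ → ℝ) (v : (Fin 3 → ℝ) → ℝ) (z : Fin 3 → ℝ) :
    pointTransform b K v z = transformFactor b K z * v (rescale b z) := rfl

theorem contDiffAt_pointTransform (hI : IsOpen I) (hb : IsCoefficient I b)
    (hK : ContDiffOn ℝ ∞ K I) (hv : ∀ z ∈ slab 2 I, ContDiffAt ℝ ∞ v z) {z : Fin 3 → ℝ}
    (hz : z ∈ slab 2 I) : ContDiffAt ℝ ∞ (pointTransform b K v) z := by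
  have hproj : ∀ k : Fin 3, ContDiffAt ℝ ∞ (fun w : Fin 3 → ℝ => w k) z := fun k =>
    contDiffAt_pi.1 contDiffAt_id k
  have lift : ∀ f : ℝ → ℝ, ContDiffOn ℝ ∞ f I →
      ContDiffAt ℝ ∞ (fun w : Fin 3 → ℝ => f (w 0)) z := fun f hf =>
    (hf.contDiffAt (hI.mem_nhds hz)).comp z (hproj 0)
  have hpos := hb.2 _ hz
  have f0 := lift b hb.1
  have f1 := lift _ (hb.1.deriv_contDiffOn hI)
  have fK := lift K hK
  have fr : ContDiffAt ℝ ∞ (fun w : Fin 3 → ℝ => √(b (w 0))) z := f0.sqrt hpos.ne'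
  have hr : √(b (z 0)) ≠ 0 := (Real.sqrt_pos.2 hpos).ne'
  have hψ : ContDiffAt ℝ ∞ (rescale b) z := by
    refine contDiffAt_pi.2 fun k => ?_
    fin_cases k
    · exact hproj 0
    · exact hproj 1
    · exact (hproj 2).div fr hr
  have hg := fK.mul ((f1.div (f0.pow 2) (pow_ne_zero 2 hpos.ne')).neg.mul
    (((hproj 2).pow 2).div_const 8)).exp
  exact hg.mul ((hv (rescale b z) hz).comp z hψ)

theorem pd_one_pointTransform (hI : IsOpen I) (hb : IsCoefficient I b)
    (hK : ContDiffOn ℝ ∞ K I) (hv : ∀ z ∈ slab 2 I, ContDiffAt ℝ ∞ v z) {z : Fin 3 → ℝ}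
    (hz : z ∈ slab 2 I) :
    pd 1 (pointTransform b K v) z = pointTransform b K (pd 1 v) z := by
  refine pd_eq_of_line (contDiffAt_pointTransform hI hb hK hv hz).diff ?_
  have hc := hasDerivAt_comp_curve (v := v) (s := z 1)
    (c := fun s => ![z 0, s, z 2 / √(b (z 0))]) (c' := ![0, 1, 0])
    (hv (rescale b z) hz).diff
    (fun j => by
      fin_cases j
      · exact hasDerivAt_const _ _
      · exact hasDerivAt_id _
      · exact hasDerivAt_const _ _)
  have h := hc.const_mul (transformFactor b K z)
  simp only [Fin.sum_univ_three] at h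
  simp at h
  simp only [pointTransform_eq]
  exact h

theorem pd_two_pointTransform (hI : IsOpen I) (hb : IsCoefficient I b)
    (hK : ContDiffOn ℝ ∞ K I) (hv : ∀ z ∈ slab 2 I, ContDiffAt ℝ ∞ v z) {z : Fin 3 → ℝ}
    (hz : z ∈ slab 2 I) :
    pd 2 (pointTransform b K v) z =
      -(deriv b (z 0) / (4 * b (z 0) ^ 2)) * (z 2 * pointTransform b K v z)
        + 1 / √(b (z 0)) * pointTransform b K (pd 2 v) z := by
  refine pd_eq_of_line (contDiffAt_pointTransform hI hb hK hv hz).diff ?_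
  have hc := hasDerivAt_comp_curve (v := v) (s := z 2)
    (c := fun s => ![z 0, z 1, s / √(b (z 0))]) (c' := ![0, 0, 1 / √(b (z 0))])
    (hv (rescale b z) hz).diff
    (fun j => by
      fin_cases j
      · exact hasDerivAt_const _ _
      · exact hasDerivAt_const _ _
      · exact (hasDerivAt_id _).div_const _)
  have hg := (((((hasDerivAt_id (z 2)).pow 2).div_const 8).const_mul
    (-(deriv b (z 0) / b (z 0) ^ 2))).exp).const_mul (K (z 0))
  have h := hg.mul hc
  refine h.congr_deriv ?_
  simp [Fin.sum_univ_three, pointTransform_eq, transformFactor, rescale]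
  ring

theorem pd_zero_pointTransform (hI : IsOpen I) (hb : IsCoefficient I b)
    (hK : ContDiffOn ℝ ∞ K I) (hK0 : ∀ t ∈ I, K t ≠ 0)
    (hv : ∀ z ∈ slab 2 I, ContDiffAt ℝ ∞ v z) {z : Fin 3 → ℝ} (hz : z ∈ slab 2 I) :
    pd 0 (pointTransform b K v) z = pointTransform b K (pd 0 v) z
      - z 2 * (deriv b (z 0) / (2 * b (z 0) * √(b (z 0)))) * pointTransform b K (pd 2 v) z
      + (deriv K (z 0) / K (z 0) - (b (z 0) * deriv (deriv b) (z 0) - 2 * deriv b (z 0) ^ 2)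
          / (8 * b (z 0) ^ 3) * z 2 ^ 2) * pointTransform b K v z := by
  refine pd_eq_of_line (contDiffAt_pointTransform hI hb hK hv hz).diff ?_
  have hpos := hb.2 _ hz
  have hr : 0 < √(b (z 0)) := Real.sqrt_pos.2 hpos
  have hK1 := hK0 _ hz
  have h0 := hb.1.hasDerivAt_of_mem hI hz
  have h1 := (hb.1.deriv_contDiffOn hI).hasDerivAt_of_mem hI hz
  have hc := hasDerivAt_comp_curve (v := v) (s := z 0)
    (c := fun s => ![s, z 1, z 2 / √(b s)])
    (c' := ![1, 0, z 2 * -(deriv b (z 0) / (2 * b (z 0) * √(b (z 0))))])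
    (hv (rescale b z) hz).diff
    (fun j => by
      fin_cases j
      · exact hasDerivAt_id _
      · exact hasDerivAt_const _ _
      · simpa [div_eq_mul_inv] using
          (hasDerivAt_inv_sqrt_coefficient hI hb hz).const_mul (z 2))
  have hg := (hK.hasDerivAt_of_mem hI hz).mul
    (((h1.div (h0.pow 2) (pow_ne_zero 2 hpos.ne')).neg.mul_const (z 2 ^ 2 / 8)).exp)
  have h := hg.mul hc
  refine h.congr_deriv ?_
  simp [Fin.sum_univ_three, pointTransform_eq, transformFactor, rescale]
  field_simp
  ring

/-- The equation for `u`, in terms of `v`: besides the transformed equation there remains a term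
without derivatives of `v`, which is a polynomial of degree two in `y`. -/
theorem residual_pointTransform (hI : IsOpen I) (hb : IsCoefficient I b)
    (hK : ContDiffOn ℝ ∞ K I) (hK0 : ∀ t ∈ I, K t ≠ 0)
    (hv : ∀ z ∈ slab 2 I, ContDiffAt ℝ ∞ v z) {z : Fin 3 → ℝ} (hz : z ∈ slab 2 I) :
    pd 0 (pointTransform b K v) z - (pd 1 (pd 1 (pointTransform b K v)) z
        + b (z 0) * pd 2 (pd 2 (pointTransform b K v)) z) =
      transformFactor b K z * (pd 0 v (rescale b z) -
        (pd 1 (pd 1 v) (rescale b z) + 1 * pd 2 (pd 2 v) (rescale b z))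
        + v (rescale b z) * (deriv K (z 0) / K (z 0) + deriv b (z 0) / (4 * b (z 0))
          - z 2 ^ 2 * (schwarz b (z 0) / (16 * b (z 0) ^ 3)))) := by
  have hpos := hb.2 _ hz
  have hr : 0 < √(b (z 0)) := Real.sqrt_pos.2 hpos
  have hs := Real.sq_sqrt hpos.le
  have hpd : ∀ i, ∀ z ∈ slab 2 I, ContDiffAt ℝ ∞ (pd i v) z := fun i z hz =>
    contDiffAt_pd' (hv z hz) i
  have e11 : pd 1 (pd 1 (pointTransform b K v)) z = pointTransform b K (pd 1 (pd 1 v)) z := by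
    rw [pd_congr_of_eqOn (isOpen_slab 2 hI)
      (fun w hw => pd_one_pointTransform hI hb hK hv hw) 1 hz]
    exact pd_one_pointTransform hI hb hK (hpd 1) hz
  have e22 : pd 2 (pd 2 (pointTransform b K v)) z =
      -(deriv b (z 0) / (4 * b (z 0) ^ 2)) * (pointTransform b K v z
        + z 2 * pd 2 (pointTransform b K v) z)
      + 1 / √(b (z 0)) * pd 2 (pointTransform b K (pd 2 v)) z := by
    refine pd_eq_of_line (contDiffAt_pd' (contDiffAt_pointTransform hI hb hK hv hz) 2).diff ?_
    have l1 := hasDerivAt_line (g := pointTransform b K v) (z := z) (i := 2) (s := z 2)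
      (by simpa using (contDiffAt_pointTransform hI hb hK hv hz).diff)
    have l2 := hasDerivAt_line (g := pointTransform b K (pd 2 v)) (z := z) (i := 2) (s := z 2)
      (by simpa using (contDiffAt_pointTransform hI hb hK (hpd 2) hz).diff)
    have h := (((hasDerivAt_id (z 2)).mul l1).const_mul (-(deriv b (z 0) / (4 * b (z 0) ^ 2)))).add
      (l2.const_mul (1 / √(b (z 0))))
    have e : (fun s => pd 2 (pointTransform b K v) (Function.update z 2 s)) = fun s =>
        -(deriv b (z 0) / (4 * b (z 0) ^ 2)) *
          (s * pointTransform b K v (Function.update z 2 s))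
        + 1 / √(b (z 0)) * pointTransform b K (pd 2 v) (Function.update z 2 s) := by
      funext s
      rw [pd_two_pointTransform hI hb hK hv (update_mem_slab hz (by decide) s)]
      simp
    rw [e]
    refine h.congr_deriv ?_
    simp
  rw [pd_zero_pointTransform hI hb hK hK0 hv hz, e11, e22, pd_two_pointTransform hI hb hK hv hz,
    pd_two_pointTransform hI hb hK (hpd 2) hz]
  simp only [pointTransform_eq, schwarz]
  have hK1 := hK0 _ hz
  generalize √(b (z 0)) = r at *
  rw [← hs]
  field_simp
  ring

theorem mapsToStandard_iff (hI : IsOpen I) (hb : IsCoefficient I b)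
    (hK : ContDiffOn ℝ ∞ K I) (hK0 : ∀ t ∈ I, K t ≠ 0) :
    MapsToStandard I b K ↔ ∀ t ∈ I, 4 * b t * deriv K t + K t * deriv b t = 0 ∧
      2 * b t * deriv (deriv b) t = 3 * deriv b t ^ 2 := by
  have hfac : ∀ z ∈ slab 2 I, transformFactor b K z ≠ 0 := fun z hz =>
    mul_ne_zero (hK0 _ hz) (Real.exp_pos _).ne'
  have hcont : ∀ v : (Fin 3 → ℝ) → ℝ, ContDiffOn ℝ ∞ v (slab 2 I) →
      ∀ z ∈ slab 2 I, ContDiffAt ℝ ∞ v z := fun v hv z hz =>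
    hv.contDiffAt ((isOpen_slab 2 hI).mem_nhds hz)
  constructor
  · intro h t ht
    -- the constant solution detects the term without derivatives
    have hsol : IsSolution I (fun _ => 1) fun _ => 1 :=
      ⟨contDiffOn_const, fun z _ => by
        have : ∀ i : Fin 3, pd i (fun _ : Fin 3 → ℝ => (1 : ℝ)) = fun _ => 0 := fun i => by
          funext w
          simp [pd]
        simp [this]
        simp [pd]⟩
    have hu := ((h _ contDiffOn_const).2 hsol).2
    have key : ∀ y : ℝ, deriv K t / K t + deriv b t / (4 * b t)
        - y ^ 2 * (schwarz b t / (16 * b t ^ 3)) = 0 := by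
      intro y
      have hz : ![t, 0, y] ∈ slab 2 I := ht
      have h1 := residual_pointTransform hI hb hK hK0 (hcont _ contDiffOn_const) hz
        (v := fun _ => (1 : ℝ))
      rw [← hu _ hz, sub_self] at h1
      have h2 := (mul_eq_zero.1 h1.symm).resolve_left (hfac _ hz)
      rw [hsol.2 _ (show rescale b ![t, 0, y] ∈ slab 2 I from ht)] at h2
      simpa using h2
    have hpos := hb.2 t ht
    have hK1 := hK0 t ht
    have k0 := key 0
    have k1 := key 1
    have e1 : deriv K t / K t + deriv b t / (4 * b t) = 0 := by linarith
    have e2 : schwarz b t / (16 * b t ^ 3) = 0 := by linarith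
    constructor
    · field_simp at e1
      linarith
    · have e3 := (div_eq_zero_iff.1 e2).resolve_right (by positivity)
      simp only [schwarz] at e3
      linarith
  · intro h v hv
    have hres : ∀ z ∈ slab 2 I, pd 0 (pointTransform b K v) z
        - (pd 1 (pd 1 (pointTransform b K v)) z
          + b (z 0) * pd 2 (pd 2 (pointTransform b K v)) z) =
        transformFactor b K z * (pd 0 v (rescale b z) -
          (pd 1 (pd 1 v) (rescale b z) + 1 * pd 2 (pd 2 v) (rescale b z))) := by
      intro z hz
      obtain ⟨h1, h2⟩ := h _ hz
      have hpos := hb.2 _ hz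
      have hK1 := hK0 _ hz
      have e1 : deriv K (z 0) / K (z 0) + deriv b (z 0) / (4 * b (z 0)) = 0 := by
        field_simp
        linarith
      have e2 : schwarz b (z 0) = 0 := by
        simp only [schwarz]
        linarith
      rw [residual_pointTransform hI hb hK hK0 (hcont v hv) hz, e1, e2]
      simp
    constructor
    · rintro ⟨-, hu⟩
      refine ⟨hv, fun w hw => ?_⟩
      have hr : 0 < √(b (w 0)) := Real.sqrt_pos.2 (hb.2 _ hw)
      have hz : ![w 0, w 1, √(b (w 0)) * w 2] ∈ slab 2 I := hw
      have e : rescale b ![w 0, w 1, √(b (w 0)) * w 2] = w := by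
        ext k
        fin_cases k <;> simp [rescale]
        field_simp
      have h1 := hres _ hz
      rw [hu _ hz, sub_self, e] at h1
      exact sub_eq_zero.1 ((mul_eq_zero.1 h1.symm).resolve_left (hfac _ hz))
    · rintro ⟨-, hv'⟩
      refine ⟨fun z hz =>
        (contDiffAt_pointTransform hI hb hK (hcont v hv) hz).contDiffWithinAt, fun z hz => ?_⟩
      have h1 := hres z hz
      rw [hv' (rescale b z) hz, sub_self, mul_zero] at h1
      exact sub_eq_zero.1 h1

theorem transform_conditions_iff (hI : IsOpen I) (hc : IsPreconnected I) (hne : I.Nonempty)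
    (hb : IsCoefficient I b) (hK : ContDiffOn ℝ ∞ K I) (hK0 : ∀ t ∈ I, K t ≠ 0) :
    (∀ t ∈ I, 4 * b t * deriv K t + K t * deriv b t = 0 ∧
        2 * b t * deriv (deriv b) t = 3 * deriv b t ^ 2) ↔
      ∃ b₁ b₀ k₀ : ℝ, k₀ ≠ 0 ∧ ∀ t ∈ I, 0 < b₁ * t + b₀ ∧ b t = ((b₁ * t + b₀) ^ 2)⁻¹ ∧
        K t = k₀ * b t ^ (-(1 / 4) : ℝ) ∧ K t = k₀ * Real.sqrt (b₁ * t + b₀) := by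
  have hlin : ∀ b₁ b₀ : ℝ, ∀ t : ℝ, HasDerivAt (fun t => b₁ * t + b₀) b₁ t := fun b₁ b₀ t =>
    (((hasDerivAt_id t).const_mul b₁).add_const b₀).congr_deriv (by simp)
  constructor
  · intro h
    obtain ⟨p, q, hpq⟩ := exists_eq_inv_sq_of_schwarz hI hc hb fun t ht => by
      simp only [schwarz]
      linarith [(h t ht).2]
    obtain ⟨k, hk⟩ := eqOn_const_of_hasDerivAt_zero hI hc (f := fun t => K t / √(p * t + q))
      (fun t ht => by
        obtain ⟨hr, hbt⟩ := hpq t ht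
        have hs : 0 < √(p * t + q) := Real.sqrt_pos.2 hr
        have hsq := Real.sq_sqrt hr.le
        have hb1 := (deriv_inv_sq hI (c := 1) (p := p) (q := q)
          (fun t ht => ⟨(hpq t ht).1.ne', by simpa using (hpq t ht).2⟩) ht).1
        have hd := (hK.hasDerivAt_of_mem hI ht).div ((hlin p q t).sqrt hr.ne') hs.ne'
        refine hd.congr_deriv ?_
        have e := (h t ht).1
        rw [hb1, hbt] at e
        field_simp at e
        field_simp
        rw [hsq]
        linarith)
    have hkt : ∀ t ∈ I, K t = k * √(p * t + q) := fun t ht => by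
      have hs : 0 < √(p * t + q) := Real.sqrt_pos.2 (hpq t ht).1
      rw [← hk t ht]
      field_simp
    refine ⟨p, q, k, ?_, fun t ht => ⟨(hpq t ht).1, (hpq t ht).2, ?_, hkt t ht⟩⟩
    · rintro rfl
      obtain ⟨t, ht⟩ := hne
      exact hK0 t ht (by simpa using hkt t ht)
    · have hr := (hpq t ht).1
      rw [hkt t ht, (hpq t ht).2, ← Real.rpow_natCast, ← Real.rpow_neg hr.le, ← Real.rpow_mul hr.le,
        Real.sqrt_eq_rpow]
      norm_num
  · rintro ⟨p, q, k, hk, h⟩ t ht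
    have hinv : ∀ t ∈ I, p * t + q ≠ 0 ∧ b t = 1 * ((p * t + q) ^ 2)⁻¹ := fun t ht =>
      ⟨(h t ht).1.ne', by simpa using (h t ht).2.1⟩
    obtain ⟨hr, hbt, -, hKt⟩ := h t ht
    have hs : 0 < √(p * t + q) := Real.sqrt_pos.2 hr
    have hsq := Real.sq_sqrt hr.le
    have hb1 := (deriv_inv_sq hI hinv ht).1
    have hK1 := (hasDerivAt_congr_on hI (fun t ht => (h t ht).2.2.2) ht
      (((hlin p q t).sqrt hr.ne').const_mul k)).deriv
    constructor
    · rw [hK1, hb1, hKt, hbt]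
      field_simp
      rw [hsq]
      ring
    · have := schwarz_inv_sq hI hinv ht
      simp only [schwarz] at this
      linarith

end Transform

theorem mainTheorem3 (I : Set ℝ) (hI_open : IsOpen I) (hI_conn : IsPreconnected I)
    (hI_ne : I.Nonempty) :
    -- the transformation to the standard form
    (∀ b K : ℝ → ℝ, IsCoefficient I b → ContDiffOn ℝ ∞ K I → (∀ t ∈ I, K t ≠ 0) →
      (MapsToStandard I b K ↔
        ∀ t ∈ I, 4 * b t * deriv K t + K t * deriv b t = 0 ∧
          2 * b t * deriv (deriv b) t = 3 * deriv b t ^ 2) ∧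
      ((∀ t ∈ I, 4 * b t * deriv K t + K t * deriv b t = 0 ∧
          2 * b t * deriv (deriv b) t = 3 * deriv b t ^ 2) ↔
        ∃ b₁ b₀ k₀ : ℝ, k₀ ≠ 0 ∧ ∀ t ∈ I, 0 < b₁ * t + b₀ ∧ b t = ((b₁ * t + b₀) ^ 2)⁻¹ ∧
          K t = k₀ * b t ^ (-(1 / 4) : ℝ) ∧ K t = k₀ * Real.sqrt (b₁ * t + b₀))) ∧
    -- the coefficients with a nine-dimensional symmetry algebra
    (∀ b : ℝ → ℝ, IsCoefficient I b →
      (symmetryDim I b = 9 ↔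
        (∃ c : ℝ, 0 < c ∧ ∀ t ∈ I, b t = c) ∨
        (∃ c t₀ : ℝ, 0 < c ∧ ∀ t ∈ I, t ≠ t₀ ∧ b t = c / (t - t₀) ^ 2)) ∧
      (symmetryDim I b ≠ 9 → symmetryDim I b ≤ 6)) ∧
    -- every symmetry algebra contains the Heisenberg algebra
    (∀ b B : ℝ → ℝ, IsCoefficient I b → (∀ t ∈ I, HasDerivAt B (b t) t) →
      (∀ i, h2Fields I B i ∈ pointSymmetries I b) ∧
      IndepModSuperposition I b (h2Fields I B) ∧
      HeisenbergRelations ![h2Fields I B 0, h2Fields I B 2]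
        ![(2 : ℝ) • h2Fields I B 1, (2 : ℝ) • h2Fields I B 3] (h2Fields I B 4)) ∧
    -- for generic coefficients there is nothing else: an open condition ...
    (∀ b : ℝ → ℝ, IsCoefficient I b → HasOnlyH2 I b →
      ∃ J ⊆ I, IsCompact J ∧ ∃ N : ℕ, ∃ ε > 0, ∀ b' : ℝ → ℝ, IsCoefficient I b' →
        CkClose J N ε b' b → HasOnlyH2 I b') ∧
    -- ... and a dense one
    (∀ b : ℝ → ℝ, IsCoefficient I b → ∀ J ⊆ I, IsCompact J → ∀ N : ℕ, ∀ ε > 0,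
      ∃ b' : ℝ → ℝ, IsCoefficient I b' ∧ CkClose J N ε b' b ∧ HasOnlyH2 I b') ∧
    -- power functions
    (∀ (b B : ℝ → ℝ) (β α : ℝ), 0 < β → (∀ t ∈ I, 0 < t ∧ b t = β * t ^ α) →
      (∀ t ∈ I, HasDerivAt B (b t) t) →
      scalingField I α ∈ pointSymmetries I b ∧
      (α ≠ 0 → α ≠ -2 →
        IsSymmetryBasis I b (Fin.snoc (h2Fields I B) (scalingField I α) : Fin 6 → VField)) ∧
      (α = 0 ∨ α = -2 →
        ∃ Y : Fin 3 → VField, IsSymmetryBasis I b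
          (Fin.append (Fin.snoc (h2Fields I B) (scalingField I α) : Fin 6 → VField) Y))) := by
  refine ⟨fun b K hb hK hK0 => ⟨mapsToStandard_iff hI_open hb hK hK0,
      transform_conditions_iff hI_open hI_conn hI_ne hb hK hK0⟩, fun b hb => ?_,
    fun b B hb hB => ⟨h2Fields_mem_pointSymmetries hI_open hI_conn hb hB,
      indepModSuperposition_h2Fields hI_open hI_ne hb hB,
      heisenbergRelations_h2Fields hI_open hb hB⟩,
    fun b hb h => hasOnlyH2_of_ckClose hI_open hI_conn hI_ne hb h,
    fun b hb J hJI hJ N ε hε => exists_hasOnlyH2_ckClose hI_open hI_conn hI_ne hb hJI hJ N hε,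
    fun b B β α hβ h hB => ⟨?_, fun h0 h2 =>
      isSymmetryBasis_power hI_open hI_conn hI_ne hβ h hB h0 h2,
      fun hα => exists_isSymmetryBasis_power hI_open hI_conn hI_ne hβ h hB hα⟩⟩
  · rw [← schwarz_eq_zero_iff hI_open hI_conn hb]
    by_cases hS : ∀ t ∈ I, schwarz b t = 0
    · have h9 := symmetryDim_eq_nine hI_open hI_conn hI_ne hb hS
      exact ⟨⟨fun _ => hS, fun _ => h9⟩, fun hn => absurd h9 hn⟩
    · have h6 := symmetryDim_le_six hI_open hI_conn hI_ne hb hS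
      refine ⟨⟨fun h9 => ?_, fun h => absurd h hS⟩, fun _ => h6⟩
      rw [h9] at h6
      exact absurd h6 (by norm_num)
  · rw [scalingField_eq_candidate (B := B) hI_open hβ h]
    exact candidate_mem_pointSymmetries hI_open hI_conn (isCoefficient_power hβ h) hB
      (scalingParams_mem hI_open hβ h)
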